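/- **Definitions.** Let $G$ be a finite directed graph with a set $V^\infty\subseteq V(G)$ of distinguished (undeletable) vertices and a set $T\subseteq V^\infty$ of terminals. For disjoint non-empty sets $X,Y\subseteq V(G)$, an *$X$–$Y$ separator* is a set $S\subseteq V(G)\setminus(X\cup Y\cup V^\infty)$ such that $G\setminus S$ has no path from $X$ to $Y$; it is *minimal* if no proper subset of it is an $X$–$Y$ separator. Let $R^+_{G\setminus S}(X)$ be the set of vertices reachable from $X$ in $G\setminus S$. A minimal $X$–$Y$ separator $S$ is *important* if there is no $X$–$Y$ separator $S'$ with $|S'|\le|S|$ and $R^+_{G\setminus S}(X)\subsetneq R^+_{G\setminus S'}(X)$. A $v$–$T$ separator is a $\{v\}$–$T$ separator. A set $S\subseteq V(G)\setminus V^\infty$ is *thin* if there is no $v\in S$ for which $S\setminus\{v\}$ is a $v$–$T$ separator. **Theorem (random sampling).** There are a randomized algorithm $\textsc{RandomSet}$ (a program of a random access machine with addition, truncated subtraction, tests for zero, memory access and fair coin tosses, each at unit cost), a polynomial $q$ with coefficients in $\mathbb N$, and a constant $c\in\mathbb N$ such that the following holds for every directed graph $G$ with $n\ge 0$ vertices,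 all sets $T\subseteq V^\infty\subseteq V(G)$, and every integer $p\ge 0$. On the input $(G,V^\infty,T,p)$ (with $G$ given by its adjacency matrix) the algorithm halts within $4^p\cdot q(n)$ steps, whatever the outcomes of its coin tosses, and returns a random set $Z\subseteq V(G)\setminus T$. Moreover, let $S\subseteq V(G)\setminus V^\infty$ be a thin set with $|S|\le p$, and let $Y$ be a set of vertices such that for every $v\in Y$ there is an important $v$–$T$ separator $S'\subseteq S$. Then for every such pair $(S,Y)$ $$\Pr\bigl[\,S\cap Z=\emptyset\ \text{ and }\ Y\subseteq Z\,\bigr]\ \ge\ 2^{-2^{cp}}.$$ -/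

import Mathlib

/-! ## Separators, shadows and thin sets in directed graphs -/

namespace RandomSampling

section Separators

variable {V : Type*} [DecidableEq V]

/-- `reach G S X` is the set of vertices reachable from `X` in the digraph `G \ S`. -/
def reach (G : Digraph V) (S X : Finset V) : Set V :=
  {v | ∃ x ∈ X, x ∉ S ∧ Relation.ReflTransGen (fun a b => G.Adj a b ∧ a ∉ S ∧ b ∉ S) x v}

/-- `S` is an `X`-`Y` separator of `G`, where `D` is the set of distinguished (undeletable)
vertices: `X` and `Y` are disjoint and non-empty, `S ⊆ V \ (X ∪ Y ∪ D)`, and there is no path from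
`X` to `Y` in `G \ S`. -/
structure IsSeparator (G : Digraph V) (D X Y S : Finset V) : Prop where
  left_nonempty : X.Nonempty
  right_nonempty : Y.Nonempty
  disjoint : Disjoint X Y
  avoids : Disjoint S (X ∪ Y ∪ D)
  separates : ∀ y ∈ Y, y ∉ reach G S X

/-- `S` is a separator, and no proper subset of `S` is one. -/
def IsMinimalSeparator (G : Digraph V) (D X Y S : Finset V) : Prop :=
  IsSeparator G D X Y S ∧ ∀ S' : Finset V, S' ⊂ S → ¬ IsSeparator G D X Y S'

/-- `S` is a minimal separator, and no separator of at most the same size has a strictly larger set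
of vertices reachable from `X`. -/
def IsImportantSeparator (G : Digraph V) (D X Y S : Finset V) : Prop :=
  IsMinimalSeparator G D X Y S ∧
    ¬ ∃ S' : Finset V, IsSeparator G D X Y S' ∧ S'.card ≤ S.card ∧ reach G S X ⊂ reach G S' X

/-- The reverse shadow of `S` with respect to `T`. -/
def reverseShadow (G : Digraph V) (D T S : Finset V) : Set V :=
  {v | IsSeparator G D {v} T S}

/-- `S` is thin: no `v ∈ S` is in the reverse shadow of `S \ {v}`. -/
def IsThin (G : Digraph V) (D T S : Finset V) : Prop :=
  ∀ v ∈ S, v ∉ reverseShadow G D T (S.erase v)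

end Separators

/-! ## Randomized random access machines

Programs are structured programs over finitely many variables and finitely many arrays of natural
numbers (the arrays of a program may be thought of as interleaved in a single memory).  The only
arithmetic operations are addition and truncated subtraction, and one unit of time is charged for
every operation, every access to the memory, every test, and every random bit. -/

/-- Expressions: numerals, variables, array cells, sums, truncated differences. -/
inductive Expr : Type
  | const (k : ℕ)
  | var (x : ℕ)
  | get (a : ℕ) (i : Expr)
  | add (e f : Expr)
  | sub (e f : Expr)

/-- Programs.  `coin x` assigns a fresh random bit to the variable `x`; the tests of `ite` and `loop`
(the while loop) ask whether the value of an expression is non-zero. -/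
inductive Prog : Type
  | skip
  | assign (x : ℕ) (e : Expr)
  | store (a : ℕ) (i e : Expr)
  | coin (x : ℕ)
  | seq (P Q : Prog)
  | ite (e : Expr) (P Q : Prog)
  | loop (e : Expr) (P : Prog)

/-- A state: the values of the variables, the contents of the arrays, and the number of random bits
that have been used. -/
@[ext]
structure State where
  var : ℕ → ℕ
  arr : ℕ → ℕ → ℕ
  pos : ℕ

/-- The state after the assignment of `k` to the variable `x`. -/
def State.setVar (s : State) (x k : ℕ) : State :=
  { s with var := Function.update s.var x k }

/-- The state after `k` is written into cell `i` of the array `a`. -/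
def State.setArr (s : State) (a i k : ℕ) : State :=
  { s with arr := Function.update s.arr a (Function.update (s.arr a) i k) }

/-- The state after the random bit `b` is read into the variable `x`. -/
def State.toss (s : State) (x : ℕ) (b : Bool) : State :=
  { s.setVar x b.toNat with pos := s.pos + 1 }

/-- The value of an expression in a state. -/
def Expr.eval (s : State) : Expr → ℕ
  | const k => k
  | var x => s.var x
  | get a i => s.arr a (i.eval s)
  | add e f => e.eval s + f.eval s
  | sub e f => e.eval s - f.eval s

/-- The time for the evaluation of an expression: the number of its nodes. -/
def Expr.cost : Expr → ℕ
  | const _ => 1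
  | var _ => 1
  | get _ i => i.cost + 1
  | add e f => e.cost + f.cost + 1
  | sub e f => e.cost + f.cost + 1

/-- `Exec ω P s t s'`: with `ω` as its sequence of random bits, the program `P`, started in the
state `s`, halts after `t` units of time in the state `s'`. -/
inductive Exec (ω : ℕ → Bool) : Prog → State → ℕ → State → Prop
  | skip (s : State) : Exec ω .skip s 1 s
  | assign (x : ℕ) (e : Expr) (s : State) :
      Exec ω (.assign x e) s (e.cost + 1) (s.setVar x (e.eval s))
  | store (a : ℕ) (i e : Expr) (s : State) :
      Exec ω (.store a i e) s (i.cost + e.cost + 1) (s.setArr a (i.eval s) (e.eval s))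
  | coin (x : ℕ) (s : State) : Exec ω (.coin x) s 1 (s.toss x (ω s.pos))
  | seq {P Q : Prog} {s s' s'' : State} {t u : ℕ} :
      Exec ω P s t s' → Exec ω Q s' u s'' → Exec ω (.seq P Q) s (t + u) s''
  | ite_true {e : Expr} {P Q : Prog} {s s' : State} {t : ℕ} :
      e.eval s ≠ 0 → Exec ω P s t s' → Exec ω (.ite e P Q) s (e.cost + 1 + t) s'
  | ite_false {e : Expr} {P Q : Prog} {s s' : State} {t : ℕ} :
      e.eval s = 0 → Exec ω Q s t s' → Exec ω (.ite e P Q) s (e.cost + 1 + t) s'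
  | loop_true {e : Expr} {P : Prog} {s s' s'' : State} {t u : ℕ} :
      e.eval s ≠ 0 → Exec ω P s t s' → Exec ω (.loop e P) s' u s'' →
        Exec ω (.loop e P) s (e.cost + 1 + t + u) s''
  | loop_false {e : Expr} {P : Prog} {s : State} :
      e.eval s = 0 → Exec ω (.loop e P) s (e.cost + 1) s

open Classical in
/-- The truth value of a proposition as a number. -/
noncomputable def bit (P : Prop) : ℕ := if P then 1 else 0

/-- The input `(G, T, p)`, where `G` has the vertex set `Fin n` and the set `D` of distinguished
vertices: variables `0` and `1` hold `n` and `p`, array `0` the adjacency matrix of `G` row by row,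
arrays `1` and `2` the characteristic vectors of `D` and `T`; all else is `0`. -/
noncomputable def input (n : ℕ) (G : Digraph (Fin n)) (D T : Finset (Fin n)) (p : ℕ) : State where
  var := fun x => if x = 0 then n else if x = 1 then p else 0
  arr := fun a i =>
    if a = 0 then bit (∃ u v : Fin n, i = u.val * n + v.val ∧ G.Adj u v)
    else if a = 1 then bit (∃ v ∈ D, i = v.val)
    else if a = 2 then bit (∃ v ∈ T, i = v.val)
    else 0
  pos := 0

/-- With the random bits `ω`, the program `P` started in `s` halts within `t` units of time and
returns the set `Z`, that is, `Z` is the set of all `v` for which cell `v` of array `3` is non-zero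
at the end. -/
def ReturnsWithin {n : ℕ} (P : Prog) (ω : ℕ → Bool) (s : State) (t : ℕ)
    (Z : Finset (Fin n)) : Prop :=
  ∃ k ≤ t, ∃ s' : State, Exec ω P s k s' ∧ ∀ v : Fin n, v ∈ Z ↔ s'.arr 3 v.val ≠ 0

/-- The law of an infinite sequence of independent fair random bits. -/
noncomputable def fairBits : MeasureTheory.Measure (ℕ → Bool) :=
  MeasureTheory.Measure.infinitePi fun _ : ℕ => (PMF.uniformOfFintype Bool).toMeasure

end RandomSampling

namespace RandomSampling

/-! ### A language of bounded loops -/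

/-! Probability. Let R be a random set that contains each deletable vertex with probability 1/2.
Suppose that every vertex v has a family 𝓕 v of at most 4^p v–T separators, fixed independently of
R, such that each important v–T separator of size at most p contains a member of 𝓕 v. Let Z consist
of the v for which some member of 𝓕 v lies in R. If S ⊆ R, then Y ⊆ Z. If moreover R misses, for all
v ∈ S and F ∈ 𝓕 v, a vertex of F outside S, then Z is disjoint from S. Such a vertex exists because
S is thin: otherwise F ⊆ S \ {v}, and S \ {v} would be a v–T separator. At most p + p·4^p ≤ 2^(4p)
coins are prescribed in all (`le_fairBits`).

The families. Split every vertex u into an arc from u to u + n of capacity 1 (or n + 1, which acts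
as infinity, if u is undeletable), and give the arcs of G capacity n + 1. An important separator S
is then the set of arcs leaving a cut A of capacity at most |S| that is maximal: enlarging A costs
capacity (`IsImportantSeparator.exists_cut`). A search keeps sources X inside A, sinks K outside A,
and a flow. Let B be the set of nodes that reach K in the residual network. If B meets X, the flow
is augmented. Otherwise the complement of B is a minimum cut, and by submodularity and maximality it
lies in A (`SearchInv.mem_of_not_reach`). If an arc from a ∉ B to b ∈ B has a head b that is not yet
a sink, the search guesses whether b ∈ A. If so, b becomes a source, and the minimum cut grows; if
not, b becomes a sink, and is the head of an arc that leaves A. Each kind of guess occurs at most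
c(A) ≤ p times, so 4^p sequences of guesses suffice (`exists_choices`). When no such arc is left,
all arcs that leave the complement of B end in sinks, hence leave A as well. Their tails therefore
form a separator contained in S, which is all that is needed (`exists_finalLevels`,
`exists_separators`).

Machine. The algorithm is written in a language of bounded loops with a total denotational semantics
`den`. Running times then follow structurally (`runs_cost`). That the coins do not influence the
families is a noninterference statement, checked by a computable information-flow test
(`secure_lowEq`); the only coin-dependent data the searches leave behind are the verdict and the
output. -/

@[simp] theorem State.setVar_var (s : State) (x k y : ℕ) :
    (s.setVar x k).var y = if y = x then k else s.var y := by
  simp [State.setVar, Function.update_apply]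

@[simp] theorem State.setVar_arr (s : State) (x k : ℕ) : (s.setVar x k).arr = s.arr := rfl

@[simp] theorem State.setVar_pos (s : State) (x k : ℕ) : (s.setVar x k).pos = s.pos := rfl

@[simp] theorem State.setArr_var (s : State) (a i k : ℕ) : (s.setArr a i k).var = s.var := rfl

@[simp] theorem State.setArr_pos (s : State) (a i k : ℕ) : (s.setArr a i k).pos = s.pos := rfl

@[simp] theorem State.setArr_arr (s : State) (a i k b : ℕ) :
    (s.setArr a i k).arr b = if b = a then Function.update (s.arr a) i k else s.arr b := by
  simp [State.setArr, Function.update_apply]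

@[simp] theorem State.toss_var (s : State) (x : ℕ) (b : Bool) (y : ℕ) :
    (s.toss x b).var y = if y = x then b.toNat else s.var y := by
  simp [State.toss]

@[simp] theorem State.toss_arr (s : State) (x : ℕ) (b : Bool) : (s.toss x b).arr = s.arr := rfl

@[simp] theorem State.toss_pos (s : State) (x : ℕ) (b : Bool) : (s.toss x b).pos = s.pos + 1 := rfl

attribute [simp] Expr.eval

/-- Programs whose only loops are bounded: `rep l x P` runs `P` for all values of `x` below the value
of the variable `l`. -/
inductive LoopProg : Type
  | skip
  | assign (x : ℕ) (e : Expr)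
  | store (a : ℕ) (i e : Expr)
  | coin (x : ℕ)
  | seq (P Q : LoopProg)
  | ite (e : Expr) (P Q : LoopProg)
  | rep (l x : ℕ) (P : LoopProg)

namespace LoopProg

/-- The translation into programs with while loops. -/
def compile : LoopProg → Prog
  | skip => .skip
  | assign x e => .assign x e
  | store a i e => .store a i e
  | coin x => .coin x
  | seq P Q => .seq P.compile Q.compile
  | ite e P Q => .ite e P.compile Q.compile
  | rep l x P => .seq (.assign x (.const 0))
      (.loop (.sub (.var l) (.var x)) (.seq P.compile (.assign x (.add (.var x) (.const 1)))))

/-- The state after the run of a program. -/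
def den (ω : ℕ → Bool) : LoopProg → State → State
  | skip, s => s
  | assign x e, s => s.setVar x (e.eval s)
  | store a i e, s => s.setArr a (i.eval s) (e.eval s)
  | coin x, s => s.toss x (ω s.pos)
  | seq P Q, s => Q.den ω (P.den ω s)
  | ite e P Q, s => if e.eval s ≠ 0 then P.den ω s else Q.den ω s
  | rep l x P, s =>
      (fun s => (P.den ω s).setVar x ((P.den ω s).var x + 1))^[s.var l] (s.setVar x 0)

/-- The state of a loop after `i` rounds. -/
def traj (ω : ℕ → Bool) (P : LoopProg) (x : ℕ) (s : State) (i : ℕ) : State :=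
  (fun s => (P.den ω s).setVar x ((P.den ω s).var x + 1))^[i] (s.setVar x 0)

/-- Whether a program writes the variable `y`. -/
def wv (y : ℕ) : LoopProg → Bool
  | skip => false
  | assign x _ => x == y
  | store _ _ _ => false
  | coin x => x == y
  | seq P Q => P.wv y || Q.wv y
  | ite _ P Q => P.wv y || Q.wv y
  | rep _ x P => x == y || P.wv y

/-- Whether a program writes the array `b`. -/
def wa (b : ℕ) : LoopProg → Bool
  | skip => false
  | assign _ _ => false
  | store a _ _ => a == b
  | coin _ => false
  | seq P Q => P.wa b || Q.wa b
  | ite _ P Q => P.wa b || Q.wa b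
  | rep _ _ P => P.wa b

/-- Whether a program tosses coins. -/
def tosses : LoopProg → Bool
  | skip => false
  | assign _ _ => false
  | store _ _ _ => false
  | coin _ => true
  | seq P Q => P.tosses || Q.tosses
  | ite _ P Q => P.tosses || Q.tosses
  | rep _ _ P => P.tosses

/-- No loop changes its counter or its bound in its body. -/
def ok : LoopProg → Bool
  | skip => true
  | assign _ _ => true
  | store _ _ _ => true
  | coin _ => true
  | seq P Q => P.ok && Q.ok
  | ite _ P Q => P.ok && Q.ok
  | rep l x P => !P.wv l && !P.wv x && !(x == l) && P.ok

/-- The loop bounds. -/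
def lims : LoopProg → List ℕ
  | skip => []
  | assign _ _ => []
  | store _ _ _ => []
  | coin _ => []
  | seq P Q => P.lims ++ Q.lims
  | ite _ P Q => P.lims ++ Q.lims
  | rep l _ P => l :: P.lims

/-- No loop bound is written. -/
def fixedLims (P : LoopProg) : Bool := P.lims.all fun l => !P.wv l

open Polynomial in
/-- A bound for the running time in terms of a bound for the loop bounds. -/
noncomputable def cost : LoopProg → ℕ[X]
  | skip => 1
  | assign _ e => C (e.cost + 1)
  | store _ i e => C (i.cost + e.cost + 1)
  | coin _ => 1
  | seq P Q => P.cost + Q.cost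
  | ite e P Q => C (e.cost + 1) + P.cost + Q.cost
  | rep _ _ P => X * (P.cost + C 8) + C 6

/-! ### Frame rules and loop invariants -/

theorem frame_iterate {ω : ℕ → Bool} {P : LoopProg} {x : ℕ} {γ : Type*} (f : State → γ)
    (hP : ∀ s, f (P.den ω s) = f s) (hx : ∀ s k, f (s.setVar x k) = f s) (s : State) (i : ℕ) :
    f ((fun s => (P.den ω s).setVar x ((P.den ω s).var x + 1))^[i] s) = f s := by
  induction i generalizing s with
  | zero => rfl
  | succ i ih => rw [Function.iterate_succ_apply, ih, hx, hP]

theorem den_var (ω : ℕ → Bool) {y : ℕ} (P : LoopProg) (h : P.wv y = false) (s : State) :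
    (P.den ω s).var y = s.var y := by
  induction P generalizing s with
  | skip => rfl
  | assign x e => simp [wv] at h; simp [den, Ne.symm h]
  | store a i e => rfl
  | coin x => simp [wv] at h; simp [den, Ne.symm h]
  | seq P Q ihP ihQ => simp [wv] at h; simp [den, ihP h.1, ihQ h.2]
  | ite e P Q ihP ihQ => simp [wv] at h; simp only [den]; split_ifs <;> simp [ihP h.1, ihQ h.2]
  | rep l x P ih =>
    simp only [wv, Bool.or_eq_false_iff, beq_eq_false_iff_ne] at h
    have hx : ∀ (s : State) k, (s.setVar x k).var y = s.var y := fun s k => by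
      simp [Ne.symm h.1]
    exact (frame_iterate (fun s => s.var y) (ih h.2) hx _ _).trans (hx _ _)

theorem den_arr (ω : ℕ → Bool) {b : ℕ} (P : LoopProg) (h : P.wa b = false) (s : State) :
    (P.den ω s).arr b = s.arr b := by
  induction P generalizing s with
  | skip => rfl
  | assign x e => rfl
  | store a i e => simp [wa] at h; simp [den, Ne.symm h]
  | coin x => rfl
  | seq P Q ihP ihQ => simp [wa] at h; simp [den, ihP h.1, ihQ h.2]
  | ite e P Q ihP ihQ => simp [wa] at h; simp only [den]; split_ifs <;> simp [ihP h.1, ihQ h.2]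
  | rep l x P ih =>
    simp only [wa] at h
    exact frame_iterate (fun s => s.arr b) (ih h) (fun _ _ => rfl) _ _

theorem den_pos (ω : ℕ → Bool) (P : LoopProg) (h : P.tosses = false) (s : State) :
    (P.den ω s).pos = s.pos := by
  induction P generalizing s with
  | skip => rfl
  | assign x e => rfl
  | store a i e => rfl
  | coin x => simp [tosses] at h
  | seq P Q ihP ihQ => simp [tosses] at h; simp [den, ihP h.1, ihQ h.2]
  | ite e P Q ihP ihQ => simp [tosses] at h; simp only [den]; split_ifs <;> simp [ihP h.1, ihQ h.2]
  | rep l x P ih =>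
    simp only [tosses] at h
    exact frame_iterate (fun s => s.pos) (ih h) (fun _ _ => rfl) _ _

theorem traj_zero (ω : ℕ → Bool) (P : LoopProg) (x : ℕ) (s : State) :
    traj ω P x s 0 = s.setVar x 0 := rfl

theorem traj_var_self (ω : ℕ → Bool) (P : LoopProg) {x : ℕ} (hx : P.wv x = false) (s : State)
    (i : ℕ) : (traj ω P x s i).var x = i := by
  induction i with
  | zero => simp [traj]
  | succ i ih =>
    rw [traj, Function.iterate_succ_apply', ← traj]
    simp [den_var ω P hx, ih]

theorem traj_succ (ω : ℕ → Bool) (P : LoopProg) {x : ℕ} (hx : P.wv x = false) (s : State)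
    (i : ℕ) : traj ω P x s (i + 1) = (P.den ω (traj ω P x s i)).setVar x (i + 1) := by
  rw [traj, Function.iterate_succ_apply', ← traj, den_var ω P hx, traj_var_self ω P hx]

theorem traj_var (ω : ℕ → Bool) (P : LoopProg) {x y : ℕ} (hy : P.wv y = false) (hxy : y ≠ x)
    (s : State) (i : ℕ) : (traj ω P x s i).var y = s.var y := by
  have hx : ∀ (s : State) k, (s.setVar x k).var y = s.var y := fun s k => by simp [hxy]
  exact (frame_iterate (fun s => s.var y) (den_var ω P hy) hx _ _).trans (hx _ _)

theorem traj_arr (ω : ℕ → Bool) (P : LoopProg) {x b : ℕ} (hb : P.wa b = false)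
    (s : State) (i : ℕ) : (traj ω P x s i).arr b = s.arr b :=
  frame_iterate (fun s => s.arr b) (den_arr ω P hb) (fun _ _ => rfl) _ _

theorem den_rep (ω : ℕ → Bool) (P : LoopProg) (l x : ℕ) (s : State) :
    (rep l x P).den ω s = traj ω P x s (s.var l) := rfl

/-- The rule of loop invariants. -/
theorem rep_induction {ω : ℕ → Bool} {P : LoopProg} {l x : ℕ} {s : State}
    (Inv : ℕ → State → Prop) (hx : P.wv x = false)
    (h0 : Inv 0 (s.setVar x 0))
    (hstep : ∀ i s₁, i < s.var l → s₁.var x = i →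
      (∀ y, P.wv y = false → y ≠ x → s₁.var y = s.var y) →
      (∀ b, P.wa b = false → s₁.arr b = s.arr b) →
      Inv i s₁ → Inv (i + 1) ((P.den ω s₁).setVar x (i + 1))) :
    Inv (s.var l) ((rep l x P).den ω s) := by
  rw [den_rep]
  have : ∀ i ≤ s.var l, Inv i (traj ω P x s i) := by
    intro i
    induction i with
    | zero => exact fun _ => h0
    | succ i ih =>
      intro hi
      rw [traj_succ ω P hx]
      exact hstep i _ hi (traj_var_self ω P hx s i) (fun y hy hxy => traj_var ω P hy hxy s i)
        (fun b hb => traj_arr ω P hb s i) (ih (by omega))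
  exact this _ le_rfl

/-- The variables that a program writes. -/
def writtenVars : LoopProg → List ℕ
  | skip => []
  | assign x _ => [x]
  | store _ _ _ => []
  | coin x => [x]
  | seq P Q => P.writtenVars ++ Q.writtenVars
  | ite _ P Q => P.writtenVars ++ Q.writtenVars
  | rep _ x P => x :: P.writtenVars

/-- The arrays that a program writes. -/
def writtenArrs : LoopProg → List ℕ
  | skip => []
  | assign _ _ => []
  | store a _ _ => [a]
  | coin _ => []
  | seq P Q => P.writtenArrs ++ Q.writtenArrs
  | ite _ P Q => P.writtenArrs ++ Q.writtenArrs
  | rep _ _ P => P.writtenArrs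

theorem wv_eq_false {y : ℕ} (P : LoopProg) (h : y ∉ P.writtenVars) : P.wv y = false := by
  induction P <;> simp_all [wv, writtenVars, Ne.symm, beq_eq_false_iff_ne]

theorem wa_eq_false {b : ℕ} (P : LoopProg) (h : b ∉ P.writtenArrs) : P.wa b = false := by
  induction P <;> simp_all [wa, writtenArrs, Ne.symm, beq_eq_false_iff_ne]

/-- Stores `e` into cell `i` of the array `a` if `i` is less than the value of the variable `l`. -/
abbrev storeLt (l a : ℕ) (i e : Expr) : LoopProg := ite (.sub (.var l) i) (store a i e) skip

theorem den_storeLt {ω : ℕ → Bool} {l a : ℕ} {i e : Expr} {s : State} (h : i.eval s < s.var l) :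
    (storeLt l a i e).den ω s = s.setArr a (i.eval s) (e.eval s) :=
  if_pos (show s.var l - i.eval s ≠ 0 by omega)

/-- Only cells of the array `a` below the value of the variable `l` are written. -/
inductive Guarded (a l : ℕ) : LoopProg → Prop
  | skip : Guarded a l skip
  | assign (x : ℕ) (e : Expr) : Guarded a l (assign x e)
  | store (b : ℕ) (i e : Expr) (h : b ≠ a) : Guarded a l (store b i e)
  | storeLt (i e : Expr) : Guarded a l (storeLt l a i e)
  | coin (x : ℕ) : Guarded a l (coin x)
  | seq {P Q : LoopProg} (hP : Guarded a l P) (hQ : Guarded a l Q) : Guarded a l (seq P Q)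
  | ite {e : Expr} {P Q : LoopProg} (hP : Guarded a l P) (hQ : Guarded a l Q) :
      Guarded a l (ite e P Q)
  | rep {l' x : ℕ} {P : LoopProg} (hP : Guarded a l P) : Guarded a l (rep l' x P)

/-- Every write to the array is preceded by a run-time comparison with the bound, so the cells
beyond it are preserved without any proof that the indices are in range. -/
theorem Guarded.den_arr {ω : ℕ → Bool} {a l : ℕ} {P : LoopProg} (h : Guarded a l P)
    (hl : P.wv l = false) {s : State} {c : ℕ} (hc : s.var l ≤ c) :
    (P.den ω s).arr a c = s.arr a c := by
  induction h generalizing s with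
  | skip => rfl
  | assign x e => rfl
  | store b i e h => simp [den, h.symm]
  | storeLt i e =>
    by_cases h : i.eval s < s.var l
    · rw [den_storeLt h, State.setArr_arr, if_pos rfl, Function.update_of_ne (by omega)]
    · rw [show (LoopProg.storeLt l a i e).den ω s = s from
        if_neg (show ¬ (s.var l - i.eval s ≠ 0) by omega)]
  | coin x => rfl
  | seq _ _ ihP ihQ =>
    simp only [wv, Bool.or_eq_false_iff] at hl
    simp only [den]
    rw [ihQ hl.2 (by rwa [den_var ω _ hl.1]), ihP hl.1 hc]
  | ite _ _ ihP ihQ =>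
    simp only [wv, Bool.or_eq_false_iff] at hl
    simp only [den]
    split_ifs
    exacts [ihP hl.1 hc, ihQ hl.2 hc]
  | @rep l' x P _ ih =>
    simp only [wv, Bool.or_eq_false_iff, beq_eq_false_iff_ne] at hl
    simp only [den]
    suffices H : ∀ i (s : State), s.var l ≤ c →
        ((fun s => (P.den ω s).setVar x ((P.den ω s).var x + 1))^[i] s).arr a c = s.arr a c from
      H _ _ (by simpa [Ne.symm hl.1] using hc)
    intro i
    induction i with
    | zero => exact fun s _ => rfl
    | succ i ih' =>
      intro s hs
      rw [Function.iterate_succ_apply,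
        ih' _ (by simpa [Ne.symm hl.1, LoopProg.den_var ω P hl.2] using hs)]
      exact ih hl.2 hs

/-! ### Running times of bounded loops -/

/-- The program `P`, started in `s`, halts within `c` units of time. -/
def Runs (ω : ℕ → Bool) (P : LoopProg) (s : State) (c : ℕ) : Prop :=
  ∃ t ≤ c, Exec ω P.compile s t (P.den ω s)

theorem Runs.seq {ω : ℕ → Bool} {P Q : LoopProg} {s : State} {c d : ℕ} (hP : P.Runs ω s c)
    (hQ : Q.Runs ω (P.den ω s) d) : (seq P Q).Runs ω s (c + d) := by
  obtain ⟨t, ht, h⟩ := hP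
  obtain ⟨u, hu, h'⟩ := hQ
  exact ⟨t + u, by omega, .seq h h'⟩

theorem Runs.mono {ω : ℕ → Bool} {P : LoopProg} {s : State} {c d : ℕ} (hP : P.Runs ω s c)
    (h : c ≤ d) : P.Runs ω s d := by
  obtain ⟨t, ht, h'⟩ := hP
  exact ⟨t, by omega, h'⟩

/-- Each round pays 4 for the test and 4 for the increment of the counter; the initialization of the
counter (2) and the last, failing test (4) give the remaining 6. -/
theorem Runs.rep {ω : ℕ → Bool} {P : LoopProg} {l x : ℕ} {s : State} {c : ℕ}
    (hx : P.wv x = false) (hl : P.wv l = false) (hxl : l ≠ x)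
    (h : ∀ i < s.var l, P.Runs ω (traj ω P x s i) c) :
    (rep l x P).Runs ω s (s.var l * (c + 8) + 6) := by
  -- Induction on the number `j` of rounds that remain, since the execution relation of a loop
  -- unfolds from the front.
  have key : ∀ j ≤ s.var l, ∃ t ≤ j * (c + 8) + 4,
      Exec ω (.loop (.sub (.var l) (.var x)) (.seq P.compile (.assign x (.add (.var x) (.const 1)))))
        (traj ω P x s (s.var l - j)) t (traj ω P x s (s.var l)) := by
    intro j
    induction j with
    | zero =>
      intro _
      refine ⟨4, by omega, ?_⟩
      apply Exec.loop_false
      simp [traj_var_self ω P hx, traj_var ω P hl hxl]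
    | succ j ih =>
      intro hj
      obtain ⟨t, ht, hE⟩ := ih (by omega)
      obtain ⟨u, hu, hE'⟩ := h (s.var l - (j + 1)) (by omega)
      refine ⟨4 + (u + 4) + t, by rw [Nat.succ_mul]; omega, ?_⟩
      refine Exec.loop_true ?_ (Exec.seq hE' (Exec.assign _ _ _)) ?_
      · simp [traj_var_self ω P hx, traj_var ω P hl hxl]
        omega
      · convert hE using 1
        have : s.var l - j = s.var l - (j + 1) + 1 := by omega
        rw [this, traj_succ ω P hx]
        simp [den_var ω P hx, traj_var_self ω P hx]
  obtain ⟨t, ht, hE⟩ := key (s.var l) le_rfl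
  refine ⟨2 + t, by omega, .seq (.assign _ _ _) ?_⟩
  simpa [traj_zero, den_rep] using hE

/-- The bound is a polynomial in a common bound `K` for the loop limits. As no limit is written
anywhere in the program, `K` stays valid at every loop entry. -/
theorem runs_cost (ω : ℕ → Bool) (K : ℕ) (P : LoopProg) (hok : P.ok = true)
    (hf : ∀ l ∈ P.lims, P.wv l = false) (s : State) (hs : ∀ l ∈ P.lims, s.var l ≤ K) :
    P.Runs ω s (P.cost.eval K) := by
  induction P generalizing s with
  | skip => exact ⟨1, by simp [cost], .skip s⟩
  | assign x e => exact ⟨_, by simp [cost], .assign x e s⟩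
  | store a i e => exact ⟨_, by simp [cost], .store a i e s⟩
  | coin x => exact ⟨1, by simp [cost], .coin x s⟩
  | seq P Q ihP ihQ =>
    simp only [ok, Bool.and_eq_true] at hok
    simp only [lims, List.mem_append, wv, Bool.or_eq_false_iff] at hf hs
    rw [cost, Polynomial.eval_add]
    refine (ihP hok.1 (fun l hl => (hf l (.inl hl)).1) s (fun l hl => hs l (.inl hl))).seq
      (ihQ hok.2 (fun l hl => (hf l (.inr hl)).2) _ (fun l hl => ?_))
    rw [den_var ω P (hf l (.inr hl)).1]
    exact hs l (.inr hl)
  | ite e P Q ihP ihQ =>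
    simp only [ok, Bool.and_eq_true] at hok
    simp only [lims, List.mem_append, wv, Bool.or_eq_false_iff] at hf hs
    obtain ⟨t, ht, h⟩ := ihP hok.1 (fun l hl => (hf l (.inl hl)).1) s (fun l hl => hs l (.inl hl))
    obtain ⟨u, hu, h'⟩ := ihQ hok.2 (fun l hl => (hf l (.inr hl)).2) s (fun l hl => hs l (.inr hl))
    simp only [Runs, cost, Polynomial.eval_add, Polynomial.eval_C]
    by_cases he : e.eval s = 0
    · exact ⟨e.cost + 1 + u, by omega, by simpa [den, he, compile] using Exec.ite_false he h'⟩
    · exact ⟨e.cost + 1 + t, by omega, by simpa [den, he, compile] using Exec.ite_true he h⟩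
  | rep l x P ih =>
    simp only [ok, Bool.and_eq_true, Bool.not_eq_true', beq_eq_false_iff_ne] at hok
    obtain ⟨⟨⟨hl, hx⟩, hxl⟩, hok⟩ := hok
    simp only [lims, List.mem_cons, forall_eq_or_imp, wv, Bool.or_eq_false_iff,
      beq_eq_false_iff_ne] at hf hs
    refine (Runs.rep hx hl (Ne.symm hxl) (c := P.cost.eval K) fun i _ => ?_).mono ?_
    · refine ih hok (fun l hl => (hf.2 l hl).2) _ fun l hl => ?_
      rw [traj_var ω P (hf.2 l hl).2 (Ne.symm (hf.2 l hl).1)]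
      exact hs.2 l hl
    · simp only [cost, Polynomial.eval_add, Polynomial.eval_mul, Polynomial.eval_X,
        Polynomial.eval_C]
      gcongr
      exact hs.1

theorem fixedLims_iff {P : LoopProg} (h : P.fixedLims = true) : ∀ l ∈ P.lims, P.wv l = false := by
  simpa [fixedLims] using h

/-! ### Noninterference -/

end LoopProg

/-- The expression does not depend on the variables in `hv` and the arrays in `ha`. -/
def Expr.low (hv ha : List ℕ) : Expr → Bool
  | const _ => true
  | var x => !hv.contains x
  | get a i => !ha.contains a && i.low hv ha
  | add e f => e.low hv ha && f.low hv ha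
  | sub e f => e.low hv ha && f.low hv ha

/-- The states agree, except for the variables in `hv` and the arrays in `ha`. -/
structure LowEq (hv ha : List ℕ) (s s' : State) : Prop where
  var : ∀ x, x ∉ hv → s.var x = s'.var x
  arr : ∀ a, a ∉ ha → s.arr a = s'.arr a
  pos : s.pos = s'.pos

theorem LowEq.symm {hv ha : List ℕ} {s s' : State} (h : LowEq hv ha s s') : LowEq hv ha s' s :=
  ⟨fun x hx => (h.var x hx).symm, fun x hx => (h.arr x hx).symm, h.pos.symm⟩

theorem LowEq.trans {hv ha : List ℕ} {s s' s'' : State} (h : LowEq hv ha s s')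
    (h' : LowEq hv ha s' s'') : LowEq hv ha s s'' :=
  ⟨fun x hx => (h.var x hx).trans (h'.var x hx), fun x hx => (h.arr x hx).trans (h'.arr x hx),
    h.pos.trans h'.pos⟩

theorem LowEq.refl (hv ha : List ℕ) (s : State) : LowEq hv ha s s :=
  ⟨fun _ _ => rfl, fun _ _ => rfl, rfl⟩

theorem Expr.eval_low {hv ha : List ℕ} {s s' : State} (h : LowEq hv ha s s') (e : Expr)
    (he : e.low hv ha = true) : e.eval s = e.eval s' := by
  induction e with
  | const k => rfl
  | var x => simp [low] at he; exact h.var x he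
  | get a i ih => simp [low] at he; simp [ih he.2, h.arr a he.1]
  | add e f ihe ihf => simp [low] at he; simp [ihe he.1, ihf he.2]
  | sub e f ihe ihf => simp [low] at he; simp [ihe he.1, ihf he.2]

theorem LowEq.setVar {hv ha : List ℕ} {s s' : State} (h : LowEq hv ha s s') (x k : ℕ) :
    LowEq hv ha (s.setVar x k) (s'.setVar x k) :=
  ⟨fun y hy => by simp [h.var y hy], h.arr, h.pos⟩

theorem LowEq.setVar_left {hv ha : List ℕ} {s s' : State} (h : LowEq hv ha s s') {x : ℕ}
    (hx : x ∈ hv) (k : ℕ) : LowEq hv ha (s.setVar x k) s' :=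
  ⟨fun y hy => by rw [State.setVar_var, if_neg (by rintro rfl; exact hy hx), h.var y hy],
    h.arr, h.pos⟩

theorem LowEq.setArr {hv ha : List ℕ} {s s' : State} (h : LowEq hv ha s s') (a i k : ℕ) :
    LowEq hv ha (s.setArr a i k) (s'.setArr a i k) := by
  refine ⟨h.var, fun b hb => ?_, h.pos⟩
  simp only [State.setArr_arr]
  split_ifs with hba
  · rw [h.arr a (hba ▸ hb)]
  · exact h.arr b hb

theorem LowEq.setArr_left {hv ha : List ℕ} {s s' : State} (h : LowEq hv ha s s') {a : ℕ}
    (hx : a ∈ ha) (i k : ℕ) : LowEq hv ha (s.setArr a i k) s' := by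
  refine ⟨h.var, fun b hb => ?_, h.pos⟩
  rw [State.setArr_arr, if_neg (by rintro rfl; exact hb hx), h.arr b hb]

namespace LoopProg

/-- The program is free of loops and coins and writes only variables in `hv` and arrays in `ha`. -/
def high (hv ha : List ℕ) : LoopProg → Bool
  | skip => true
  | assign x _ => hv.contains x
  | store a _ _ => ha.contains a
  | coin _ => false
  | seq P Q => P.high hv ha && Q.high hv ha
  | ite _ P Q => P.high hv ha && Q.high hv ha
  | rep _ _ _ => false

/-- There is no flow of information from the variables in `hv`, the arrays in `ha` and the coins to
the other variables and arrays. -/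
def secure (hv ha : List ℕ) : LoopProg → Bool
  | skip => true
  | assign x e => hv.contains x || e.low hv ha
  | store a i e => ha.contains a || (i.low hv ha && e.low hv ha)
  | coin x => hv.contains x
  | seq P Q => P.secure hv ha && Q.secure hv ha
  | ite e P Q => P.high hv ha && Q.high hv ha ||
      e.low hv ha && P.secure hv ha && Q.secure hv ha
  | rep l _ P => !hv.contains l && P.secure hv ha

/-- Needed for branches on secret data: both branches leave the public part unchanged. Coins are
excluded because the number of used bits is public. -/
theorem high_lowEq {hv ha : List ℕ} (ω : ℕ → Bool) (P : LoopProg) (h : P.high hv ha = true)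
    (s : State) : LowEq hv ha (P.den ω s) s := by
  induction P generalizing s with
  | skip => exact .refl _ _ s
  | assign x e => simp [high] at h; exact (LowEq.refl _ _ s).setVar_left h _
  | store a i e => simp [high] at h; exact (LowEq.refl _ _ s).setArr_left h _ _
  | coin x => simp [high] at h
  | seq P Q ihP ihQ => simp [high] at h; exact (ihQ h.2 _).trans (ihP h.1 _)
  | ite e P Q ihP ihQ => simp [high] at h; simp only [den]; split_ifs <;> simp [ihP h.1, ihQ h.2]
  | rep l x P ih => simp [high] at h

/-- The two runs may use different random bits: bits enter only through secret variables, while both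
runs consume the same number of them. -/
theorem secure_lowEq {hv ha : List ℕ} {ω ω' : ℕ → Bool} (P : LoopProg)
    (h : P.secure hv ha = true) {s s' : State} (hs : LowEq hv ha s s') :
    LowEq hv ha (P.den ω s) (P.den ω' s') := by
  induction P generalizing s s' with
  | skip => exact hs
  | assign x e =>
    simp only [secure, Bool.or_eq_true, List.contains_iff_mem] at h
    rcases h with h | h
    · exact ((hs.setVar_left h _).symm.setVar_left h _).symm
    · simp only [den, Expr.eval_low hs e h]; exact hs.setVar _ _
  | store a i e =>
    simp only [secure, Bool.or_eq_true, Bool.and_eq_true, List.contains_iff_mem] at h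
    rcases h with h | h
    · exact ((hs.setArr_left h _ _).symm.setArr_left h _ _).symm
    · simp only [den, Expr.eval_low hs e h.2, Expr.eval_low hs i h.1]; exact hs.setArr _ _ _
  | coin x =>
    simp only [secure, List.contains_iff_mem] at h
    have := ((hs.setVar_left h (ω s.pos).toNat).symm.setVar_left h (ω' s'.pos).toNat).symm
    exact ⟨this.var, this.arr, by simp [den, hs.pos]⟩
  | seq P Q ihP ihQ => simp [secure] at h; exact ihQ h.2 (ihP h.1 hs)
  | ite e P Q ihP ihQ =>
    simp only [secure, Bool.or_eq_true, Bool.and_eq_true] at h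
    rcases h with h | ⟨⟨he, hP⟩, hQ⟩
    · have aux : ∀ (ω : ℕ → Bool) s, LowEq hv ha ((ite e P Q).den ω s) s := by
        intro ω s
        simp only [den]
        split_ifs
        exacts [high_lowEq ω P h.1 s, high_lowEq ω Q h.2 s]
      exact (aux ω s).trans (hs.trans (aux ω' s').symm)
    · simp only [den, Expr.eval_low hs e he]
      split_ifs
      exacts [ihP hP hs, ihQ hQ hs]
  | rep l x P ih =>
    simp only [secure, Bool.and_eq_true, Bool.not_eq_true', ← Bool.not_eq_true,
      List.contains_iff_mem] at h
    simp only [den, hs.var l h.1]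
    generalize s'.var l = k
    have := hs.setVar x 0
    revert this
    generalize s.setVar x 0 = s
    generalize s'.setVar x 0 = s'
    intro hs
    induction k generalizing s s' with
    | zero => exact hs
    | succ k ihk =>
      simp only [Function.iterate_succ_apply]
      apply ihk
      have := ih h.2 hs
      refine ⟨fun y hy => ?_, this.arr, this.pos⟩
      simp only [State.setVar_var]
      split_ifs with hyx
      · rw [this.var x (hyx ▸ hy)]
      · exact this.var y hy

/-- A program that does not mention the variable `x` commutes with assignments to it. -/
theorem den_setVar_comm {ω : ℕ → Bool} {x : ℕ} (P : LoopProg) (h : P.secure [x] [] = true)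
    (hx : P.wv x = false) (s : State) (k : ℕ) :
    P.den ω (s.setVar x k) = (P.den ω s).setVar x k := by
  have := secure_lowEq (ω := ω) (ω' := ω) P h ((LowEq.refl [x] [] s).setVar_left (x := x) (by simp) k)
  ext y
  · by_cases hy : y = x
    · subst hy; simp [den_var ω P hx]
    · rw [this.var y (by simpa using hy)]; simp [hy]
  · rw [this.arr _ (by simp)]; rfl
  · exact this.pos

end LoopProg
end RandomSampling

namespace RandomSampling

/-! ### Cuts -/

/-- The capacity of the arcs among the nodes below `N` that leave `A`. -/
def cut (N : ℕ) (r : ℕ → ℕ → ℕ) (A : Finset ℕ) : ℕ :=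
  ∑ a ∈ Finset.range N, ∑ b ∈ Finset.range N, if a ∈ A ∧ b ∉ A then r a b else 0

theorem cut_add (N : ℕ) (r r' : ℕ → ℕ → ℕ) (A : Finset ℕ) :
    cut N (fun a b => r a b + r' a b) A = cut N r A + cut N r' A := by
  simp only [cut, ← Finset.sum_add_distrib]
  refine Finset.sum_congr rfl fun a _ => Finset.sum_congr rfl fun b _ => ?_
  split_ifs <;> simp

theorem cut_congr {N : ℕ} {r r' : ℕ → ℕ → ℕ} {A : Finset ℕ}
    (h : ∀ a < N, ∀ b < N, r a b = r' a b) : cut N r A = cut N r' A := by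
  refine Finset.sum_congr rfl fun a ha => Finset.sum_congr rfl fun b hb => ?_
  rw [h a (Finset.mem_range.1 ha) b (Finset.mem_range.1 hb)]

theorem le_cut {N : ℕ} (r : ℕ → ℕ → ℕ) {A : Finset ℕ} {a b : ℕ} (ha : a < N) (hb : b < N)
    (haA : a ∈ A) (hbA : b ∉ A) : r a b ≤ cut N r A := by
  have h1 : r a b = if a ∈ A ∧ b ∉ A then r a b else 0 := by simp [haA, hbA]
  rw [h1]
  refine le_trans ?_ (Finset.single_le_sum (fun _ _ => Nat.zero_le _) (Finset.mem_range.2 ha))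
  exact Finset.single_le_sum (f := fun b => if a ∈ A ∧ b ∉ A then r a b else 0)
    (fun _ _ => Nat.zero_le _) (Finset.mem_range.2 hb)

theorem cut_single {N y z : ℕ} (hy : y < N) (hz : z < N) (A : Finset ℕ) :
    cut N (fun a b => if a = y ∧ b = z then 1 else 0) A = if y ∈ A ∧ z ∉ A then 1 else 0 := by
  rw [cut, Finset.sum_eq_single y, Finset.sum_eq_single z]
  · simp
  · intro b _ hb; simp [hb]
  · intro h; simp [hz] at h
  · intro a _ ha; simp [ha]
  · intro h; simp [hy] at h

/-- The effect of one more unit of flow on the arc from `y` to `z` on residual cuts. -/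
theorem cut_push {N y z : ℕ} (hy : y < N) (hz : z < N) {r r' : ℕ → ℕ → ℕ}
    (h : ∀ a < N, ∀ b < N, r' a b + (if a = y ∧ b = z then 1 else 0) =
      r a b + (if a = z ∧ b = y then 1 else 0)) (A : Finset ℕ) :
    cut N r' A + (if y ∈ A then 1 else 0) = cut N r A + (if z ∈ A then 1 else 0) := by
  have := cut_congr (A := A) h
  rw [cut_add, cut_add, cut_single hy hz, cut_single hz hy] at this
  by_cases h1 : y ∈ A <;> by_cases h2 : z ∈ A <;> simp [h1, h2] at this ⊢ <;> omega

/-- Holds arc by arc, by inspecting the possible positions of tail and head. -/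
theorem cut_submodular (N : ℕ) (r : ℕ → ℕ → ℕ) (A B : Finset ℕ) :
    cut N r (A ∩ B) + cut N r (A ∪ B) ≤ cut N r A + cut N r B := by
  simp only [cut, ← Finset.sum_add_distrib]
  refine Finset.sum_le_sum fun a _ => Finset.sum_le_sum fun b _ => ?_
  by_cases h1 : a ∈ A <;> by_cases h2 : a ∈ B <;> by_cases h3 : b ∈ A <;> by_cases h4 : b ∈ B <;>
    simp [h1, h2, h3, h4]

/-- `A` contains the sources `X` and none of the sinks `K`. -/
def IsCut (N : ℕ) (X K : ℕ → Prop) (A : Finset ℕ) : Prop :=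
  (∀ a < N, X a → a ∈ A) ∧ ∀ a < N, K a → a ∉ A

/-- `B` is the set of nodes from which `K` can be reached along arcs of positive capacity. -/
structure BackReach (N : ℕ) (r : ℕ → ℕ → ℕ) (K B : ℕ → Prop) : Prop where
  sink : ∀ a < N, K a → B a
  closed : ∀ a < N, ∀ b < N, r a b ≠ 0 → B b → B a
  one_le_cut : ∀ b < N, B b → ∀ A : Finset ℕ, b ∈ A → (∀ a < N, K a → a ∉ A) → 1 ≤ cut N r A

/-- `A` is a cut for the sinks `K`, and no larger cut has at most the same capacity. -/
def IsMaximalCut (N : ℕ) (c : ℕ → ℕ → ℕ) (K : ℕ → Prop) (A : Finset ℕ) : Prop :=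
  ∀ U : Finset ℕ, (∀ a < N, K a → a ∉ U) → cut N c (U ∪ A) ≤ cut N c A → ∀ a < N, a ∈ U → a ∈ A

/-- The invariant of the search for the cut `A`: `r` is the residual capacity of a flow of value `k`,
and `i` sources and `j` sinks have been added. -/
structure SearchInv (N : ℕ) (c : ℕ → ℕ → ℕ) (K₀ : ℕ → Prop) (A : Finset ℕ)
    (r : ℕ → ℕ → ℕ) (X K : ℕ → Prop) (k i j : ℕ) : Prop where
  isCut : IsCut N X K A
  sink : ∀ a < N, K₀ a → K a
  residual : ∀ A', IsCut N X K A' → cut N c A' = cut N r A' + k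
  le_cut : ∀ A', IsCut N X K A' → i ≤ cut N c A'
  taken : ∃ Q : Finset ℕ, Q.card = j ∧ ∀ b ∈ Q, b < N ∧ K b ∧ ∃ a < N, a ∈ A ∧ c a b ≠ 0

namespace SearchInv

variable {N : ℕ} {c : ℕ → ℕ → ℕ} {K₀ : ℕ → Prop} {A : Finset ℕ} {r : ℕ → ℕ → ℕ} {X K : ℕ → Prop}
  {k i j : ℕ}

theorem flow_le (h : SearchInv N c K₀ A r X K k i j) : k ≤ cut N c A := by
  rw [h.residual A h.isCut]; omega

theorem sources_le (h : SearchInv N c K₀ A r X K k i j) : i ≤ cut N c A := h.le_cut A h.isCut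

/-- The sinks added so far are distinct heads of arcs that leave `A`, and every such arc contributes
at least one unit. -/
theorem sinks_le (h : SearchInv N c K₀ A r X K k i j) : j ≤ cut N c A := by
  obtain ⟨Q, rfl, hQ⟩ := h.taken
  choose! f hfN hfA hfc using fun b hb => (hQ b hb).2.2
  calc Q.card = ∑ b ∈ Q, 1 := by simp
    _ ≤ ∑ b ∈ Q, ∑ a ∈ Finset.range N, if a ∈ A ∧ b ∉ A then c a b else 0 := by
      refine Finset.sum_le_sum fun b hb => ?_
      refine le_trans ?_ (Finset.single_le_sum (fun _ _ => Nat.zero_le _)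
        (Finset.mem_range.2 (hfN b hb)))
      rw [if_pos ⟨hfA b hb, h.isCut.2 b (hQ b hb).1 (hQ b hb).2.1⟩]
      exact Nat.one_le_iff_ne_zero.2 (hfc b hb)
    _ ≤ ∑ b ∈ Finset.range N, ∑ a ∈ Finset.range N, if a ∈ A ∧ b ∉ A then c a b else 0 :=
      Finset.sum_le_sum_of_subset fun b hb => Finset.mem_range.2 (hQ b hb).1
    _ = cut N c A := Finset.sum_comm

/-- Flows are never mentioned: the invariant only records that capacity and residual capacity of
every admissible cut differ by `k`. An augmentation lowers all these residual cuts by one. -/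
theorem augment (h : SearchInv N c K₀ A r X K k i j) {r' : ℕ → ℕ → ℕ}
    (hr : ∀ A', IsCut N X K A' → cut N r' A' + 1 = cut N r A') :
    SearchInv N c K₀ A r' X K (k + 1) i j where
  isCut := h.isCut
  sink := h.sink
  residual A' hA' := by rw [h.residual A' hA', ← hr A' hA']; omega
  le_cut := h.le_cut
  taken := h.taken

open Classical in
theorem compl_isCut {B : ℕ → Prop} (hB : BackReach N r K B) (hX : ∀ a < N, X a → ¬ B a) :
    IsCut N X K {a ∈ Finset.range N | ¬ B a} ∧ cut N r {a ∈ Finset.range N | ¬ B a} = 0 := by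
  refine ⟨⟨fun a ha hXa => by simp [ha, hX a ha hXa], fun a ha hKa => by simp [hB.sink a ha hKa]⟩,
    Finset.sum_eq_zero fun a ha => Finset.sum_eq_zero fun b hb => ?_⟩
  simp only [Finset.mem_range] at ha hb
  rw [ite_eq_right_iff]
  simp only [Finset.mem_filter, Finset.mem_range, ha, hb, true_and, not_not]
  intro hab
  by_contra hne
  exact hab.1 (hB.closed a ha b hb hne hab.2)

/-- The complement U of `B` has residual capacity 0, so c(U) = k is minimum and c(U ∩ A) ≥ c(U).
Submodularity gives c(U ∪ A) ≤ c(A), and the maximality of `A` gives U ⊆ A. -/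
theorem mem_of_not_reach (h : SearchInv N c K₀ A r X K k i j) (hA : IsMaximalCut N c K₀ A)
    {B : ℕ → Prop} (hB : BackReach N r K B) (hX : ∀ a < N, X a → ¬ B a) {a : ℕ} (ha : a < N)
    (haB : ¬ B a) : a ∈ A := by
  classical
  obtain ⟨h1, h2⟩ := compl_isCut hB hX
  set U : Finset ℕ := {a ∈ Finset.range N | ¬ B a}
  refine hA U (fun a ha hK => h1.2 a ha (h.sink a ha hK)) ?_ a ha (by simp [U, ha, haB])
  have h3 : IsCut N X K (U ∩ A) :=
    ⟨fun a ha hXa => Finset.mem_inter.2 ⟨h1.1 a ha hXa, h.isCut.1 a ha hXa⟩,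
      fun a ha hKa hm => h1.2 a ha hKa (Finset.mem_inter.1 hm).1⟩
  have := cut_submodular N c U A
  have h4 := h.residual U h1
  have h5 := h.residual _ h3
  omega

/-- The minimum cut has capacity k ≥ i. A cut that also contains `b` is crossed by a residual arc on
the way from `b` to the sinks, hence has capacity at least k + 1. -/
theorem addSource (h : SearchInv N c K₀ A r X K k i j) {B : ℕ → Prop} (hB : BackReach N r K B)
    (hX : ∀ a < N, X a → ¬ B a) {b : ℕ} (hb : b < N) (hbB : B b) (hbA : b ∈ A) :
    SearchInv N c K₀ A r (fun a => X a ∨ a = b) K k (i + 1) j where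
  isCut := ⟨fun a ha hXa => hXa.elim (h.isCut.1 a ha) fun h => h ▸ hbA, h.isCut.2⟩
  sink := h.sink
  residual A' hA' := h.residual A' ⟨fun a ha hXa => hA'.1 a ha (.inl hXa), hA'.2⟩
  le_cut A' hA' := by
    classical
    obtain ⟨h1, h2⟩ := compl_isCut hB hX
    have h3 := h.le_cut _ h1
    rw [h.residual _ h1, h2] at h3
    rw [h.residual A' ⟨fun a ha hXa => hA'.1 a ha (.inl hXa), hA'.2⟩]
    have := hB.one_le_cut b hb hbB A' (hA'.1 b hb (.inr rfl)) hA'.2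
    omega
  taken := h.taken

/-- The tail `a` has no residual path to the sinks, so it lies in `A`; thus `b` is a new head of an
arc that leaves `A`. -/
theorem addSink (h : SearchInv N c K₀ A r X K k i j) (hA : IsMaximalCut N c K₀ A) {B : ℕ → Prop}
    (hB : BackReach N r K B) (hX : ∀ a < N, X a → ¬ B a) {a b : ℕ} (ha : a < N) (hb : b < N)
    (haB : ¬ B a) (hbK : ¬ K b) (hc : c a b ≠ 0) (hbA : b ∉ A) :
    SearchInv N c K₀ A r X (fun a => K a ∨ a = b) k i (j + 1) where
  isCut := ⟨h.isCut.1, fun a ha hKa => hKa.elim (h.isCut.2 a ha) fun h => h ▸ hbA⟩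
  sink a ha hKa := .inl (h.sink a ha hKa)
  residual A' hA' := h.residual A' ⟨hA'.1, fun a ha hXa => hA'.2 a ha (.inl hXa)⟩
  le_cut A' hA' := h.le_cut A' ⟨hA'.1, fun a ha hXa => hA'.2 a ha (.inl hXa)⟩
  taken := by
    obtain ⟨Q, rfl, hQ⟩ := h.taken
    refine ⟨insert b Q, Finset.card_insert_of_notMem fun hm => hbK (hQ b hm).2.1, fun b' hb' => ?_⟩
    rcases Finset.mem_insert.1 hb' with rfl | hb'
    · exact ⟨hb, .inr rfl, a, ha, h.mem_of_not_reach hA hB hX ha haB, hc⟩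
    · exact ⟨(hQ b' hb').1, .inl (hQ b' hb').2.1, (hQ b' hb').2.2⟩

end SearchInv

/-! ### The network of a digraph -/

/-- The capacities of the network of a digraph: the vertex `u` becomes the arc from `u` to `u + n`,
an arc from `u` to `w` becomes one from `u + n` to `w`. -/
structure IsNetwork {n : ℕ} (G : Digraph (Fin n)) (D : Finset (Fin n)) (c : ℕ → ℕ → ℕ) : Prop where
  vertex : ∀ u : Fin n, c u (u + n) = if u ∈ D then n + 1 else 1
  arc : ∀ u w : Fin n, G.Adj u w → c (u + n) w = n + 1
  eq_zero : ∀ a < n + n, ∀ b < n + n, c a b ≠ 0 → (∃ u : Fin n, a = u ∧ b = u + n) ∨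
    ∃ u w : Fin n, G.Adj u w ∧ a = u + n ∧ b = w

/-- The vertices with arcs out of `A`. -/
def boundary {n : ℕ} (A : ℕ → Prop) [DecidablePred A] : Finset (Fin n) :=
  {u | A u ∧ ¬ A (u + n)}

variable {n : ℕ} {G : Digraph (Fin n)} {D T : Finset (Fin n)} {c : ℕ → ℕ → ℕ}

theorem mem_boundary {A : ℕ → Prop} [DecidablePred A] {u : Fin n} :
    u ∈ boundary (n := n) A ↔ A u ∧ ¬ A (u + n) := by
  simp [boundary]

/-- A walk from the out-node of `v` can leave `A` only through a vertex arc, whose vertex is then in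
the boundary. The in-node of `v` itself need not lie in `A`, hence the exception `x = v`. -/
theorem reach_subset_of_network (hc : IsNetwork G D c) {A : ℕ → Prop} [DecidablePred A]
    {v : Fin n} (hv : A (v + n))
    (harc : ∀ u w : Fin n, A (u + n) → ¬ A w → c (u + n) w = 0) {x : Fin n}
    (hx : x ∈ reach G (boundary A) {v}) : (x = v ∨ A x) ∧ A (x + n) := by
  obtain ⟨v', hv', -, hp⟩ := hx
  rw [Finset.mem_singleton] at hv'
  subst hv'
  induction hp with
  | refl => exact ⟨.inl rfl, hv⟩
  | tail _ hab ih =>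
    rename_i a b _
    have h1 : A b := by
      by_contra h1
      have h2 := harc a b ih.2 h1
      rw [hc.arc a b hab.1] at h2
      omega
    refine ⟨.inr h1, ?_⟩
    by_contra hb
    exact hab.2.2 (mem_boundary.2 ⟨h1, hb⟩)

/-- The boundary of a cut without arcs of large capacity is a separator. -/
theorem isSeparator_boundary (hc : IsNetwork G D c) {A : ℕ → Prop} [DecidablePred A]
    {v : Fin n} (hv : A (v + n)) (hvT : v ∉ T) (hT : T.Nonempty) (hAT : ∀ t ∈ T, ¬ A t)
    (hA : ∀ a < n + n, ∀ b < n + n, A a → ¬ A b → c a b ≠ 0 → ∃ u : Fin n, a = u ∧ u ∉ D) :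
    IsSeparator G D {v} T (boundary A) := by
  refine ⟨by simp, hT, by simpa using hvT, ?_, ?_⟩
  · rw [Finset.disjoint_left]
    intro u hu hu'
    rw [mem_boundary] at hu
    simp only [Finset.mem_union, Finset.mem_singleton] at hu'
    rcases hu' with (rfl | h) | h
    · exact hu.2 hv
    · exact hAT u h hu.1
    · obtain ⟨u', h1, h2⟩ := hA u (by omega) (u + n) (by omega) hu.1 hu.2
        (by rw [hc.vertex]; split_ifs; omega)
      exact h2 (Fin.ext h1 ▸ h)
  · intro t ht hr
    have h1 := reach_subset_of_network hc hv (fun u w hu hw => by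
      by_contra hne
      obtain ⟨u', h1, -⟩ := hA _ (by omega) _ (by omega) hu hw hne
      omega) hr
    rcases h1.1 with rfl | h
    · exact hvT ht
    · exact hAT t ht h

/-- The cut that belongs to the separator `S`. -/
def separatorCut (G : Digraph (Fin n)) (v : Fin n) (S : Finset (Fin n)) : Set ℕ :=
  {a | ∃ x : Fin n, (a = x ∧ (x ∈ S ∨ x ∈ reach G S {v})) ∨ (a = x + n ∧ x ∈ reach G S {v})}

theorem coe_mem_separatorCut {v x : Fin n} {S : Finset (Fin n)} :
    (x : ℕ) ∈ separatorCut G v S ↔ x ∈ S ∨ x ∈ reach G S {v} := by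
  constructor
  · rintro ⟨y, ⟨h, h'⟩ | ⟨h, -⟩⟩
    · rwa [Fin.ext h]
    · omega
  · exact fun h => ⟨x, .inl ⟨rfl, h⟩⟩

theorem coe_add_mem_separatorCut {v x : Fin n} {S : Finset (Fin n)} :
    (x + n : ℕ) ∈ separatorCut G v S ↔ x ∈ reach G S {v} := by
  constructor
  · rintro ⟨y, ⟨h, -⟩ | ⟨h, h'⟩⟩
    · omega
    · rwa [Fin.ext (show (x : ℕ) = y by omega)]
  · exact fun h => ⟨x, .inr ⟨rfl, h⟩⟩

theorem notMem_of_mem_reach {S : Finset (Fin n)} {X : Finset (Fin n)} {x : Fin n}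
    (h : x ∈ reach G S X) : x ∉ S := by
  obtain ⟨v, -, hvS, hp⟩ := h
  rcases Relation.ReflTransGen.cases_tail hp with h | ⟨a, -, hab⟩
  · exact h ▸ hvS
  · exact hab.2.2

theorem mem_reach_of_adj {S : Finset (Fin n)} {X : Finset (Fin n)} {x y : Fin n}
    (h : x ∈ reach G S X) (hxy : G.Adj x y) (hy : y ∉ S) : y ∈ reach G S X := by
  have hx := notMem_of_mem_reach h
  obtain ⟨v, hv, hvS, hp⟩ := h
  exact ⟨v, hv, hvS, hp.tail ⟨hxy, hx, hy⟩⟩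

/-- Only the vertex arcs of elements of `S` leave the cut, and these have capacity 1. An arc of G
out of a reachable vertex ends in a reachable vertex or in `S`. -/
theorem cut_separatorCut_le (hc : IsNetwork G D c) {v : Fin n} {S : Finset (Fin n)}
    (hSD : Disjoint S D) {A : Finset ℕ} (hA : ∀ a, a ∈ A ↔ a ∈ separatorCut G v S) :
    cut (n + n) c A ≤ S.card := by
  have key : ∀ a < n + n, ∀ b < n + n, (if a ∈ A ∧ b ∉ A then c a b else 0) ≤
      ∑ u ∈ S, if a = (u : ℕ) ∧ b = u + n then 1 else 0 := by
    intro a ha b hb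
    split_ifs with h
    swap; · exact Nat.zero_le _
    rw [hA, hA] at h
    by_cases h0 : c a b = 0
    · simp [h0]
    rcases hc.eq_zero a ha b hb h0 with ⟨u, rfl, rfl⟩ | ⟨u, w, huw, rfl, rfl⟩
    · rw [coe_mem_separatorCut, coe_add_mem_separatorCut] at h
      have hu : u ∈ S := h.1.resolve_right h.2
      have huD : u ∉ D := Finset.disjoint_left.1 hSD hu
      rw [hc.vertex, if_neg huD]
      refine le_trans ?_ (Finset.single_le_sum (fun _ _ => Nat.zero_le _) hu)
      simp
    · rw [coe_mem_separatorCut, coe_add_mem_separatorCut] at h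
      exact absurd (mem_reach_of_adj h.1 huw fun hw => h.2 (.inl hw)) fun hw => h.2 (.inr hw)
  calc cut (n + n) c A
      ≤ ∑ a ∈ Finset.range (n + n), ∑ b ∈ Finset.range (n + n), ∑ u ∈ S,
          if a = (u : ℕ) ∧ b = u + n then 1 else 0 :=
        Finset.sum_le_sum fun a ha => Finset.sum_le_sum fun b hb =>
          key a (Finset.mem_range.1 ha) b (Finset.mem_range.1 hb)
    _ = ∑ u ∈ S, ∑ a ∈ Finset.range (n + n), ∑ b ∈ Finset.range (n + n),
          if a = (u : ℕ) ∧ b = u + n then 1 else 0 := by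
        rw [Finset.sum_comm]
        rw [Finset.sum_congr rfl fun b _ => Finset.sum_comm]
        rw [Finset.sum_comm]
        exact Finset.sum_congr rfl fun u _ => Finset.sum_comm
    _ ≤ ∑ u ∈ S, 1 := by
        refine Finset.sum_le_sum fun u _ => ?_
        rw [Finset.sum_eq_single (u : ℕ), Finset.sum_eq_single (u + n : ℕ)]
        · simp
        · intro b _ hb; simp [hb]
        · intro h; exact absurd (Finset.mem_range.2 (by omega)) h
        · intro b _ hb; simp [hb]
        · intro h; exact absurd (Finset.mem_range.2 (by omega)) h
    _ = S.card := by simp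

/-- Distinct boundary vertices contribute distinct vertex arcs, each of capacity at least 1. -/
theorem card_boundary_le (hc : IsNetwork G D c) (A : Finset ℕ) :
    (boundary (n := n) (· ∈ A)).card ≤ cut (n + n) c A := by
  calc (boundary (n := n) (· ∈ A)).card = ∑ u ∈ boundary (n := n) (· ∈ A), 1 := by simp
    _ ≤ ∑ u ∈ boundary (n := n) (· ∈ A), ∑ b ∈ Finset.range (n + n),
          if (u : ℕ) ∈ A ∧ b ∉ A then c u b else 0 := by
        refine Finset.sum_le_sum fun u hu => ?_
        rw [mem_boundary] at hu
        refine le_trans ?_ (Finset.single_le_sum (fun _ _ => Nat.zero_le _)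
          (Finset.mem_range.2 (show (u + n : ℕ) < n + n by omega)))
        rw [if_pos hu, hc.vertex]
        split_ifs <;> omega
    _ = ∑ a ∈ (boundary (n := n) (· ∈ A)).map Fin.valEmbedding, ∑ b ∈ Finset.range (n + n),
          if a ∈ A ∧ b ∉ A then c a b else 0 := by
        rw [Finset.sum_map]
        rfl
    _ ≤ _ := Finset.sum_le_sum_of_subset fun a ha => by
        obtain ⟨u, -, rfl⟩ := Finset.mem_map.1 ha
        simp only [Fin.valEmbedding_apply, Finset.mem_range]
        omega

/-- An important separator belongs to a maximal cut. -/
theorem IsImportantSeparator.exists_cut (hc : IsNetwork G D c) {v : Fin n}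
    {S : Finset (Fin n)} (hS : IsImportantSeparator G D {v} T S) :
    ∃ A : Finset ℕ, v + n ∈ A ∧ (∀ t ∈ T, (t : ℕ) ∉ A) ∧ cut (n + n) c A ≤ S.card ∧
      IsMaximalCut (n + n) c (fun a => ∃ t ∈ T, a = (t : ℕ)) A ∧
      ∀ a < n + n, ∀ b < n + n, a ∈ A → b ∉ A → c a b ≠ 0 → ∃ u : Fin n, a = u ∧ u ∈ S := by
  classical
  obtain ⟨⟨hsep, hmin⟩, himp⟩ := hS
  have hav := Finset.disjoint_left.1 hsep.avoids
  have hvS : v ∉ S := fun h => hav h (by simp)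
  have hST : ∀ t ∈ T, t ∉ S := fun t ht h => hav h (by simp [ht])
  have hSD : Disjoint S D := Finset.disjoint_left.2 fun x hx h => hav hx (by simp [h])
  have hvr : v ∈ reach G S {v} := ⟨v, by simp, hvS, .refl⟩
  have hSn : S.card ≤ n := by simpa using Finset.card_le_univ S
  let A₀ : Finset ℕ := {a ∈ Finset.range (n + n) | a ∈ separatorCut G v S}
  have hA₀ : ∀ a, a ∈ A₀ ↔ a ∈ separatorCut G v S := by
    intro a
    simp only [A₀, Finset.mem_filter, Finset.mem_range, and_iff_right_iff_imp]
    rintro ⟨x, ⟨h, -⟩ | ⟨h, -⟩⟩ <;> omega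
  -- The cuts that contain the cut of `S` and cost no more than |S|; a member of maximal cardinality
  -- is the required cut.
  let 𝓐 : Finset (Finset ℕ) := {A ∈ (Finset.range (n + n)).powerset |
    A₀ ⊆ A ∧ (∀ t ∈ T, (t : ℕ) ∉ A) ∧ cut (n + n) c A ≤ S.card}
  have h𝓐 : ∀ A, A ∈ 𝓐 ↔ A ⊆ Finset.range (n + n) ∧
      A₀ ⊆ A ∧ (∀ t ∈ T, (t : ℕ) ∉ A) ∧ cut (n + n) c A ≤ S.card := by simp [𝓐]
  have hne : 𝓐.Nonempty := ⟨A₀, (h𝓐 _).2 ⟨Finset.filter_subset _ _, subset_rfl, fun t ht h => by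
    rw [hA₀, coe_mem_separatorCut] at h
    rcases h with h | h
    exacts [hST t ht h, hsep.separates t ht h], cut_separatorCut_le hc hSD hA₀⟩⟩
  obtain ⟨A, hA𝓐, hmax⟩ := 𝓐.exists_max_image Finset.card hne
  obtain ⟨hAn, hA₀A, hAT, hAc⟩ := (h𝓐 A).1 hA𝓐
  have hvA : v + n ∈ A := hA₀A ((hA₀ _).2 (coe_add_mem_separatorCut.2 hvr))
  -- No arc of capacity n + 1 leaves `A`, as the whole cut costs at most |S| ≤ n.
  have hbig : ∀ a < n + n, ∀ b < n + n, a ∈ A → b ∉ A → c a b ≤ n := fun a ha b hb h h' =>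
    (le_cut c ha hb h h').trans (hAc.trans hSn)
  have harc : ∀ u w : Fin n, G.Adj u w → (u + n : ℕ) ∈ A → (w : ℕ) ∈ A := by
    intro u w huw hu
    by_contra hw
    have := hbig _ (by omega) _ (by omega) hu hw
    rw [hc.arc u w huw] at this
    omega
  have hcross : ∀ a < n + n, ∀ b < n + n, a ∈ A → b ∉ A → c a b ≠ 0 →
      ∃ u : Fin n, a = u ∧ u ∉ D ∧ b = u + n := by
    intro a ha b hb h h' hab
    rcases hc.eq_zero a ha b hb hab with ⟨u, rfl, rfl⟩ | ⟨u, w, huw, rfl, rfl⟩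
    · refine ⟨u, rfl, fun hu => ?_, rfl⟩
      have := hbig _ ha _ hb h h'
      rw [hc.vertex, if_pos hu] at this
      omega
    · exact absurd (harc u w huw h) h'
  have hT : T.Nonempty := hsep.right_nonempty
  have hvT : v ∉ T := by simpa using hsep.disjoint
  set S'' := boundary (n := n) (· ∈ A) with hS''
  have hsep'' : IsSeparator G D {v} T S'' :=
    isSeparator_boundary hc hvA hvT hT hAT fun a ha b hb h h' hab => by
      obtain ⟨u, h1, h2, -⟩ := hcross a ha b hb h h' hab
      exact ⟨u, h1, h2⟩
  have hsub : reach G S {v} ⊆ reach G S'' {v} := by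
    rintro x ⟨v', hv', -, hp⟩
    rw [Finset.mem_singleton] at hv'
    subst hv'
    have hout : ∀ y, y ∈ reach G S {v'} → y ∉ S'' := fun y hy hy' =>
      (mem_boundary.1 hy').2 (hA₀A ((hA₀ _).2 (coe_add_mem_separatorCut.2 hy)))
    induction hp with
    | refl => exact ⟨v', by simp, hout v' hvr, .refl⟩
    | tail hp hab ih =>
      exact mem_reach_of_adj ih hab.1 (hout _ ⟨v', by simp, hvS, hp.tail hab⟩)
  have hcard : S''.card ≤ S.card := (card_boundary_le hc A).trans hAc
  -- This is where importance enters: `S''` is a separator of at most the same size whose reachable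
  -- set is at least as large.
  have heq : reach G S'' {v} ⊆ reach G S {v} := by
    by_contra h
    exact himp ⟨S'', hsep'', hcard, hsub, h⟩
  have hSS : S ⊆ S'' := by
    intro x hx
    -- By minimality every element of `S` has an in-neighbour that is reachable in G \ S; otherwise
    -- deleting it from `S` would leave a separator.
    obtain ⟨y, hy, hyx⟩ : ∃ y, y ∈ reach G S {v} ∧ G.Adj y x := by
      by_contra! hno
      refine hmin (S.erase x) (Finset.erase_ssubset hx) ⟨hsep.left_nonempty, hT, hsep.disjoint,
        hsep.avoids.mono_left (Finset.erase_subset _ _), fun t ht hr => hsep.separates t ht ?_⟩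
      obtain ⟨v', hv', -, hp⟩ := hr
      rw [Finset.mem_singleton] at hv'
      subst hv'
      clear ht
      induction hp with
      | refl => exact hvr
      | tail _ hab ih =>
        rename_i a b _
        refine mem_reach_of_adj ih hab.1 fun hb => hab.2.2 (Finset.mem_erase.2 ⟨?_, hb⟩)
        rintro rfl
        exact hno a ih hab.1
    refine mem_boundary.2 ⟨harc y x hyx (hA₀A ((hA₀ _).2 (coe_add_mem_separatorCut.2 hy))), ?_⟩
    intro hxA
    have hx'' : x ∉ S'' := fun h => (mem_boundary.1 h).2 hxA
    exact notMem_of_mem_reach (heq (mem_reach_of_adj (hsub hy) hyx hx'')) hx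
  have hSeq : S = S'' := Finset.eq_of_subset_of_card_le hSS hcard
  refine ⟨A, hvA, hAT, hAc, ?_, ?_⟩
  · intro U hU hUA a ha haU
    -- `U` is arbitrary, whereas members of `𝓐` consist of nodes only; nodes out of range do not
    -- affect the capacity.
    have hmem : (U ∩ Finset.range (n + n)) ∪ A ∈ 𝓐 := by
      refine (h𝓐 _).2 ⟨Finset.union_subset Finset.inter_subset_right hAn,
        hA₀A.trans Finset.subset_union_right, fun t ht h => ?_, ?_⟩
      · rcases Finset.mem_union.1 h with h | h
        · exact hU t (by omega) ⟨t, ht, rfl⟩ (Finset.mem_inter.1 h).1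
        · exact hAT t ht h
      · refine le_trans (le_of_eq ?_) (hUA.trans hAc)
        refine Finset.sum_congr rfl fun a ha => Finset.sum_congr rfl fun b hb => ?_
        simp [Finset.mem_range.1 ha, Finset.mem_range.1 hb]
    have h1 := Finset.eq_of_subset_of_card_le (Finset.subset_union_right) (hmax _ hmem)
    rw [h1]
    simp [haU, ha]
  · intro a ha b hb h h' hab
    obtain ⟨u, rfl, -, rfl⟩ := hcross a ha b hb h h' hab
    exact ⟨u, rfl, hSeq ▸ mem_boundary.2 ⟨h, h'⟩⟩

end RandomSampling

namespace RandomSampling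

/-! ### Backward search by levels -/

/-- Intermediate stage of the search: `ℓ` holds the levels found so far (`0` for none, `1` for
sinks), `nx` the next nodes on the way to the sinks. -/
structure PartialLevels (N : ℕ) (r : ℕ → ℕ → ℕ) (K : ℕ → Prop) (i a₀ b₀ : ℕ) (ℓ nx : ℕ → ℕ) :
    Prop where
  sink : ∀ a < N, K a ↔ ℓ a = 1
  next : ∀ a < N, 2 ≤ ℓ a → nx a < N ∧ r a (nx a) ≠ 0 ∧ ℓ a = ℓ (nx a) + 1
  closed : ∀ a < N, ∀ b < N, r a b ≠ 0 → ℓ b ≠ 0 →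
    (ℓ b ≤ i ∨ ℓ b = i + 1 ∧ (a < a₀ ∨ a = a₀ ∧ b < b₀)) → ℓ a ≠ 0

namespace PartialLevels

variable {N : ℕ} {r : ℕ → ℕ → ℕ} {K : ℕ → Prop} {i a₀ b₀ : ℕ} {ℓ nx : ℕ → ℕ}

theorem unchanged (h : PartialLevels N r K i a₀ b₀ ℓ nx)
    (hno : ¬ (ℓ a₀ = 0 ∧ ℓ b₀ = i + 1 ∧ r a₀ b₀ ≠ 0)) :
    PartialLevels N r K i a₀ (b₀ + 1) ℓ nx where
  sink := h.sink
  next := h.next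
  closed a ha b hb hr hlb hc := by
    rcases hc with hc | ⟨hc, hc' | ⟨rfl, hc'⟩⟩
    · exact h.closed a ha b hb hr hlb (.inl hc)
    · exact h.closed a ha b hb hr hlb (.inr ⟨hc, .inl hc'⟩)
    · rcases Nat.lt_succ_iff_lt_or_eq.1 hc' with hc' | rfl
      · exact h.closed a ha b hb hr hlb (.inr ⟨hc, .inr ⟨rfl, hc'⟩⟩)
      · exact fun h0 => hno ⟨h0, hc, hr⟩

theorem update (h : PartialLevels N r K i a₀ b₀ ℓ nx) (hb₀ : b₀ < N)
    (h0 : ℓ a₀ = 0) (h1 : ℓ b₀ = i + 1) (h2 : r a₀ b₀ ≠ 0) :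
    PartialLevels N r K i a₀ (b₀ + 1) (Function.update ℓ a₀ (i + 2)) (Function.update nx a₀ b₀) where
  sink a ha := by
    have := h.sink a ha
    grind [Function.update_apply]
  next a ha := by
    have := h.next a ha
    grind [Function.update_apply]
  closed a ha b hb hr := by
    have := h.closed a ha b hb hr
    grind [Function.update_apply]

theorem next_row (h : PartialLevels N r K i a₀ N ℓ nx) : PartialLevels N r K i (a₀ + 1) 0 ℓ nx where
  sink := h.sink
  next := h.next
  closed a ha b hb hr hlb hc := h.closed a ha b hb hr hlb (by omega)

theorem next_level (h : PartialLevels N r K i N b₀ ℓ nx) :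
    PartialLevels N r K (i + 1) 0 0 ℓ nx where
  sink := h.sink
  next := h.next
  closed a ha b hb hr hlb hc := h.closed a ha b hb hr hlb (by omega)

/-- Following `nx` lowers the level by exactly one, so no level below an occupied one is skipped. -/
theorem exists_level (h : PartialLevels N r K i a₀ b₀ ℓ nx) :
    ∀ d a, a < N → ∀ j, 1 ≤ j → j + d = ℓ a → ∃ a' < N, ℓ a' = j := by
  intro d
  induction d with
  | zero => exact fun a ha j _ h => ⟨a, ha, by omega⟩
  | succ d ih =>
    intro a ha j hj hja
    obtain ⟨h1, -, h2⟩ := h.next a ha (by omega)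
    exact ih (nx a) h1 j hj (by omega)

/-- All levels from 1 to that of `a` are occupied, so there are at most `N` of them. Hence `N`
passes of the search suffice. -/
theorem le (h : PartialLevels N r K i a₀ b₀ ℓ nx) {a : ℕ} (ha : a < N) : ℓ a ≤ N := by
  have hsub : Finset.Icc 1 (ℓ a) ⊆ (Finset.range N).image ℓ := by
    intro j hj
    rw [Finset.mem_Icc] at hj
    obtain ⟨a', ha', h'⟩ := h.exists_level (ℓ a - j) a ha j hj.1 (by omega)
    exact Finset.mem_image.2 ⟨a', Finset.mem_range.2 ha', h'⟩
  have := (Finset.card_le_card hsub).trans Finset.card_image_le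
  simpa using this

/-- For `one_le_cut`, follow `nx` from `b ∈ A` down to level 1. Sinks lie outside `A`, so some step
leaves `A` along an arc of positive residual capacity. -/
theorem backReach (h : PartialLevels N r K N 0 0 ℓ nx) : BackReach N r K (fun a => ℓ a ≠ 0) where
  sink a ha hK := by rw [(h.sink a ha).1 hK]; exact one_ne_zero
  closed a ha b hb hr hlb := h.closed a ha b hb hr hlb (.inl (h.le hb))
  one_le_cut b hb hlb A hbA hA := by
    have : ∀ j b, b < N → ℓ b = j + 1 → b ∈ A → 1 ≤ cut N r A := by
      intro j
      induction j with
      | zero => exact fun b hb hj hbA => absurd hbA (hA b hb ((h.sink b hb).2 hj))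
      | succ j ih =>
        intro b hb hj hbA
        obtain ⟨h1, h2, h3⟩ := h.next b hb (by omega)
        by_cases hn : nx b ∈ A
        · exact ih _ h1 (by omega) hn
        · exact (Nat.one_le_iff_ne_zero.2 h2).trans (le_cut r hb h1 hbA hn)
    exact this (ℓ b - 1) b hb (by omega) hbA

end PartialLevels

/-! ### Augmentation along a path of descending levels -/

/-- Intermediate stage of an augmentation along a path from `x`, which has been followed up to `y`. -/
structure PartialAugment (N : ℕ) (r : ℕ → ℕ → ℕ) (ℓ : ℕ → ℕ) (x i y : ℕ) (r' : ℕ → ℕ → ℕ) :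
    Prop where
  lt : y < N
  ne_zero : ℓ y ≠ 0
  level : ℓ y ≤ 1 ∨ ℓ y + i ≤ N
  cut_eq : ∀ A : Finset ℕ,
    cut N r' A + (if x ∈ A then 1 else 0) = cut N r A + (if y ∈ A then 1 else 0)
  le : ∀ a < N, ℓ a ≤ ℓ y → ∀ b < N, r a b ≤ r' a b

namespace PartialAugment

variable {N : ℕ} {r r' r'' : ℕ → ℕ → ℕ} {K : ℕ → Prop} {x y i : ℕ} {ℓ nx : ℕ → ℕ}

/-- Levels strictly descend, so only rows of higher levels have lost capacity so far; the next arc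
still has its positive residual capacity. Hence the effect `hr` of the update need only hold in that
case, where truncated subtraction is exact. -/
theorem step (h : PartialAugment N r ℓ x i y r') (hℓ : PartialLevels N r K N 0 0 ℓ nx)
    (hy : ¬ K y)
    (hr : r' y (nx y) ≠ 0 → ∀ a < N, ∀ b < N, r'' a b + (if a = y ∧ b = nx y then 1 else 0) =
      r' a b + (if a = nx y ∧ b = y then 1 else 0)) :
    PartialAugment N r ℓ x (i + 1) (nx y) r'' := by
  have h1 : ℓ y ≠ 1 := fun h1 => hy ((hℓ.sink y h.lt).2 h1)
  have h0 := h.ne_zero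
  obtain ⟨h2, h3, h4⟩ := hℓ.next y h.lt (by omega)
  have h5 := h.le y h.lt le_rfl _ h2
  have hr := hr (by omega)
  have h6 := h.level
  refine ⟨h2, by omega, by omega, fun A => ?_, fun a ha hla b hb => ?_⟩
  · have := cut_push h.lt h2 hr A
    have := h.cut_eq A
    omega
  · have h7 := h.le a ha (by omega) b hb
    have h8 := hr a ha b hb
    have h9 : ¬ (a = y ∧ b = nx y) := by rintro ⟨rfl, -⟩; omega
    rw [if_neg h9] at h8
    omega

theorem done (h : PartialAugment N r ℓ x i y r') (hℓ : PartialLevels N r K N 0 0 ℓ nx)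
    (hy : K y) : PartialAugment N r ℓ x (i + 1) y r' :=
  ⟨h.lt, h.ne_zero, .inl ((hℓ.sink y h.lt).1 hy).le, h.cut_eq, h.le⟩

/-- After `N` steps the level is 1, since it is non-zero and each step before a sink lowers it. The
path thus ends in a sink, which is outside `A`, and `cut_eq` becomes a loss of one unit. -/
theorem cut_add_one (h : PartialAugment N r ℓ x N y r') (hℓ : PartialLevels N r K N 0 0 ℓ nx)
    {A : Finset ℕ} (hx : x ∈ A) (hA : ∀ a < N, K a → a ∉ A) : cut N r' A + 1 = cut N r A := by
  have h1 := h.level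
  have h2 := h.ne_zero
  have h3 : K y := (hℓ.sink y h.lt).2 (by omega)
  simpa [hx, hA y h.lt h3] using h.cut_eq A

end PartialAugment

/-! ### The program

Variables: `0` and `1` input, `2` number of nodes, `3` bound for the size of separators, `4` number
of choice sequences, `5` whether there are terminals, `6` choice sequence, `7` vertex, `8` remaining
choices, `9`, `10`, `11`, `17` counters, `12`, `18` results of searches, `13`, `14` current arc,
`15` verdict, `16` coin, `19` number of rounds, `20` number of
cells of a matrix.
Arrays: `0`, `1`, `2` input, `3` output, `4` random set, `5`, `14` multiples of `2 * n` and `n`,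
`6` capacities, `7` residual capacities, `8` sources, `9` sinks, `10` levels, `11` next nodes,
`12`, `13` remainders and quotients modulo `2`. -/

open LoopProg

/-- The index of a cell of a matrix with rows and columns indexed by the nodes. -/
def cell (x y : ℕ) : Expr := .add (.get 5 (.var x)) (.var y)

/-- An expression whose value is zero if and only if `e` and `f` have the same value. -/
def differ (e f : Expr) : Expr := .add (.sub e f) (.sub f e)

theorem eval_differ_eq_zero {e f : Expr} {s : State} :
    (differ e f).eval s = 0 ↔ e.eval s = f.eval s := by
  simp only [differ, Expr.eval]
  omega

/-- The residual capacities. -/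
def State.res (s : State) (a b : ℕ) : ℕ := s.arr 7 (a * s.var 2 + b)

/-- The capacities. -/
def State.cap (s : State) (a b : ℕ) : ℕ := s.arr 6 (a * s.var 2 + b)

/-- Array `5` holds the offsets of the rows, variable `20` the number of cells of a matrix. -/
def State.Offsets (s : State) : Prop :=
  (∀ a < s.var 2, s.arr 5 a = a * s.var 2) ∧ s.var 20 = s.var 2 * s.var 2

def levelStep : LoopProg :=
  .ite (.get 10 (.var 10)) .skip (.ite (differ (.get 10 (.var 11)) (.add (.var 9) (.const 1))) .skip
    (.ite (.get 7 (cell 10 11))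
      (.seq (storeLt 2 10 (.var 10) (.add (.var 9) (.const 2)))
        (storeLt 2 11 (.var 10) (.var 11))) .skip))

def initLevels : LoopProg :=
  .rep 2 10 (.ite (.get 9 (.var 10)) (storeLt 2 10 (.var 10) (.const 1))
    (storeLt 2 10 (.var 10) (.const 0)))

/-- Computes the levels. -/
def levels : LoopProg := .seq initLevels (.rep 2 9 (.rep 2 10 (.rep 2 11 levelStep)))

/-- Three nested uses of the loop rule, with the invariant indexed by level, row and column. The
pass with counter i scans all arcs into level i + 1 and assigns level i + 2. -/
theorem levels_spec (ω : ℕ → Bool) (s : State) (hs : s.Offsets) :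
    PartialLevels (s.var 2) s.res (fun a => s.arr 9 a ≠ 0) (s.var 2) 0 0
      ((levels.den ω s).arr 10) ((levels.den ω s).arr 11) := by
  set s' := initLevels.den ω s with hs'
  have e2 : s'.var 2 = s.var 2 := den_var ω _ rfl s
  have e5 : s'.arr 5 = s.arr 5 := den_arr ω _ rfl s
  have e7 : s'.arr 7 = s.arr 7 := den_arr ω _ rfl s
  have e9 : s'.arr 9 = s.arr 9 := den_arr ω _ rfl s
  have hinit : ∀ a < s.var 2, s'.arr 10 a = if s.arr 9 a ≠ 0 then 1 else 0 := by
    refine rep_induction (l := 2) (x := 10)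
      (fun i s₁ => ∀ a < i, s₁.arr 10 a = if s.arr 9 a ≠ 0 then 1 else 0) rfl (by simp) ?_
    intro i s₁ hi hx hv ha ih a hai
    have h9 := ha 9 rfl
    have hlt : s.var 2 - i ≠ 0 := by omega
    have h2 : s₁.var 2 = s.var 2 := hv 2 rfl (by decide)
    rcases Nat.lt_succ_iff_lt_or_eq.1 hai with h | rfl
    · have := ih a h
      simp only [den, Expr.eval, hx, h9, h2, if_pos hlt]
      split_ifs with h1 <;> simp_all [h.ne]
    · simp only [den, Expr.eval, hx, h9, h2, if_pos hlt]
      split_ifs with h1 <;> simp_all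
  have h0 : PartialLevels (s.var 2) s.res (fun a => s.arr 9 a ≠ 0) 0 0 0 (s'.arr 10) (s'.arr 11) := by
    refine ⟨fun a ha => ?_, fun a ha h => ?_, fun a ha b hb _ h h' => ?_⟩
    · rw [hinit a ha]; split_ifs <;> simp_all
    · rw [hinit a ha] at h; split_ifs at h <;> omega
    · omega
  have hden : levels.den ω s = (LoopProg.rep 2 9 (.rep 2 10 (.rep 2 11 levelStep))).den ω s' := rfl
  rw [hden]
  have := rep_induction (ω := ω) (P := .rep 2 10 (.rep 2 11 levelStep)) (l := 2) (x := 9) (s := s')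
    (fun i s₁ => PartialLevels (s.var 2) s.res (fun a => s.arr 9 a ≠ 0) i 0 0
      (s₁.arr 10) (s₁.arr 11)) rfl h0 ?_
  · rwa [e2] at this
  intro i s₁ _ hx₁ hv₁ ha₁ h₁
  have e2₁ : s₁.var 2 = s.var 2 := (hv₁ 2 rfl (by decide)).trans e2
  have := rep_induction (ω := ω) (P := .rep 2 11 levelStep) (l := 2) (x := 10) (s := s₁)
    (fun a₀ s₁ => PartialLevels (s.var 2) s.res (fun a => s.arr 9 a ≠ 0) i a₀ 0
      (s₁.arr 10) (s₁.arr 11)) rfl h₁ ?_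
  · rw [e2₁] at this
    exact this.next_level
  intro a₀ s₂ ha₀ hx₂ hv₂ ha₂ h₂
  have e2₂ : s₂.var 2 = s.var 2 := (hv₂ 2 rfl (by decide)).trans e2₁
  have := rep_induction (ω := ω) (P := levelStep) (l := 2) (x := 11) (s := s₂)
    (fun b₀ s₁ => PartialLevels (s.var 2) s.res (fun a => s.arr 9 a ≠ 0) i a₀ b₀
      (s₁.arr 10) (s₁.arr 11)) rfl h₂ ?_
  · rw [e2₂] at this
    exact this.next_row
  intro b₀ s₃ hb₀ hx₃ hv₃ ha₃ h₃
  rw [e2₂] at hb₀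
  rw [e2₁] at ha₀
  have f9 : s₃.var 9 = i := by rw [hv₃ 9 rfl (by decide), hv₂ 9 rfl (by decide), hx₁]
  have f10 : s₃.var 10 = a₀ := by rw [hv₃ 10 rfl (by decide), hx₂]
  have f5 : s₃.arr 5 a₀ = a₀ * s.var 2 := by
    rw [ha₃ 5 rfl, ha₂ 5 rfl, ha₁ 5 rfl, e5, hs.1 a₀ ha₀]
  have f7 : s₃.arr 7 = s.arr 7 := by rw [ha₃ 7 rfl, ha₂ 7 rfl, ha₁ 7 rfl, e7]
  simp only [State.setVar_arr, levelStep, den, Expr.eval, eval_differ_eq_zero, ne_eq, hx₃, f9, f10,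
    cell, f5, f7]
  by_cases c1 : s₃.arr 10 a₀ = 0
  swap; · simpa [c1] using h₃.unchanged (by simp [c1])
  by_cases c2 : s₃.arr 10 b₀ = i + 1
  swap; · simpa [c1, c2] using h₃.unchanged (by simp [c2])
  by_cases c3 : s.arr 7 (a₀ * s.var 2 + b₀) = 0
  · simpa [c1, c2, c3] using h₃.unchanged (by simp [State.res, c3])
  · have hlt : s₃.var 2 - a₀ ≠ 0 := by
      rw [hv₃ 2 rfl (by decide), e2₂]; omega
    simpa [c1, c2, c3, hx₃, f9, f10, hlt] using h₃.update hb₀ c1 c2 c3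

end RandomSampling

namespace RandomSampling

open LoopProg

/-! ### The steps of a round: finding a source, augmenting, finding an exit, branching -/

/-- Looks for a source that has a level. -/
def findSource : LoopProg :=
  .seq (.assign 12 (.const 0)) (.rep 2 10 (.ite (.get 8 (.var 10)) (.ite (.get 10 (.var 10))
    (.assign 12 (.add (.var 10) (.const 1))) .skip) .skip))

theorem findSource_spec (ω : ℕ → Bool) (s : State) :
    ((findSource.den ω s).var 12 = 0 ∧ ∀ a < s.var 2, s.arr 8 a ≠ 0 → s.arr 10 a = 0) ∨
      ∃ a < s.var 2, s.arr 8 a ≠ 0 ∧ s.arr 10 a ≠ 0 ∧ (findSource.den ω s).var 12 = a + 1 := by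
  refine rep_induction (l := 2) (x := 10) (s := s.setVar 12 0)
    (fun i s₁ => (s₁.var 12 = 0 ∧ ∀ a < i, s.arr 8 a ≠ 0 → s.arr 10 a = 0) ∨
      ∃ a < s.var 2, s.arr 8 a ≠ 0 ∧ s.arr 10 a ≠ 0 ∧ s₁.var 12 = a + 1) rfl
    (.inl (by simp)) ?_
  intro i s₁ hi hx hv ha ih
  have h8 : s₁.arr 8 = s.arr 8 := ha 8 rfl
  have h10 : s₁.arr 10 = s.arr 10 := ha 10 rfl
  simp only [den, Expr.eval, hx, h8, h10]
  by_cases c1 : s.arr 8 i = 0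
  · simp only [c1, ne_eq, not_true, if_false]
    rcases ih with ih | ih
    · refine .inl ⟨by simpa using ih.1, fun a ha h => ?_⟩
      rcases Nat.lt_succ_iff_lt_or_eq.1 ha with ha | rfl
      exacts [ih.2 a ha h, absurd c1 h]
    · exact .inr (by simpa using ih)
  by_cases c2 : s.arr 10 i = 0
  · simp only [c1, c2, ne_eq, not_true, not_false_iff, if_true, if_false]
    rcases ih with ih | ih
    · refine .inl ⟨by simpa using ih.1, fun a ha h => ?_⟩
      rcases Nat.lt_succ_iff_lt_or_eq.1 ha with ha | rfl
      exacts [ih.2 a ha h, c2]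
    · exact .inr (by simpa using ih)
  · exact .inr ⟨i, by simpa using hi, c1, c2, by simp [c1, c2]⟩

def augmentStep : LoopProg :=
  .ite (.get 9 (.var 13)) .skip
    (.seq (.assign 14 (.get 11 (.var 13)))
    (.seq (storeLt 20 7 (cell 13 14) (.sub (.get 7 (cell 13 14)) (.const 1)))
    (.seq (storeLt 20 7 (cell 14 13) (.add (.get 7 (cell 14 13)) (.const 1)))
    (.assign 13 (.var 14)))))

/-- Augments the flow along the path from the source that was found. -/
def augmentPath : LoopProg :=
  .seq (.assign 13 (.sub (.var 12) (.const 1))) (.rep 2 9 augmentStep)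

theorem cell_inj {N a b c d : ℕ} (hb : b < N) (hd : d < N) :
    a * N + b = c * N + d ↔ a = c ∧ b = d := by
  constructor
  · intro h
    have hN : 0 < N := by omega
    have h1 : (a * N + b) / N = (c * N + d) / N := by rw [h]
    rw [mul_comm a, mul_comm c, Nat.mul_add_div hN, Nat.mul_add_div hN, Nat.div_eq_of_lt hb,
      Nat.div_eq_of_lt hd] at h1
    have h2 : a = c := by simpa using h1
    subst h2
    exact ⟨rfl, by omega⟩
  · rintro ⟨rfl, rfl⟩; rfl

theorem cell_lt {N a b : ℕ} (ha : a < N) (hb : b < N) : a * N + b < N * N := by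
  calc a * N + b < (a + 1) * N := by rw [Nat.succ_mul]; omega
    _ ≤ N * N := Nat.mul_le_mul_right N ha

/-- The loop always makes `N` steps; after a sink is reached they do nothing. -/
theorem augmentPath_spec (ω : ℕ → Bool) (s : State) (hs : s.Offsets)
    (hℓ : PartialLevels (s.var 2) s.res (fun a => s.arr 9 a ≠ 0) (s.var 2) 0 0 (s.arr 10)
      (s.arr 11)) {x : ℕ} (hx : x < s.var 2) (hxℓ : s.arr 10 x ≠ 0) (hs12 : s.var 12 = x + 1)
    {A : Finset ℕ} (hxA : x ∈ A) (hA : ∀ a < s.var 2, s.arr 9 a ≠ 0 → a ∉ A) :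
    cut (s.var 2) (augmentPath.den ω s).res A + 1 = cut (s.var 2) s.res A := by
  suffices h : PartialAugment (s.var 2) s.res (s.arr 10) x (s.var 2) ((augmentPath.den ω s).var 13)
      (augmentPath.den ω s).res from h.cut_add_one hℓ hxA hA
  have e : augmentPath.den ω s = (LoopProg.rep 2 9 augmentStep).den ω (s.setVar 13 x) := by
    simp only [augmentPath, den, Expr.eval, hs12, Nat.add_sub_cancel]
  rw [e]
  refine rep_induction (P := augmentStep) (l := 2) (x := 9) (s := s.setVar 13 x)
    (fun i s₁ => PartialAugment (s.var 2) s.res (s.arr 10) x i (s₁.var 13) s₁.res) rfl ?_ ?_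
  · exact ⟨by simpa using hx, by simpa using hxℓ, .inr (by simpa using hℓ.le hx), fun A => rfl,
      fun a _ _ b _ => le_rfl⟩
  intro i s₁ hi hx₁ hv ha ih
  have h2 : s₁.var 2 = s.var 2 := hv 2 rfl (by decide)
  have h5 : s₁.arr 5 = s.arr 5 := ha 5 rfl
  have h9 : s₁.arr 9 = s.arr 9 := ha 9 rfl
  have h11 : s₁.arr 11 = s.arr 11 := ha 11 rfl
  by_cases hK : s.arr 9 (s₁.var 13) = 0
  swap
  · simp only [augmentStep, den, Expr.eval, h9, hK, ne_eq, not_false_iff, if_true]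
    exact ih.done hℓ hK
  have hy := ih.lt
  have hny : s.arr 11 (s₁.var 13) < s.var 2 ∧
      s.arr 10 (s₁.var 13) = s.arr 10 (s.arr 11 (s₁.var 13)) + 1 := by
    have := hℓ.next _ hy (by
      have := ih.ne_zero
      have := mt (hℓ.sink _ hy).2 (by simpa using hK)
      omega)
    exact ⟨this.1, this.2.2⟩
  have h20 : s₁.var 20 = s.var 2 * s.var 2 := (hv 20 rfl (by decide)).trans hs.2
  have hlt1 := cell_lt hy hny.1
  have hlt2 := cell_lt hny.1 hy
  -- Consecutive nodes have different levels, so the arc and its reverse occupy different cells and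
  -- the second store does not undo the first.
  have hne : s₁.var 13 ≠ s.arr 11 (s₁.var 13) := fun h => by
    have := hny.2
    rw [← h] at this
    omega
  have o1 := hs.1 _ hy
  have o2 := hs.1 _ hny.1
  have key := ih.step hℓ (by simpa using hK)
    (r'' := State.res ((augmentStep.den ω s₁).setVar 9 (i + 1))) ?_
  all_goals
    have hd : augmentStep.den ω s₁ = _ := if_neg (show ¬ (s₁.arr 9 (s₁.var 13) ≠ 0) by simp [h9, hK])
    rw [den, den, den, den_storeLt (by simpa [cell, den, h5, h11, o1, h20] using hlt1), den,
      den_storeLt (by simpa [cell, den, h5, h11, o2, h20] using hlt2)] at hd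
    simp only [den, Expr.eval, cell, State.setVar_var, State.setVar_arr, State.setArr_var,
      State.setArr_arr, Nat.reduceEqDiff, if_true, if_false, h5, h11, o1, o2] at hd
  · convert key using 1
    simp [hd]
  · intro hr a ha' b hb'
    simp only [State.res, h2] at hr ⊢
    simp only [hd, State.setVar_arr, State.setArr_arr, State.setVar_var, State.setArr_var, if_true,
      Function.update_apply, cell_inj hb' hy, cell_inj hb' hny.1, cell_inj hy hny.1, h2,
      Nat.reduceEqDiff, if_false]
    by_cases c1 : a = s₁.var 13 ∧ b = s.arr 11 (s₁.var 13)
    · obtain ⟨rfl, rfl⟩ := c1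
      simp [hne, hne.symm]
      omega
    · by_cases c2 : a = s.arr 11 (s₁.var 13) ∧ b = s₁.var 13
      · obtain ⟨rfl, rfl⟩ := c2
        simp [hne, hne.symm]
      · simp [c1, c2]

def findExitStep : LoopProg :=
  .ite (.get 10 (.var 10)) .skip (.ite (.get 10 (.var 11)) (.ite (.get 9 (.var 11)) .skip
    (.ite (.get 6 (cell 10 11)) (.assign 18 (.add (.var 11) (.const 1))) .skip)) .skip)

/-- Looks for a node that is no sink, has a level, and can be entered from a node without one. -/
def findExit : LoopProg :=
  .seq (.assign 18 (.const 0)) (.rep 2 10 (.rep 2 11 findExitStep))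

/-- The arc from `a` to `b` leaves the set of the nodes without a level for a node that is not
a sink. -/
def State.IsExit (s : State) (a b : ℕ) : Prop :=
  s.arr 10 a = 0 ∧ s.arr 10 b ≠ 0 ∧ s.arr 9 b = 0 ∧ s.cap a b ≠ 0

theorem findExit_spec (ω : ℕ → Bool) (s : State) (hs : s.Offsets) :
    ((findExit.den ω s).var 18 = 0 ∧ ∀ a < s.var 2, ∀ b < s.var 2, ¬ s.IsExit a b) ∨
      ∃ a < s.var 2, ∃ b < s.var 2, s.IsExit a b ∧ (findExit.den ω s).var 18 = b + 1 := by
  let Inv (i j : ℕ) (s₁ : State) : Prop :=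
    (s₁.var 18 = 0 ∧ ∀ a < s.var 2, ∀ b < s.var 2, (a < i ∨ a = i ∧ b < j) → ¬ s.IsExit a b) ∨
      ∃ a < s.var 2, ∃ b < s.var 2, s.IsExit a b ∧ s₁.var 18 = b + 1
  have hInv {i j i' j' : ℕ} {s₁ s₂ : State} (h : Inv i j s₁) (h' : s₂.var 18 = s₁.var 18)
      (hij : ∀ a < s.var 2, ∀ b < s.var 2, (a < i' ∨ a = i' ∧ b < j') → s.IsExit a b →
        (a < i ∨ a = i ∧ b < j)) : Inv i' j' s₂ := by
    rcases h with h | h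
    · exact .inl ⟨h'.trans h.1, fun a ha b hb hc he => h.2 a ha b hb (hij a ha b hb hc he) he⟩
    · exact .inr (by rwa [h'])
  have := rep_induction (ω := ω) (P := .rep 2 11 findExitStep) (l := 2) (x := 10)
    (s := s.setVar 18 0) (fun i s₁ => Inv i 0 s₁) rfl (.inl (by simp)) ?_
  · rcases this with h | h
    · exact .inl ⟨h.1, fun a ha b hb => h.2 a ha b hb (.inl ha)⟩
    · exact .inr h
  intro i s₁ hi hx₁ hv₁ ha₁ h₁
  have := rep_induction (ω := ω) (P := findExitStep) (l := 2) (x := 11)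
    (s := s₁) (fun j s₁ => Inv i j s₁) rfl (hInv h₁ rfl fun a _ b _ h _ => h) ?_
  · refine hInv this rfl fun a _ b hb h _ => ?_
    have e : s₁.var 2 = s.var 2 := hv₁ 2 rfl (by decide)
    omega
  intro j s₂ hj hx₂ hv₂ ha₂ h₂
  have e2 : s₁.var 2 = s.var 2 := hv₁ 2 rfl (by decide)
  have f10 : s₂.var 10 = i := by rw [hv₂ 10 rfl (by decide), hx₁]
  have g5 : s₂.arr 5 i = i * s.var 2 := by rw [ha₂ 5 rfl, ha₁ 5 rfl]; exact hs.1 i hi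
  have g6 : s₂.arr 6 = s.arr 6 := by rw [ha₂ 6 rfl, ha₁ 6 rfl]; rfl
  have g9 : s₂.arr 9 = s.arr 9 := by rw [ha₂ 9 rfl, ha₁ 9 rfl]; rfl
  have g10 : s₂.arr 10 = s.arr 10 := by rw [ha₂ 10 rfl, ha₁ 10 rfl]; rfl
  by_cases he : s.IsExit i j
  · obtain ⟨c1, c2, c3, c4⟩ := he
    refine .inr ⟨i, hi, j, e2 ▸ hj, ⟨c1, c2, c3, c4⟩, ?_⟩
    rw [State.cap] at c4
    simp [findExitStep, den, cell, hx₂, f10, g5, g6, g9, g10, c1, c2, c3, c4]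
  · refine hInv h₂ ?_ fun a _ b _ h h' => ?_
    · rw [State.IsExit, State.cap] at he
      simp only [findExitStep, den, cell, Expr.eval, hx₂, f10, g5, g6, g9, g10]
      split_ifs with c1 c2 c3 c4 <;> simp_all
    · rcases h with h | ⟨rfl, h⟩
      · exact .inl h
      · rcases Nat.lt_succ_iff_lt_or_eq.1 h with h | rfl
        exacts [.inr ⟨rfl, h⟩, absurd h' he]

/-- Makes the node that was found a sink or a source, according to the next choice. -/
def branch : LoopProg :=
  .ite (.var 18) (.seq (.ite (.get 12 (.var 8)) (storeLt 2 9 (.sub (.var 18) (.const 1)) (.const 1))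
    (storeLt 2 8 (.sub (.var 18) (.const 1)) (.const 1))) (.assign 8 (.get 13 (.var 8)))) .skip

def search : LoopProg := .seq levels findSource

/-- One round: an augmentation or a branching. -/
def round : LoopProg :=
  .seq search (.ite (.var 12) augmentPath (.seq findExit branch))

/-- The parts of the state that are fixed during the search. -/
structure State.Fixed (s s' : State) : Prop where
  var2 : s'.var 2 = s.var 2
  var4 : s'.var 4 = s.var 4
  var20 : s'.var 20 = s.var 20
  arr5 : s'.arr 5 = s.arr 5
  arr6 : s'.arr 6 = s.arr 6
  arr12 : s'.arr 12 = s.arr 12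
  arr13 : s'.arr 13 = s.arr 13

theorem State.Fixed.trans {s s' s'' : State} (h : s.Fixed s') (h' : s'.Fixed s'') : s.Fixed s'' :=
  ⟨h'.1.trans h.1, h'.2.trans h.2, h'.3.trans h.3, h'.4.trans h.4, h'.5.trans h.5, h'.6.trans h.6,
    h'.7.trans h.7⟩

theorem State.Fixed.cap {s s' : State} (h : s.Fixed s') : s'.cap = s.cap := by
  funext a b; simp only [State.cap, h.var2, h.arr6]

/-- The sources, the sinks, and the residual capacities are the same. -/
structure State.SameFlow (s s' : State) : Prop where
  res : s'.res = s.res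
  arr8 : s'.arr 8 = s.arr 8
  arr9 : s'.arr 9 = s.arr 9

/-- The three possible effects of a round. -/
theorem round_cases (ω : ℕ → Bool) (s : State) (hs : s.Offsets) :
    ∃ B : ℕ → Prop, BackReach (s.var 2) s.res (fun a => s.arr 9 a ≠ 0) B ∧ ∃ s₁, s.Fixed s₁ ∧
      (((∃ x < s.var 2, s.arr 8 x ≠ 0 ∧ B x) ∧ s₁.arr 8 = s.arr 8 ∧ s₁.arr 9 = s.arr 9 ∧
        (∀ A, IsCut (s.var 2) (fun a => s.arr 8 a ≠ 0) (fun a => s.arr 9 a ≠ 0) A →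
          cut (s.var 2) s₁.res A + 1 = cut (s.var 2) s.res A) ∧
        ∀ k, round.den ω (s.setVar 8 k) = s₁.setVar 8 k) ∨
      s.SameFlow s₁ ∧ (∀ x < s.var 2, s.arr 8 x ≠ 0 → ¬ B x) ∧
      ((∃ a < s.var 2, ∃ b < s.var 2, ¬ B a ∧ B b ∧ s.arr 9 b = 0 ∧ s.cap a b ≠ 0 ∧
        ∀ k, round.den ω (s.setVar 8 k) =
          (if s.arr 12 k ≠ 0 then s₁.setArr 9 b 1 else s₁.setArr 8 b 1).setVar 8 (s.arr 13 k)) ∨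
      (∀ a < s.var 2, ∀ b < s.var 2, ¬ B a → B b → s.arr 9 b = 0 → s.cap a b = 0) ∧
        ∀ k, round.den ω (s.setVar 8 k) = s₁.setVar 8 k)) := by
  set t := search.den ω s with ht
  have t2 : t.var 2 = s.var 2 := den_var ω _ rfl s
  have t4 : t.var 4 = s.var 4 := den_var ω _ rfl s
  have t20 : t.var 20 = s.var 20 := den_var ω _ rfl s
  have t5 : t.arr 5 = s.arr 5 := den_arr ω _ rfl s
  have t6 : t.arr 6 = s.arr 6 := den_arr ω _ rfl s
  have t7 : t.arr 7 = s.arr 7 := den_arr ω _ rfl s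
  have t8 : t.arr 8 = s.arr 8 := den_arr ω _ rfl s
  have t9 : t.arr 9 = s.arr 9 := den_arr ω _ rfl s
  have t10 : t.arr 10 = (levels.den ω s).arr 10 := den_arr ω findSource rfl _
  have t11 : t.arr 11 = (levels.den ω s).arr 11 := den_arr ω findSource rfl _
  have t12 : t.arr 12 = s.arr 12 := den_arr ω _ rfl s
  have t13 : t.arr 13 = s.arr 13 := den_arr ω _ rfl s
  have tres : t.res = s.res := by funext a b; simp only [State.res, t2, t7]
  have tcap : t.cap = s.cap := by funext a b; simp only [State.cap, t2, t6]
  have toff : t.Offsets := by rw [State.Offsets, t2, t5, t20]; exact hs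
  have hℓ := levels_spec ω s hs
  rw [← t10, ← t11] at hℓ
  -- The search for levels and sources ignores the remaining choices, so a single analysis serves
  -- all values `k` at once. This uniformity lets the right choices be determined backwards later.
  have hcomm : ∀ k, search.den ω (s.setVar 8 k) = t.setVar 8 k := den_setVar_comm _ rfl rfl s
  have l2 : (levels.den ω s).var 2 = s.var 2 := den_var ω _ rfl s
  have l8 : (levels.den ω s).arr 8 = s.arr 8 := den_arr ω _ rfl s
  have hfs := findSource_spec ω (levels.den ω s)
  rw [l2, l8, ← t10] at hfs
  change (t.var 12 = 0 ∧ _) ∨ (∃ a < _, _ ∧ _ ∧ t.var 12 = _) at hfs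
  refine ⟨fun a => t.arr 10 a ≠ 0, hℓ.backReach, ?_⟩
  rcases hfs with ⟨h12, hno⟩ | ⟨x, hx, hx8, hx10, h12⟩
  swap
  · refine ⟨augmentPath.den ω t, ⟨?_, ?_, ?_, ?_, ?_, ?_, ?_⟩, .inl ⟨⟨x, hx, hx8, hx10⟩,
      (den_arr ω _ rfl t).trans t8, (den_arr ω _ rfl t).trans t9, fun A hA => ?_, fun k => ?_⟩⟩
    · exact (den_var ω _ rfl t).trans t2
    · exact (den_var ω _ rfl t).trans t4
    · exact (den_var ω _ rfl t).trans t20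
    · exact (den_arr ω _ rfl t).trans t5
    · exact (den_arr ω _ rfl t).trans t6
    · exact (den_arr ω _ rfl t).trans t12
    · exact (den_arr ω _ rfl t).trans t13
    · have := augmentPath_spec ω t toff (by rwa [tres, t2, t9]) (by rwa [t2]) hx10 h12
        (hA.1 x hx hx8) (by rw [t2, t9]; exact hA.2)
      rwa [t2, tres] at this
    · simp only [round, den, hcomm]
      simp only [Expr.eval, State.setVar_var]
      rw [if_pos (by simp [h12])]
      exact den_setVar_comm _ rfl rfl t k
  set e := findExit.den ω t with he
  have e2 : e.var 2 = s.var 2 := (den_var ω _ rfl t).trans t2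
  have e4 : e.var 4 = s.var 4 := (den_var ω _ rfl t).trans t4
  have e20 : e.var 20 = s.var 20 := (den_var ω _ rfl t).trans t20
  have e5 : e.arr 5 = s.arr 5 := (den_arr ω _ rfl t).trans t5
  have e6 : e.arr 6 = s.arr 6 := (den_arr ω _ rfl t).trans t6
  have e7 : e.arr 7 = s.arr 7 := (den_arr ω _ rfl t).trans t7
  have e8 : e.arr 8 = s.arr 8 := (den_arr ω _ rfl t).trans t8
  have e9 : e.arr 9 = s.arr 9 := (den_arr ω _ rfl t).trans t9
  have e12 : e.arr 12 = s.arr 12 := (den_arr ω _ rfl t).trans t12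
  have e13 : e.arr 13 = s.arr 13 := (den_arr ω _ rfl t).trans t13
  have eres : e.res = s.res := by funext a b; simp only [State.res, e2, e7]
  have hround : ∀ k, round.den ω (s.setVar 8 k) = branch.den ω (e.setVar 8 k) := by
    intro k
    simp only [round, den, hcomm]
    simp only [Expr.eval, State.setVar_var]
    rw [if_neg (by simp [h12]), he, den_setVar_comm (ω := ω) findExit rfl rfl t k]
  refine ⟨e, ⟨e2, e4, e20, e5, e6, e12, e13⟩, .inr ⟨⟨eres, e8, e9⟩, fun x hx h8 h10 => h10 (hno x hx h8),
    ?_⟩⟩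
  rcases findExit_spec ω t toff with ⟨h18, hno'⟩ | ⟨a, ha, b, hb, ⟨h1, h2, h3, h4⟩, h18⟩
  · refine .inr ⟨fun a ha b hb h1 h2 h3 => ?_, fun k => ?_⟩
    · by_contra h4
      exact hno' a (t2 ▸ ha) b (t2 ▸ hb) ⟨not_not.1 h1, h2, t9 ▸ h3, tcap ▸ h4⟩
    · rw [hround]
      simp only [branch, den, Expr.eval, State.setVar_var]
      rw [← he] at h18
      rw [if_neg (by simp [h18])]
  · refine .inl ⟨a, t2 ▸ ha, b, t2 ▸ hb, not_not.2 h1, h2, t9 ▸ h3, tcap ▸ h4, fun k => ?_⟩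
    rw [← he] at h18
    rw [hround]
    have : ∀ s' : State, (s'.setVar 8 k).setVar 8 (s.arr 13 k) = s'.setVar 8 (s.arr 13 k) := by
      intro s'; ext y <;> simp; split_ifs <;> rfl
    by_cases c : s.arr 12 k = 0
    all_goals
      have hlt : s.var 2 - b ≠ 0 := by omega
      simp [branch, den, h18, c, e2, e12, e13, hlt]
      first | exact this (e.setArr 9 b 1) | exact this (e.setArr 8 b 1)

end RandomSampling

namespace RandomSampling

open LoopProg

/-! ### Stable states and the right sequence of choices -/

/-- The conditions of `BackReach` determine the set: the complement of `B'` has residual capacity 0,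
so it cannot contain a member of `B`. Applied both ways, this makes stability independent of the set
that a run computes. -/
theorem BackReach.subset {N : ℕ} {r : ℕ → ℕ → ℕ} {K B B' : ℕ → Prop} (h : BackReach N r K B)
    (h' : BackReach N r K B') {b : ℕ} (hb : b < N) (hB : B b) : B' b := by
  by_contra hB'
  classical
  have h0 := (SearchInv.compl_isCut (X := fun _ => False) h' (by simp))
  have := h.one_le_cut b hb hB {a ∈ Finset.range N | ¬ B' a} (by simp [hb, hB']) h0.1.2
  omega

/-- There is neither an augmenting path nor a node to branch on. -/
def State.Stable (s : State) : Prop :=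
  ∀ B : ℕ → Prop, BackReach (s.var 2) s.res (fun a => s.arr 9 a ≠ 0) B →
    (∀ x < s.var 2, s.arr 8 x ≠ 0 → ¬ B x) ∧
    ∀ a < s.var 2, ∀ b < s.var 2, ¬ B a → B b → s.arr 9 b = 0 → s.cap a b = 0

theorem State.stable_of {s : State} {B : ℕ → Prop}
    (hB : BackReach (s.var 2) s.res (fun a => s.arr 9 a ≠ 0) B)
    (h1 : ∀ x < s.var 2, s.arr 8 x ≠ 0 → ¬ B x)
    (h2 : ∀ a < s.var 2, ∀ b < s.var 2, ¬ B a → B b → s.arr 9 b = 0 → s.cap a b = 0) :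
    s.Stable := by
  intro B' hB'
  exact ⟨fun x hx h hBx => h1 x hx h (hB'.subset hB hx hBx), fun a ha b hb h h' =>
    h2 a ha b hb (fun h'' => h (hB.subset hB' ha h'')) (hB'.subset hB hb h')⟩

theorem State.Stable.congr {s s' : State} (h : s.Stable) (hf : s.Fixed s') (hs : s.SameFlow s') :
    s'.Stable := by
  rw [State.Stable, hf.var2, hf.cap, hs.res, hs.arr8, hs.arr9]
  exact h

/-- The invariant of the search, for the sources, sinks and residual capacities in the state `s`. -/
def State.Inv (s : State) (K₀ : ℕ → Prop) (A : Finset ℕ) (k i j : ℕ) : Prop :=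
  SearchInv (s.var 2) s.cap K₀ A s.res (fun a => s.arr 8 a ≠ 0) (fun a => s.arr 9 a ≠ 0) k i j

theorem State.Inv.congr {s s' : State} {K₀ : ℕ → Prop} {A : Finset ℕ} {k i j : ℕ}
    (h : s.Inv K₀ A k i j) (hf : s.Fixed s') (hs : s.SameFlow s') : s'.Inv K₀ A k i j := by
  rw [State.Inv, hf.var2, hf.cap, hs.res, hs.arr8, hs.arr9]
  exact h

/-- The tables for division by two. -/
def State.Tables (s : State) : Prop :=
  ∀ x < s.var 4, s.arr 12 x = x % 2 ∧ s.arr 13 x = x / 2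

/-- A round together with the increment of a loop counter. -/
def roundStep (ω : ℕ → Bool) (s : State) : State :=
  (round.den ω s).setVar 17 ((round.den ω s).var 17 + 1)

theorem State.fixed_setVar (s : State) {x : ℕ} (h2 : x ≠ 2) (h4 : x ≠ 4) (h20 : x ≠ 20) (k : ℕ) :
    s.Fixed (s.setVar x k) :=
  ⟨by simp [h2.symm], by simp [h4.symm], by simp [h20.symm], rfl, rfl, rfl, rfl⟩

theorem State.res_setVar (s : State) {x : ℕ} (h2 : x ≠ 2) (k : ℕ) :
    (s.setVar x k).res = s.res := by
  funext a b; simp [State.res, h2.symm]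

theorem roundStep_comm {ω : ℕ → Bool} {s s₁ : State} {k k' : ℕ}
    (h : round.den ω (s.setVar 8 k) = s₁.setVar 8 k') :
    roundStep ω (s.setVar 8 k) = (s₁.setVar 17 (s₁.var 17 + 1)).setVar 8 k' := by
  rw [roundStep, h]
  ext y
  · simp only [State.setVar_var]
    by_cases h1 : y = 8
    · simp [h1]
    · simp [h1]
  · rfl
  · rfl

/-- For every maximal cut there is a sequence of choices for which the search stays inside the cut
and makes progress until it is stable. -/
theorem exists_choices (ω : ℕ → Bool) {K₀ : ℕ → Prop} {A : Finset ℕ} (q : ℕ) (s : State)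
    (hs : s.Offsets) (ht : s.Tables) (hA : IsMaximalCut (s.var 2) s.cap K₀ A)
    {k i j L : ℕ} (hL : cut (s.var 2) s.cap A ≤ L) (hInv : s.Inv K₀ A k i j)
    (hm : 2 ^ (2 * L - (i + j)) ≤ s.var 4) :
    ∃ x < 2 ^ (2 * L - (i + j)), ∃ s' : State, (roundStep ω)^[q] (s.setVar 8 x) = s' ∧
      s.Fixed s' ∧ ∃ k' i' j', s'.Inv K₀ A k' i' j' ∧ (s.Stable → s'.Stable) ∧
        (s'.Stable ∨ k + i + j + q ≤ k' + i' + j') := by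
  induction q generalizing s k i j with
  | zero =>
    have hf := s.fixed_setVar (x := 8) (by decide) (by decide) (by decide) 0
    have hsf : s.SameFlow (s.setVar 8 0) := ⟨s.res_setVar (by decide) 0, rfl, rfl⟩
    exact ⟨0, by positivity, _, rfl, hf, k, i, j, hInv.congr hf hsf, fun h => h.congr hf hsf,
      .inr le_rfl⟩
  | succ q ih =>
    have hi := hInv.sources_le
    have hj := hInv.sinks_le
    obtain ⟨B, hB, s₁, hf, hcase⟩ := round_cases ω s hs
    have hf' : s.Fixed (s₁.setVar 17 (s₁.var 17 + 1)) :=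
      hf.trans (s₁.fixed_setVar (by decide) (by decide) (by decide) _)
    -- The induction hypothesis after one round, for any outcome that either is stable or raises k +
    -- i + j.
    have step : ∀ s₂ : State, s.Fixed s₂ → ∀ {k₂ i₂ j₂ : ℕ}, s₂.Inv K₀ A k₂ i₂ j₂ →
        i + j ≤ i₂ + j₂ → (s.Stable → s₂.Stable) → (s₂.Stable ∨ k + i + j + 1 ≤ k₂ + i₂ + j₂) →
        ∃ x < 2 ^ (2 * L - (i₂ + j₂)), ∃ s' : State, (roundStep ω)^[q] (s₂.setVar 8 x) = s' ∧
          s.Fixed s' ∧ ∃ k' i' j', s'.Inv K₀ A k' i' j' ∧ (s.Stable → s'.Stable) ∧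
            (s'.Stable ∨ k + i + j + (q + 1) ≤ k' + i' + j') := by
      intro s₂ hf₂ k₂ i₂ j₂ hInv₂ hij hst hpr
      obtain ⟨x, hx, s', hs', hf', k', i', j', h1, h2, h3⟩ := ih s₂
        (by rw [State.Offsets, hf₂.var2, hf₂.var20, hf₂.arr5]; exact hs)
        (by rw [State.Tables, hf₂.var4, hf₂.arr12, hf₂.arr13]; exact ht)
        (by rw [hf₂.var2, hf₂.cap]; exact hA) (by rw [hf₂.var2, hf₂.cap]; exact hL) hInv₂
        (by rw [hf₂.var4]; exact le_trans (Nat.pow_le_pow_right (by decide) (by omega)) hm)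
      refine ⟨x, hx, s', hs', hf₂.trans hf', k', i', j', h1, fun h => h2 (hst h), ?_⟩
      rcases hpr with hpr | hpr
      · exact .inl (h2 hpr)
      · exact h3.imp_right fun h => by omega
    rcases hcase with ⟨⟨x, hx, hX, hBx⟩, h8, h9, hcut, hround⟩ | ⟨hsf, hX, hcase⟩
    · have hInv' : (s₁.setVar 17 (s₁.var 17 + 1)).Inv K₀ A (k + 1) i j := by
        rw [State.Inv, hf'.var2, hf'.cap, State.res_setVar _ (by decide)]
        simp only [State.setVar_arr, h8, h9]
        exact SearchInv.augment hInv hcut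
      obtain ⟨x', hx', s', hs', h⟩ := step _ hf' hInv' le_rfl
        (fun h => absurd hBx ((h B hB).1 x hx hX)) (.inr (by omega))
      refine ⟨x', hx', s', ?_, h⟩
      rw [Function.iterate_succ_apply, roundStep_comm (hround x'), hs']
    have hsf' : s.SameFlow (s₁.setVar 17 (s₁.var 17 + 1)) :=
      ⟨(s₁.res_setVar (by decide) _).trans hsf.res, hsf.arr8, hsf.arr9⟩
    rcases hcase with ⟨a, ha, b, hb, haB, hbB, hbK, hc, hround⟩ | ⟨hno, hround⟩
    swap
    · have hst : s.Stable := State.stable_of hB hX hno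
      -- Nothing to do in this round: no choice is consumed, and stability persists.
      obtain ⟨x', hx', s', hs', h⟩ := step _ hf' (k₂ := k) (i₂ := i) (j₂ := j)
        (hInv.congr hf' hsf') le_rfl (fun h => h.congr hf' hsf') (.inl (hst.congr hf' hsf'))
      refine ⟨x', hx', s', ?_, h⟩
      rw [Function.iterate_succ_apply, roundStep_comm (hround x'), hs']
    have hns : ¬ s.Stable := fun h => hc ((h B hB).2 a ha b hb haB hbB hbK)
    -- The correct guess is read off from `A`. It becomes the lowest binary digit of the choice
    -- sequence, 0 for a source and 1 for a sink, in front of the digits for the later rounds.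
    by_cases hbA : b ∈ A
    · have hInv' := SearchInv.addSource hInv hB hX hb hbB hbA
      have hlt := hInv'.sources_le
      let s₂ := (s₁.setArr 8 b 1).setVar 17 (s₁.var 17 + 1)
      have hf₂ : s.Fixed s₂ := ⟨hf'.var2, hf'.var4, hf'.var20, hf'.arr5, hf'.arr6, hf'.arr12, hf'.arr13⟩
      have hInv₂ : s₂.Inv K₀ A k (i + 1) (j) := by
        have e : (fun a => s₂.arr 8 a ≠ 0) = fun a => s.arr 8 a ≠ 0 ∨ a = b := by
          funext a
          simp only [s₂, State.setVar_arr, State.setArr_arr, if_true, Function.update_apply,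
            hsf.arr8]
          by_cases h : a = b <;> simp [h]
        have e' : s₂.res = s.res := hsf'.res
        have e9 : s₂.arr 9 = s.arr 9 := hsf'.arr9
        rw [State.Inv, hf₂.var2, hf₂.cap, e', e, e9]
        exact hInv'
      obtain ⟨x', hx', s', hs', h⟩ := step s₂ hf₂ hInv₂ (by omega)
        (fun h => absurd h hns) (.inr (by omega))
      -- Since i + 1 ≤ L and j ≤ L, the truncated difference drops by exactly one, which pays for
      -- the new digit.
      have hx'' : 2 * x' < 2 ^ (2 * L - (i + j)) := by
        have : 2 * L - (i + j) = 2 * L - (i + 1 + j) + 1 := by omega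
        rw [this, pow_succ]
        omega
      refine ⟨2 * x', hx'', s', ?_, h⟩
      obtain ⟨t1, t2⟩ := ht (2 * x') (by omega)
      have hr := hround (2 * x')
      rw [t1, t2, if_neg (by simp), Nat.mul_div_cancel_left _ (by decide)] at hr
      rw [Function.iterate_succ_apply, roundStep_comm hr]
      exact hs'
    · have hInv' := SearchInv.addSink hInv hA hB hX ha hb haB (by simpa using hbK) hc hbA
      have hlt := hInv'.sinks_le
      let s₂ := (s₁.setArr 9 b 1).setVar 17 (s₁.var 17 + 1)
      have hf₂ : s.Fixed s₂ := ⟨hf'.var2, hf'.var4, hf'.var20, hf'.arr5, hf'.arr6, hf'.arr12, hf'.arr13⟩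
      have hInv₂ : s₂.Inv K₀ A k (i) (j + 1) := by
        have e : (fun a => s₂.arr 9 a ≠ 0) = fun a => s.arr 9 a ≠ 0 ∨ a = b := by
          funext a
          simp only [s₂, State.setVar_arr, State.setArr_arr, if_true, Function.update_apply,
            hsf.arr9]
          by_cases h : a = b <;> simp [h]
        have e' : s₂.res = s.res := hsf'.res
        have e8 : s₂.arr 8 = s.arr 8 := hsf'.arr8
        rw [State.Inv, hf₂.var2, hf₂.cap, e', e, e8]
        exact hInv'
      obtain ⟨x', hx', s', hs', h⟩ := step s₂ hf₂ hInv₂ (by omega)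
        (fun h => absurd h hns) (.inr (by omega))
      have hx'' : 2 * x' + 1 < 2 ^ (2 * L - (i + j)) := by
        have : 2 * L - (i + j) = 2 * L - (i + (j + 1)) + 1 := by omega
        rw [this, pow_succ]
        omega
      refine ⟨2 * x' + 1, hx'', s', ?_, h⟩
      obtain ⟨t1, t2⟩ := ht (2 * x' + 1) (by omega)
      have hr := hround (2 * x' + 1)
      rw [t1, t2, if_pos (by omega), show (2 * x' + 1) / 2 = x' by omega] at hr
      rw [Function.iterate_succ_apply, roundStep_comm hr]
      exact hs'

end RandomSampling

namespace RandomSampling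

open LoopProg

/-! ### One search -/

def initFlow : LoopProg :=
  .rep 2 10 (.rep 2 11 (storeLt 20 7 (cell 10 11) (.get 6 (cell 10 11))))

def initMarksStep : LoopProg :=
  .seq (storeLt 2 8 (.var 10) (.const 0)) (.seq (storeLt 2 9 (.var 10) (.get 2 (.var 10)))
    (.seq (storeLt 2 10 (.var 10) (.const 0)) (storeLt 2 11 (.var 10) (.const 0))))

def initMarks : LoopProg := .rep 2 10 initMarksStep

def clearVars : LoopProg :=
  .seq (.assign 9 (.const 0)) (.seq (.assign 10 (.const 0)) (.seq (.assign 11 (.const 0))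
    (.seq (.assign 12 (.const 0)) (.seq (.assign 13 (.const 0)) (.seq (.assign 14 (.const 0))
      (.seq (.assign 17 (.const 0)) (.assign 18 (.const 0))))))))

/-- The index of the node where the search starts. -/
def startNode : Expr := .add (.var 7) (.var 0)

/-- The initial state of a search. -/
def init : LoopProg :=
  .seq initFlow (.seq initMarks (.seq clearVars (storeLt 2 8 startNode (.const 1))))

/-- The zero flow: residual capacities are the capacities. -/
theorem initFlow_spec (ω : ℕ → Bool) (s : State) (hs : s.Offsets) {a b : ℕ} (ha : a < s.var 2)
    (hb : b < s.var 2) : (initFlow.den ω s).arr 7 (a * s.var 2 + b) = s.cap a b := by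
  suffices h : ∀ a < s.var 2, ∀ b < s.var 2, (a < s.var 2 ∨ a = s.var 2 ∧ b < 0) →
      (initFlow.den ω s).arr 7 (a * s.var 2 + b) = s.cap a b from h a ha b hb (.inl ha)
  refine rep_induction (l := 2) (x := 10) (s := s)
    (fun i s₁ => ∀ a < s.var 2, ∀ b < s.var 2, (a < i ∨ a = i ∧ b < 0) →
      s₁.arr 7 (a * s.var 2 + b) = s.cap a b) rfl (by omega) ?_
  intro i s₁ hi hx₁ hv₁ ha₁ h₁
  have e2 : s₁.var 2 = s.var 2 := hv₁ 2 rfl (by decide)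
  have := rep_induction (ω := ω) (P := storeLt 20 7 (cell 10 11) (.get 6 (cell 10 11))) (l := 2)
    (x := 11) (s := s₁) (fun j s₁ => ∀ a < s.var 2, ∀ b < s.var 2, (a < i ∨ a = i ∧ b < j) →
      s₁.arr 7 (a * s.var 2 + b) = s.cap a b) rfl h₁ ?_
  · intro a ha b hb h
    exact this a ha b hb (by omega)
  intro j s₂ hj hx₂ hv₂ ha₂ h₂ a ha b hb h
  rw [e2] at hj
  have f10 : s₂.var 10 = i := by rw [hv₂ 10 rfl (by decide), hx₁]
  have f20 : s₂.var 20 = s.var 2 * s.var 2 := by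
    rw [hv₂ 20 rfl (by decide), hv₁ 20 rfl (by decide), hs.2]
  have f5 : s₂.arr 5 i = i * s.var 2 := by rw [ha₂ 5 rfl, ha₁ 5 rfl, hs.1 i hi]
  have f6 : s₂.arr 6 = s.arr 6 := by rw [ha₂ 6 rfl, ha₁ 6 rfl]
  have hc : (cell 10 11).eval s₂ = i * s.var 2 + j := by simp [cell, f10, f5, hx₂]
  rw [den_storeLt (by rw [hc, f20]; exact cell_lt hi hj), hc]
  simp only [State.setVar_arr, State.setArr_arr, if_true, Expr.eval, hc, f6, Function.update_apply,
    cell_inj hb hj]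
  split_ifs with hab
  · rw [hab.1, hab.2]; rfl
  · exact h₂ a ha b hb (by omega)

theorem initMarks_spec (ω : ℕ → Bool) (s : State) {a : ℕ} (ha : a < s.var 2) :
    (initMarks.den ω s).arr 8 a = 0 ∧ (initMarks.den ω s).arr 9 a = s.arr 2 a ∧
      (initMarks.den ω s).arr 10 a = 0 ∧ (initMarks.den ω s).arr 11 a = 0 := by
  revert a
  refine rep_induction (P := initMarksStep) (l := 2) (x := 10) (s := s)
    (fun i s₁ => ∀ {a}, a < i → s₁.arr 8 a = 0 ∧ s₁.arr 9 a = s.arr 2 a ∧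
      s₁.arr 10 a = 0 ∧ s₁.arr 11 a = 0) rfl (by simp) ?_
  intro i s₁ hi hx hv ha ih a hai
  have h2 : s₁.var 2 = s.var 2 := hv 2 rfl (by decide)
  have g2 : s₁.arr 2 = s.arr 2 := ha 2 rfl
  have hlt : s.var 2 - i ≠ 0 := by omega
  rcases Nat.lt_succ_iff_lt_or_eq.1 hai with h | rfl
  · have := ih h
    simp [initMarksStep, den, hx, h2, hlt, h.ne, this]
  · simp [initMarksStep, den, hx, h2, hlt, g2]

/-- The cells outside of the matrices and vectors indexed by the nodes are zero. -/
structure State.Clean (s : State) : Prop where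
  arr7 : ∀ c, s.var 20 ≤ c → s.arr 7 c = 0
  arr8 : ∀ c, s.var 2 ≤ c → s.arr 8 c = 0
  arr9 : ∀ c, s.var 2 ≤ c → s.arr 9 c = 0
  arr10 : ∀ c, s.var 2 ≤ c → s.arr 10 c = 0
  arr11 : ∀ c, s.var 2 ≤ c → s.arr 11 c = 0

/-- The program preserves `State.Clean`. -/
structure LoopProg.KeepsClean (P : LoopProg) : Prop where
  var20 : P.wv 20 = false
  var2 : P.wv 2 = false
  arr7 : P.Guarded 7 20
  arr8 : P.Guarded 8 2
  arr9 : P.Guarded 9 2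
  arr10 : P.Guarded 10 2
  arr11 : P.Guarded 11 2

theorem LoopProg.KeepsClean.clean {P : LoopProg} (h : P.KeepsClean) (ω : ℕ → Bool) {s : State}
    (hs : s.Clean) : (P.den ω s).Clean := by
  have h2 := den_var ω P h.var2 s
  have h20 := den_var ω P h.var20 s
  constructor
  · intro c hc; rw [h20] at hc; rw [h.arr7.den_arr h.var20 hc, hs.arr7 c hc]
  · intro c hc; rw [h2] at hc; rw [h.arr8.den_arr h.var2 hc, hs.arr8 c hc]
  · intro c hc; rw [h2] at hc; rw [h.arr9.den_arr h.var2 hc, hs.arr9 c hc]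
  · intro c hc; rw [h2] at hc; rw [h.arr10.den_arr h.var2 hc, hs.arr10 c hc]
  · intro c hc; rw [h2] at hc; rw [h.arr11.den_arr h.var2 hc, hs.arr11 c hc]

theorem init_keepsClean : init.KeepsClean := by
  constructor <;> first | rfl | repeat' (first | decide | constructor)

/-- Facts about a state that is the input of a search. -/
structure State.Ready (s : State) (n : ℕ) (v : ℕ) : Prop where
  var0 : s.var 0 = n
  var2 : s.var 2 = n + n
  var7 : s.var 7 = v
  lt : v < n
  offsets : s.Offsets
  clean : s.Clean

theorem init_spec (ω : ℕ → Bool) {s : State} {n v : ℕ} (hs : s.Ready n v) :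
    (∀ a < s.var 2, ∀ b < s.var 2, (init.den ω s).res a b = s.cap a b) ∧
    ∀ a < s.var 2, (init.den ω s).arr 8 a = (if a = v + n then 1 else 0) ∧
      (init.den ω s).arr 9 a = s.arr 2 a ∧ (init.den ω s).arr 10 a = 0 ∧
      (init.den ω s).arr 11 a = 0 := by
  have hv2 : (init.den ω s).var 2 = s.var 2 := den_var ω init rfl s
  set s₁ := initFlow.den ω s
  set s₂ := initMarks.den ω s₁ with hs₂
  set s₃ := clearVars.den ω s₂ with hs₃
  have e2 : s₃.var 2 = s.var 2 := by
    rw [hs₃, den_var ω clearVars rfl, den_var ω initMarks rfl, den_var ω initFlow rfl]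
  have e7 : s₃.var 7 = v := by
    rw [hs₃, den_var ω clearVars rfl, den_var ω initMarks rfl, den_var ω initFlow rfl, hs.var7]
  have e0 : s₃.var 0 = n := by
    rw [hs₃, den_var ω clearVars rfl, den_var ω initMarks rfl, den_var ω initFlow rfl, hs.var0]
  have hlt := hs.lt
  have hstart : startNode.eval s₃ = v + n := by simp [startNode, e7, e0]
  have hd : init.den ω s = s₃.setArr 8 (v + n) 1 := by
    have : init.den ω s = (storeLt 2 8 startNode (.const 1)).den ω s₃ := rfl
    rw [this, den_storeLt (by rw [hstart, e2, hs.var2]; omega), hstart]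
    rfl
  have g2 : s₁.arr 2 = s.arr 2 := den_arr ω initFlow rfl s
  have f2 : s₁.var 2 = s.var 2 := den_var ω initFlow rfl s
  constructor
  · intro a ha b hb
    have g7 : s₃.arr 7 = s₁.arr 7 := by rw [hs₃, den_arr ω clearVars rfl, hs₂, den_arr ω initMarks rfl]
    rw [State.res, hv2, hd, State.setArr_arr, if_neg (by decide), g7]
    exact initFlow_spec ω s hs.offsets ha hb
  · intro a ha
    obtain ⟨h8, h9, h10, h11⟩ := initMarks_spec ω s₁ (f2 ▸ ha)
    have g : ∀ x, s₃.arr x = s₂.arr x := fun x => den_arr ω clearVars rfl s₂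
    rw [hd]
    simp only [State.setArr_arr, if_true, Function.update_apply, g, ← g2, Nat.reduceEqDiff, if_false]
    refine ⟨?_, h9, h10, h11⟩
    split_ifs
    · rfl
    · exact h8

/-- The state after the initialization does not depend on the results of earlier searches. -/
theorem init_lowEq {ω ω' : ℕ → Bool} {s s' : State} {n v : ℕ} (hs : s.Ready n v)
    (hs' : s'.Ready n v)
    (h : LowEq [6, 8, 9, 10, 11, 12, 13, 14, 15, 16, 17, 18] [3, 4, 7, 8, 9, 10, 11] s s') :
    LowEq [6, 8, 15, 16] [3, 4] (init.den ω s) (init.den ω' s') := by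
  obtain ⟨hr, hm⟩ := init_spec ω hs
  obtain ⟨hr', hm'⟩ := init_spec ω' hs'
  have hc := init_keepsClean.clean ω hs.clean
  have hc' := init_keepsClean.clean ω' hs'.clean
  have e2 : (init.den ω s).var 2 = n + n := (den_var ω init rfl s).trans hs.var2
  have e2' : (init.den ω' s').var 2 = n + n := (den_var ω' init rfl s').trans hs'.var2
  have e20 : (init.den ω s).var 20 = (n + n) * (n + n) := by
    rw [den_var ω init rfl s, hs.offsets.2, hs.var2]
  have e20' : (init.den ω' s').var 20 = (n + n) * (n + n) := by
    rw [den_var ω' init rfl s', hs'.offsets.2, hs'.var2]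
  rw [hs.var2] at hr hm
  rw [hs'.var2] at hr' hm'
  have g2 : s.arr 2 = s'.arr 2 := h.arr 2 (by decide)
  have gcap : s.cap = s'.cap := by
    funext a b
    rw [State.cap, State.cap, h.arr 6 (by decide), hs.var2, hs'.var2]
  refine ⟨fun x hx => ?_, fun x hx => ?_, ?_⟩
  · by_cases hxw : x ∈ [9, 10, 11, 12, 13, 14, 17, 18]
    · have key : ∀ (ω : ℕ → Bool) (s : State), (init.den ω s).var x = 0 := by
        intro ω s
        have : (init.den ω s).var x =
            (clearVars.den ω (initMarks.den ω (initFlow.den ω s))).var x :=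
          den_var ω (storeLt 2 8 startNode (.const 1)) rfl _
        rw [this]
        simp only [List.mem_cons, List.not_mem_nil, or_false] at hxw
        rcases hxw with rfl | rfl | rfl | rfl | rfl | rfl | rfl | rfl <;> simp [clearVars, den]
      rw [key, key]
    · have hxv : init.wv x = false := by
        apply wv_eq_false
        intro hm
        have : ∀ y ∈ init.writtenVars, y ∈ [9, 10, 11, 12, 13, 14, 17, 18] := by decide
        exact hxw (this x hm)
      rw [den_var ω init hxv, den_var ω' init hxv]
      apply h.var
      simp only [List.mem_cons, List.not_mem_nil, or_false] at hx hxw ⊢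
      omega
  · by_cases hxw : x ∈ [7, 8, 9, 10, 11]
    · simp only [List.mem_cons, List.not_mem_nil, or_false] at hxw
      funext c
      rcases hxw with rfl | hxw
      -- The arrays must agree as functions, in every cell. Inside the matrix they hold the
      -- capacities; outside, `State.Clean` makes both zero.
      · by_cases hcN : c < (n + n) * (n + n)
        · have hN : 0 < n + n := by
            rcases Nat.eq_zero_or_pos (n + n) with h | h
            · rw [h] at hcN; omega
            · exact h
          have h1 := hr (c / (n + n)) (Nat.div_lt_of_lt_mul hcN) (c % (n + n)) (Nat.mod_lt _ hN)
          have h2 := hr' (c / (n + n)) (Nat.div_lt_of_lt_mul hcN) (c % (n + n)) (Nat.mod_lt _ hN)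
          rw [State.res, e2, Nat.div_add_mod'] at h1
          rw [State.res, e2', Nat.div_add_mod'] at h2
          rw [h1, h2, gcap]
        · rw [hc.arr7 c (by omega), hc'.arr7 c (by omega)]
      · by_cases hcN : c < n + n
        · have h1 := hm c hcN
          have h2 := hm' c hcN
          rw [← g2] at h2
          rcases hxw with rfl | rfl | rfl | rfl
          · rw [h1.1, h2.1]
          · rw [h1.2.1, h2.2.1]
          · rw [h1.2.2.1, h2.2.2.1]
          · rw [h1.2.2.2, h2.2.2.2]
        · rcases hxw with rfl | rfl | rfl | rfl
          · rw [hc.arr8 c (by omega), hc'.arr8 c (by omega)]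
          · rw [hc.arr9 c (by omega), hc'.arr9 c (by omega)]
          · rw [hc.arr10 c (by omega), hc'.arr10 c (by omega)]
          · rw [hc.arr11 c (by omega), hc'.arr11 c (by omega)]
    · have hxv : init.wa x = false := by
        apply wa_eq_false
        intro hm
        have : ∀ y ∈ init.writtenArrs, y ∈ [7, 8, 9, 10, 11] := by decide
        exact hxw (this x hm)
      rw [den_arr ω init hxv, den_arr ω' init hxv]
      apply h.arr
      simp only [List.mem_cons, List.not_mem_nil, or_false] at hx hxw ⊢
      omega
  · rw [den_pos ω init rfl, den_pos ω' init rfl, h.pos]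

/-- The rounds of a search, and the levels at the end. -/
def rounds : LoopProg := .seq (.rep 19 17 round) levels

/-- A search. -/
def wholeSearch : LoopProg := .seq init (.seq (.assign 8 (.var 6)) rounds)

/-- The final levels of the search with the choices `k`. -/
def State.finalLevels (s : State) (k : ℕ) : ℕ → ℕ :=
  (rounds.den (fun _ => false) ((init.den (fun _ => false) s).setVar 8 k)).arr 10

/-- The result depends on the history of the machine and on the coins only through the choice
sequence. The all-false bits in `State.finalLevels` are a dummy, because a search tosses no coins.
-/
theorem wholeSearch_arr (ω : ℕ → Bool) {s s' : State} {n v : ℕ} (hs : s.Ready n v)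
    (hs' : s'.Ready n v)
    (h : LowEq [6, 8, 9, 10, 11, 12, 13, 14, 15, 16, 17, 18] [3, 4, 7, 8, 9, 10, 11] s s') :
    (wholeSearch.den ω s).arr 10 = s'.finalLevels (s.var 6) := by
  have h1 := init_lowEq (ω := ω) (ω' := fun _ => false) hs hs' h
  have h2 : LowEq [6, 15, 16] [3, 4] ((init.den ω s).setVar 8 (s.var 6))
      ((init.den (fun _ => false) s').setVar 8 (s.var 6)) := by
    refine ⟨fun x hx => ?_, h1.arr, h1.pos⟩
    simp only [State.setVar_var]
    split_ifs with h8
    · rfl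
    · apply h1.var
      simp only [List.mem_cons, List.not_mem_nil, or_false] at hx ⊢
      omega
  have h3 := secure_lowEq (ω := ω) (ω' := fun _ => false) rounds rfl h2
  rw [State.finalLevels, ← h3.arr 10 (by decide)]
  simp only [wholeSearch, den, Expr.eval]
  rw [den_var ω init rfl s]

/-- Sources and sinks are only ever added. -/
theorem round_marks (ω : ℕ → Bool) {s : State} (hs : s.Offsets) {x a : ℕ} (hx : x = 8 ∨ x = 9)
    (ha : s.arr x a ≠ 0) : (round.den ω s).arr x a ≠ 0 := by
  obtain ⟨B, -, s₁, -, h⟩ := round_cases ω s hs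
  have e : s.setVar 8 (s.var 8) = s := by
    ext y
    · by_cases hy : y = 8 <;> simp [hy]
    · rfl
    · rfl
  rcases h with ⟨-, h8, h9, -, h⟩ | ⟨hsf, -, ⟨a', -, b, -, -, -, -, -, h⟩ | ⟨-, h⟩⟩
  · have := h (s.var 8)
    rw [e] at this
    rw [this, State.setVar_arr]
    rcases hx with rfl | rfl
    exacts [h8 ▸ ha, h9 ▸ ha]
  · have := h (s.var 8)
    rw [e] at this
    rw [this, State.setVar_arr]
    have key : ∀ y, (s₁.setArr y b 1).arr x a ≠ 0 := by
      intro y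
      have : s₁.arr x a ≠ 0 := by rcases hx with rfl | rfl; exacts [hsf.arr8 ▸ ha, hsf.arr9 ▸ ha]
      simp only [State.setArr_arr]
      split_ifs with h
      · subst h
        simp only [Function.update_apply]
        split_ifs
        exacts [one_ne_zero, this]
      · exact this
    split_ifs
    exacts [key 9, key 8]
  · have := h (s.var 8)
    rw [e] at this
    rw [this, State.setVar_arr]
    rcases hx with rfl | rfl
    exacts [hsf.arr8 ▸ ha, hsf.arr9 ▸ ha]

theorem rep_round_marks (ω : ℕ → Bool) {s : State} (hs : s.Offsets) {x a : ℕ} (hx : x = 8 ∨ x = 9)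
    (ha : s.arr x a ≠ 0) : ((LoopProg.rep 19 17 round).den ω s).arr x a ≠ 0 := by
  refine rep_induction (P := round) (l := 19) (x := 17) (s := s) (fun _ s => s.arr x a ≠ 0) rfl
    ha ?_
  intro i s₃ _ _ hv ha ih
  refine round_marks _ ?_ hx ih
  rw [State.Offsets, hv 2 rfl (by decide), hv 20 rfl (by decide), ha 5 rfl]
  exact hs

/-- Holds for every choice sequence, including wrong guesses: terminals are sinks from the start and
therefore receive a level. -/
theorem finalLevels_sink {s : State} {n v : ℕ} (hs : s.Ready n v) (k : ℕ) {a : ℕ}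
    (ha : a < s.var 2) (haK : s.arr 2 a ≠ 0) : s.finalLevels k a ≠ 0 := by
  obtain ⟨-, hm⟩ := init_spec (fun _ => false) hs
  set s₁ := (init.den (fun _ => false) s).setVar 8 k with hs₁
  have e2 : s₁.var 2 = s.var 2 := den_var _ init rfl s
  have e5 : s₁.arr 5 = s.arr 5 := den_arr _ init rfl s
  have e20 : s₁.var 20 = s.var 20 := den_var _ init rfl s
  have ho : s₁.Offsets := by rw [State.Offsets, e2, e5, e20]; exact hs.offsets
  have h9 : s₁.arr 9 a ≠ 0 := by
    have := (hm a ha).2.1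
    rw [hs₁, State.setVar_arr, this]
    exact haK
  set s₂ := (LoopProg.rep 19 17 round).den (fun _ => false) s₁ with hs₂
  have hf2 : s₂.var 2 = s.var 2 := (den_var _ (.rep 19 17 round) rfl s₁).trans e2
  have hf5 : s₂.arr 5 = s.arr 5 := (den_arr _ (.rep 19 17 round) rfl s₁).trans e5
  have hf20 : s₂.var 20 = s.var 20 := (den_var _ (.rep 19 17 round) rfl s₁).trans e20
  have ho₂ : s₂.Offsets := by rw [State.Offsets, hf2, hf5, hf20]; exact hs.offsets
  have h9₂ : s₂.arr 9 a ≠ 0 := rep_round_marks _ ho (.inr rfl) h9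
  have := ((levels_spec (fun _ => false) s₂ ho₂).sink a (hf2 ▸ ha)).1 h9₂
  change (levels.den _ s₂).arr 10 a ≠ 0
  rw [this]
  exact one_ne_zero

/-- For the right guesses the nodes without a level lie in `A`, and every arc that leaves them also
leaves `A`. So a boundary computed from the levels is part of the boundary of `A`. -/
theorem exists_finalLevels {s : State} {n v : ℕ} (hs : s.Ready n v) (ht : s.Tables)
    (h19 : s.var 19 = n + n + n + n) {A : Finset ℕ} (hvA : v + n ∈ A)
    (hTA : ∀ a < s.var 2, s.arr 2 a ≠ 0 → a ∉ A)
    (hA : IsMaximalCut (s.var 2) s.cap (fun a => s.arr 2 a ≠ 0) A) {L : ℕ}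
    (hL : cut (s.var 2) s.cap A ≤ L) (hLn : L ≤ n) (hm : 4 ^ L ≤ s.var 4) :
    ∃ k < s.var 4, s.finalLevels k (v + n) = 0 ∧
      (∀ a < s.var 2, s.finalLevels k a = 0 → a ∈ A) ∧
      ∀ a < s.var 2, ∀ b < s.var 2, s.finalLevels k a = 0 → s.finalLevels k b ≠ 0 →
        s.cap a b ≠ 0 → b ∉ A := by
  have hlt := hs.lt
  obtain ⟨hr, hmk⟩ := init_spec (fun _ => false) hs
  set s₁ := (init.den (fun _ => false) s).setVar 17 0 with hs₁
  have hf : s.Fixed s₁ := ⟨den_var _ init rfl s, den_var _ init rfl s, den_var _ init rfl s,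
    den_arr _ init rfl s, den_arr _ init rfl s, den_arr _ init rfl s, den_arr _ init rfl s⟩
  have f19 : s₁.var 19 = n + n + n + n := (den_var _ init rfl s).trans h19
  have hr₁ : ∀ a < s.var 2, ∀ b < s.var 2, s₁.res a b = s.cap a b := by
    rw [hs₁, State.res_setVar _ (by decide)]; exact hr
  have hInv : s₁.Inv (fun a => s.arr 2 a ≠ 0) A 0 0 0 := by
    rw [State.Inv, hf.var2, hf.cap]
    refine ⟨⟨fun a ha hX => ?_, fun a ha hK => ?_⟩, fun a ha hK => ?_, fun A' _ => ?_,
      fun _ _ => Nat.zero_le _, ∅, rfl, by simp⟩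
    · rw [hs₁, State.setVar_arr, (hmk a ha).1] at hX
      split_ifs at hX with h
      · rwa [h]
      · exact absurd rfl hX
    · rw [hs₁, State.setVar_arr, (hmk a ha).2.1] at hK
      exact hTA a ha hK
    · rw [hs₁, State.setVar_arr, (hmk a ha).2.1]
      exact hK
    · exact (cut_congr hr₁).symm
  have h4 : 2 ^ (2 * L) ≤ s.var 4 := by rw [pow_mul]; exact hm
  obtain ⟨k, hk, s', hs', hf', k', i', j', hInv', -, hst⟩ := exists_choices (fun _ => false)
    (n + n + n + n) s₁ (by rw [State.Offsets, hf.var2, hf.var20, hf.arr5]; exact hs.offsets)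
    (by rw [State.Tables, hf.var4, hf.arr12, hf.arr13]; exact ht)
    (by rw [hf.var2, hf.cap]; exact hA) (L := L) (by rw [hf.var2, hf.cap]; exact hL) hInv
    (by rw [hf.var4]; simpa using h4)
  have hf'' := hf.trans hf'
  have hstable : s'.Stable := by
    -- Each of k, i, j is at most c(A) ≤ L ≤ n, so progress through all 4n rounds would give 4n ≤
    -- 3n, although n > 0.
    refine hst.resolve_right fun h => ?_
    have h1 := SearchInv.flow_le hInv'
    have h2 := SearchInv.sources_le hInv'
    have h3 := SearchInv.sinks_le hInv'
    rw [hf''.var2, hf''.cap] at h1 h2 h3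
    omega
  have hx : (((init.den (fun _ => false) s).setVar 8 k).setVar 17 0) = s₁.setVar 8 k := by
    ext y
    · by_cases h1 : y = 17
      · simp [h1, hs₁]
      · simp [h1, hs₁]
    · rfl
    · rfl
  have hrep : (LoopProg.rep 19 17 round).den (fun _ => false)
      ((init.den (fun _ => false) s).setVar 8 k) = s' := by
    rw [← hs', ← hx, ← f19]
    rfl
  have hfin : s.finalLevels k = (levels.den (fun _ => false) s').arr 10 := by
    rw [← hrep]
    rfl
  have ho' : s'.Offsets := by rw [State.Offsets, hf''.var2, hf''.var20, hf''.arr5]; exact hs.offsets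
  have hB := (levels_spec (fun _ => false) s' ho').backReach
  rw [← hfin] at hB
  obtain ⟨hX, hno⟩ := hstable _ hB
  have hmem := fun {a} => SearchInv.mem_of_not_reach (a := a) hInv'
    (by rw [hf''.var2, hf''.cap]; exact hA) hB hX
  rw [hf''.var2] at hX hno
  rw [hf''.cap] at hno
  refine ⟨k, lt_of_lt_of_le hk (by simpa using h4), ?_, ?_, ?_⟩
  · have h8 : s'.arr 8 (v + n) ≠ 0 := by
      rw [← hrep]
      refine rep_round_marks _ ?_ (.inl rfl) ?_
      · rw [State.Offsets]
        exact hf.var2 ▸ hf.var20 ▸ hf.arr5 ▸ hs.offsets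
      · rw [State.setVar_arr, (hmk (v + n) (by rw [hs.var2]; omega)).1, if_pos rfl]
        exact one_ne_zero
    exact not_not.1 (hX (v + n) (by rw [hs.var2]; omega) h8)
  · intro a ha h
    exact hmem (by rwa [hf''.var2]) (not_not.2 h)
  · intro a ha b hb h1 h2 h3 hbA
    -- By stability the head of such an arc is a sink, and sinks avoid `A`.
    have hK : s'.arr 9 b ≠ 0 := fun h => h3 (hno a ha b hb (not_not.2 h1) h2 h)
    exact hInv'.isCut.2 b (by rwa [hf''.var2]) hK hbA

end RandomSampling

namespace RandomSampling

open LoopProg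

/-! ### Evaluation of a search -/

def checkStep : LoopProg :=
  .ite (.get 10 (.var 10)) .skip (.ite (.get 10 (.var 11)) (.ite (.get 6 (cell 10 11))
    (.ite (.get 4 (.var 10)) .skip (.assign 15 (.const 0))) .skip) .skip)

/-- Checks that all arcs that enter the set of the nodes with a level come from the random set, and
that the starting node has no level. -/
def check : LoopProg :=
  .seq (.assign 15 (.const 1)) (.seq (.rep 2 10 (.rep 2 11 checkStep))
    (.ite (.get 10 startNode) (.assign 15 (.const 0)) .skip))

/-- Adds the vertex to the output if the check succeeds. -/
def accept : LoopProg :=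
  .ite (.get 2 (.var 7)) .skip (.ite (.var 5) (.ite (.var 15) (.store 3 (.var 7) (.const 1)) .skip)
    .skip)

/-- The set of the nodes without a level contains `x`, and all arcs that leave it start in `R`. -/
def Accepts (N : ℕ) (c : ℕ → ℕ → ℕ) (R : ℕ → ℕ) (x : ℕ) (ℓ : ℕ → ℕ) : Prop :=
  ℓ x = 0 ∧ ∀ a < N, ∀ b < N, ℓ a = 0 → ℓ b ≠ 0 → c a b ≠ 0 → R a ≠ 0

/-- The starting node is tested as well, since wrong guesses may turn it into a sink or otherwise
give it a level. -/
theorem check_spec (ω : ℕ → Bool) {s : State} (hs : s.Offsets) :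
    (check.den ω s).var 15 ≠ 0 ↔
      Accepts (s.var 2) s.cap (s.arr 4) (startNode.eval s) (s.arr 10) := by
  let Inv (i j : ℕ) (s₁ : State) : Prop := s₁.var 15 ≠ 0 ↔ ∀ a < s.var 2, ∀ b < s.var 2,
    (a < i ∨ a = i ∧ b < j) → s.arr 10 a = 0 → s.arr 10 b ≠ 0 → s.cap a b ≠ 0 → s.arr 4 a ≠ 0
  have := rep_induction (ω := ω) (P := .rep 2 11 checkStep) (l := 2) (x := 10)
    (s := s.setVar 15 1) (fun i s₁ => Inv i 0 s₁) rfl (by simp [Inv]) ?_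
  · set s₁ := (LoopProg.rep 2 10 (.rep 2 11 checkStep)).den ω (s.setVar 15 1) with hs₁
    have hd : check.den ω s = (LoopProg.ite (.get 10 startNode) (.assign 15 (.const 0)) .skip).den ω
      s₁ := rfl
    have e10 : s₁.arr 10 = s.arr 10 := den_arr ω (.rep 2 10 (.rep 2 11 checkStep)) rfl _
    have e7 : s₁.var 7 = s.var 7 := den_var ω (.rep 2 10 (.rep 2 11 checkStep)) rfl _
    have e0 : s₁.var 0 = s.var 0 := den_var ω (.rep 2 10 (.rep 2 11 checkStep)) rfl _
    have this' : s₁.var 15 ≠ 0 ↔ _ := this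
    rw [hd]
    simp only [den, startNode, Expr.eval, e10, e7, e0, Accepts]
    by_cases c : s.arr 10 (s.var 7 + s.var 0) = 0
    · simp only [c, ne_eq, not_true, if_false, true_and]
      rw [← ne_eq, this']
      exact ⟨fun h a ha b hb => h a ha b hb (.inl ha), fun h a ha b hb _ => h a ha b hb⟩
    · simp [c]
  intro i s₁ hi hx₁ hv₁ ha₁ h₁
  have e2 : s₁.var 2 = s.var 2 := hv₁ 2 rfl (by decide)
  have := rep_induction (ω := ω) (P := checkStep) (l := 2) (x := 11)
    (s := s₁) (fun j s₁ => Inv i j s₁) rfl h₁ ?_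
  · refine Iff.trans this ⟨fun h a ha b hb hc => h a ha b hb (by omega),
      fun h a ha b hb hc => h a ha b hb (by omega)⟩
  intro j s₂ hj hx₂ hv₂ ha₂ h₂
  have f10 : s₂.var 10 = i := by rw [hv₂ 10 rfl (by decide), hx₁]
  have g5 : s₂.arr 5 i = i * s.var 2 := by rw [ha₂ 5 rfl, ha₁ 5 rfl]; exact hs.1 i hi
  have g4 : s₂.arr 4 = s.arr 4 := by rw [ha₂ 4 rfl, ha₁ 4 rfl]; rfl
  have g6 : s₂.arr 6 = s.arr 6 := by rw [ha₂ 6 rfl, ha₁ 6 rfl]; rfl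
  have g10 : s₂.arr 10 = s.arr 10 := by rw [ha₂ 10 rfl, ha₁ 10 rfl]; rfl
  have hval : ((checkStep.den ω s₂).setVar 11 (j + 1)).var 15 ≠ 0 ↔ s₂.var 15 ≠ 0 ∧
      (s.arr 10 i = 0 → s.arr 10 j ≠ 0 → s.cap i j ≠ 0 → s.arr 4 i ≠ 0) := by
    simp only [checkStep, den, cell, Expr.eval, hx₂, f10, g4, g5, g6, g10, State.cap]
    split_ifs <;> simp_all
  refine hval.trans ((and_congr_left fun _ => h₂).trans ⟨fun h a ha b hb hc => ?_, fun h =>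
    ⟨fun a ha b hb hc => h a ha b hb (by omega), h i hi j (e2 ▸ hj) (by omega)⟩⟩)
  by_cases hab : a = i ∧ b = j
  · obtain ⟨rfl, rfl⟩ := hab
    exact h.2
  · exact h.1 a ha b hb (by omega)

/-- The treatment of one vertex and one sequence of choices. -/
def body : LoopProg := .seq wholeSearch (.seq check accept)

theorem body_keepsClean : body.KeepsClean := by
  constructor <;> first | rfl | repeat' (first | decide | constructor)

open Classical in
theorem body_spec (ω : ℕ → Bool) {s : State} {n v : ℕ} (hs : s.Ready n v) :
    (body.den ω s).arr 3 = if s.arr 2 v = 0 ∧ s.var 5 ≠ 0 ∧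
      Accepts (n + n) s.cap (s.arr 4) (v + n) ((wholeSearch.den ω s).arr 10)
      then Function.update (s.arr 3) v 1 else s.arr 3 := by
  set s₁ := wholeSearch.den ω s with hs₁
  have e0 : s₁.var 0 = n := (den_var ω wholeSearch rfl s).trans hs.var0
  have e2 : s₁.var 2 = s.var 2 := den_var ω wholeSearch rfl s
  have e5 : s₁.var 5 = s.var 5 := den_var ω wholeSearch rfl s
  have e7 : s₁.var 7 = v := (den_var ω wholeSearch rfl s).trans hs.var7
  have e20 : s₁.var 20 = s.var 20 := den_var ω wholeSearch rfl s
  have g2 : s₁.arr 2 = s.arr 2 := den_arr ω wholeSearch rfl s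
  have g3 : s₁.arr 3 = s.arr 3 := den_arr ω wholeSearch rfl s
  have g4 : s₁.arr 4 = s.arr 4 := den_arr ω wholeSearch rfl s
  have g5 : s₁.arr 5 = s.arr 5 := den_arr ω wholeSearch rfl s
  have g6 : s₁.arr 6 = s.arr 6 := den_arr ω wholeSearch rfl s
  have ho : s₁.Offsets := by rw [State.Offsets, e2, e20, g5]; exact hs.offsets
  have hcap : s₁.cap = s.cap := by funext a b; rw [State.cap, State.cap, e2, g6]
  have hc := check_spec ω ho
  rw [hcap, g4, e2, hs.var2, show startNode.eval s₁ = v + n by simp [startNode, e7, e0]] at hc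
  have hd : body.den ω s = accept.den ω (check.den ω s₁) := by rw [hs₁, body, den, den]
  clear_value s₁
  rw [hd, ← hc]
  have r2 : (check.den ω s₁).arr 2 = s.arr 2 := (den_arr ω check rfl s₁).trans g2
  have r3 : (check.den ω s₁).arr 3 = s.arr 3 := (den_arr ω check rfl s₁).trans g3
  have r5 : (check.den ω s₁).var 5 = s.var 5 := (den_var ω check rfl s₁).trans e5
  have r7 : (check.den ω s₁).var 7 = v := (den_var ω check rfl s₁).trans e7
  generalize check.den ω s₁ = r at r2 r3 r5 r7 ⊢
  simp only [accept, den, Expr.eval, r2, r5, r7]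
  by_cases c1 : s.arr 2 v = 0
  swap; · simp [c1, r3]
  by_cases c2 : s.var 5 = 0
  · simp [c1, c2, r3]
  by_cases c3 : r.var 15 = 0
  · simp [c1, c2, c3, r3]
  · simp [c1, c2, c3, r3]

theorem body_wv {y : ℕ} (hy : y ∉ [8, 9, 10, 11, 12, 13, 14, 15, 17, 18]) : body.wv y = false := by
  have : ∀ y ∈ body.writtenVars, y ∈ [8, 9, 10, 11, 12, 13, 14, 15, 17, 18] := by decide +kernel
  exact wv_eq_false _ fun h => hy (this y h)

theorem body_wa {y : ℕ} (hy : y ∉ [3, 7, 8, 9, 10, 11]) : body.wa y = false := by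
  have : ∀ y ∈ body.writtenArrs, y ∈ [3, 7, 8, 9, 10, 11] := by decide +kernel
  exact wa_eq_false _ fun h => hy (this y h)

/-- All vertices and all sequences of choices. -/
def mainLoop : LoopProg := .rep 4 6 (.rep 0 7 body)

/-- The levels on the right belong to the reference state `t`, which agrees with `s` except for the
coin variable and the random set. Hence the candidate cuts are the same for all coins, and the coins
enter only through array 4. -/
theorem mainLoop_spec (ω : ℕ → Bool) {s t : State} {n : ℕ} (h0 : s.var 0 = n)
    (h2 : s.var 2 = n + n) (ho : s.Offsets) (hc : s.Clean) (h3 : s.arr 3 = 0)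
    (hct : t.Clean) (hst : LowEq [16] [4] s t) {v : ℕ} (hv : v < n) :
    (mainLoop.den ω s).arr 3 v ≠ 0 ↔ s.arr 2 v = 0 ∧ s.var 5 ≠ 0 ∧ ∃ k < s.var 4,
      Accepts (n + n) s.cap (s.arr 4) (v + n) ((t.setVar 7 v).finalLevels k) := by
  classical
  let good (k v : ℕ) : Prop := s.arr 2 v = 0 ∧ s.var 5 ≠ 0 ∧
      Accepts (n + n) s.cap (s.arr 4) (v + n) ((t.setVar 7 v).finalLevels k)
  -- Every pair treated so far has been judged as if its search had started from the reference
  -- state. `State.Clean` and the unchanged bit position are carried along because each new search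
  -- relies on them.
  let Inv (i j : ℕ) (s₁ : State) : Prop := (s₁.Clean ∧ s₁.pos = s.pos) ∧ ∀ v < n,
    s₁.arr 3 v ≠ 0 ↔ ∃ k, (k < i ∨ k = i ∧ v < j) ∧ good k v
  have hclean : ∀ {s₁ : State} {x k : ℕ}, x ≠ 2 → x ≠ 20 → s₁.Clean → (s₁.setVar x k).Clean := by
    intro s₁ x k hx hx' h
    have e2 : (s₁.setVar x k).var 2 = s₁.var 2 := by simp [hx.symm]
    have e20 : (s₁.setVar x k).var 20 = s₁.var 20 := by simp [hx'.symm]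
    exact ⟨e20 ▸ h.arr7, e2 ▸ h.arr8, e2 ▸ h.arr9, e2 ▸ h.arr10, e2 ▸ h.arr11⟩
  suffices H : Inv (s.var 4) 0 (mainLoop.den ω s) by
    rw [H.2 v hv]
    constructor
    · rintro ⟨k, hk, h⟩
      exact ⟨h.1, h.2.1, k, by omega, h.2.2⟩
    · rintro ⟨h, h', k, hk, h''⟩
      exact ⟨k, .inl hk, h, h', h''⟩
  have hwv : ∀ y, y ∉ [8, 9, 10, 11, 12, 13, 14, 15, 17, 18] → y ≠ 7 →
      (LoopProg.rep 0 7 body).wv y = false := fun y h h7 => by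
    simp [wv, body_wv h, h7.symm]
  rw [mainLoop]
  refine rep_induction (ω := ω) (P := .rep 0 7 body) (l := 4) (x := 6) (s := s) (fun i s₁ => Inv i 0 s₁)
    (by simp [wv, body_wv])
    ⟨⟨hclean (by decide) (by decide) hc, rfl⟩, fun v _ => by simp [h3]⟩ ?_
  intro i s₁ hi hx₁ hv₁ ha₁ h₁
  have := rep_induction (ω := ω) (P := body) (l := 0) (x := 7) (s := s₁) (fun j s₁ => Inv i j s₁)
    (body_wv (by decide)) ⟨⟨hclean (by decide) (by decide) h₁.1.1, h₁.1.2⟩, h₁.2⟩ ?_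
  · refine ⟨⟨hclean (by decide) (by decide) this.1.1, this.1.2⟩, fun v hv => (this.2 v hv).trans ?_⟩
    have e0 : s₁.var 0 = n := (hv₁ 0 (hwv 0 (by decide) (by decide)) (by decide)).trans h0
    refine exists_congr fun k => and_congr_left fun _ => ?_
    omega
  intro j s₂ hj hx₂ hv₂ ha₂ h₂
  have e0 : s₁.var 0 = n := (hv₁ 0 (hwv 0 (by decide) (by decide)) (by decide)).trans h0
  have frv : ∀ y, y ∉ [8, 9, 10, 11, 12, 13, 14, 15, 17, 18] → y ≠ 6 → y ≠ 7 →
      s₂.var y = s.var y := fun y h h6 h7 => by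
    rw [hv₂ y (body_wv h) h7, hv₁ y (hwv y h h7) h6]
  have fra : ∀ y, y ∉ [3, 7, 8, 9, 10, 11] → s₂.arr y = s.arr y := fun y h => by
    rw [ha₂ y (body_wa h), ha₁ y (body_wa h)]
  have hready : s₂.Ready n j := by
    refine ⟨(frv 0 (by decide) (by decide) (by decide)).trans h0,
      (frv 2 (by decide) (by decide) (by decide)).trans h2, hx₂, by omega, ?_, h₂.1.1⟩
    rw [State.Offsets, frv 2 (by decide) (by decide) (by decide), frv 20 (by decide) (by decide) (by decide),
      fra 5 (by decide)]
    exact ho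
  have htready : (t.setVar 7 j).Ready n j := by
    refine ⟨(hst.var 0 (by decide)).symm.trans h0, (hst.var 2 (by decide)).symm.trans h2,
      by simp, by omega, ?_, hclean (by decide) (by decide) hct⟩
    have e2 : (t.setVar 7 j).var 2 = s.var 2 := (hst.var 2 (by decide)).symm
    have e20 : (t.setVar 7 j).var 20 = s.var 20 := (hst.var 20 (by decide)).symm
    have e5 : (t.setVar 7 j).arr 5 = s.arr 5 := (hst.arr 5 (by decide)).symm
    rw [State.Offsets, e2, e20, e5]
    exact ho
  have hlow : LowEq [6, 8, 9, 10, 11, 12, 13, 14, 15, 16, 17, 18] [3, 4, 7, 8, 9, 10, 11] s₂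
      (t.setVar 7 j) := by
    refine ⟨fun x hx => ?_, fun x hx => ?_, ?_⟩
    · by_cases h7 : x = 7
      · simp [h7, hx₂]
      · simp only [List.mem_cons, List.not_mem_nil, or_false] at hx
        rw [frv x (by simp; omega) (by omega) h7, State.setVar_var, if_neg h7]
        exact hst.var x (by simp; omega)
    · simp only [List.mem_cons, List.not_mem_nil, or_false] at hx
      rw [fra x (by simp; omega)]
      exact hst.arr x (by simp; omega)
    · rw [h₂.1.2]
      exact hst.pos
  have h6 : s₂.var 6 = i := by rw [hv₂ 6 (body_wv (by decide)) (by decide), hx₁]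
  have hcap : s₂.cap = s.cap := by
    funext a b
    rw [State.cap, State.cap, frv 2 (by decide) (by decide) (by decide), fra 6 (by decide)]
  have hb := body_spec ω hready
  rw [wholeSearch_arr ω hready htready hlow, h6, hcap, fra 2 (by decide), fra 4 (by decide),
    frv 5 (by decide) (by decide) (by decide)] at hb
  change _ = if good i j then _ else _ at hb
  refine ⟨⟨hclean (by decide) (by decide) (body_keepsClean.clean ω h₂.1.1),
    by rw [State.setVar_pos, den_pos ω body (by decide +kernel), h₂.1.2]⟩, fun v hv => ?_⟩
  have h₂' := h₂.2 v hv
  rw [State.setVar_arr, hb]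
  by_cases hvj : v = j
  · subst hvj
    split_ifs with hg
    · simp only [Function.update_self, ne_eq, one_ne_zero, not_false_iff, true_iff]
      exact ⟨i, by omega, hg⟩
    · rw [h₂']
      refine exists_congr fun k => ?_
      constructor
      · exact fun h => ⟨by omega, h.2⟩
      · rintro ⟨h, h'⟩
        refine ⟨?_, h'⟩
        rcases h with h | h
        · exact .inl h
        · exact absurd (h.1 ▸ h') hg
  · have e : (if good i j then Function.update (s₂.arr 3) j 1 else s₂.arr 3) v = s₂.arr 3 v := by
      split_ifs
      · rw [Function.update_of_ne hvj]
      · rfl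
    rw [e, h₂']
    refine exists_congr fun k => and_congr_left fun _ => ?_
    omega

end RandomSampling

namespace RandomSampling

open LoopProg

/-! ### Preparation -/

/-- Sets the numbers that do not depend on the graph. -/
def setSizes : LoopProg :=
  .seq (.assign 2 (.add (.var 0) (.var 0))) (.seq (.assign 3 (.sub (.var 0) (.sub (.var 0) (.var 1))))
    (.seq (.assign 19 (.add (.var 2) (.var 2))) (.assign 4 (.const 1))))

/-- Computes the number of sequences of choices. -/
def setChoices : LoopProg :=
  .rep 3 9 (.assign 4 (.add (.add (.var 4) (.var 4)) (.add (.var 4) (.var 4))))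

def tablesStep : LoopProg :=
  .seq (.store 13 (.add (.var 9) (.var 9)) (.var 9))
    (.seq (.store 13 (.add (.add (.var 9) (.var 9)) (.const 1)) (.var 9))
      (.store 12 (.add (.add (.var 9) (.var 9)) (.const 1)) (.const 1)))

/-- Computes the tables for division by two. -/
def setTables : LoopProg := .rep 4 9 tablesStep

/-- Computes the multiples of the value of `y` with the variable `x` and the array `a`. -/
def multiples (x y a : ℕ) : LoopProg :=
  .seq (.assign x (.const 0))
    (.rep 2 9 (.seq (.store a (.var 9) (.var x)) (.assign x (.add (.var x) (.var y)))))

def vertexCapStep : LoopProg :=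
  .ite (.get 1 (.var 10)) (.store 6 (.add (.get 5 (.var 10)) (.add (.var 10) (.var 0)))
      (.add (.var 0) (.const 1)))
    (.store 6 (.add (.get 5 (.var 10)) (.add (.var 10) (.var 0))) (.const 1))

def arcCapStep : LoopProg :=
  .ite (.get 0 (.add (.get 14 (.var 10)) (.var 11)))
    (.store 6 (.add (.get 5 (.add (.var 10) (.var 0))) (.var 11)) (.add (.var 0) (.const 1))) .skip

/-- Computes the capacities. -/
def setCaps : LoopProg := .seq (.rep 0 10 vertexCapStep) (.rep 0 10 (.rep 0 11 arcCapStep))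

/-- Chooses the random set. -/
def setRandom : LoopProg :=
  .rep 0 9 (.seq (.coin 16) (.store 4 (.var 9) (.sub (.var 16) (.get 1 (.var 9)))))

/-- Finds out whether there are terminals. -/
def setTerminals : LoopProg := .rep 0 9 (.ite (.get 2 (.var 9)) (.assign 5 (.const 1)) .skip)

def setGraph : LoopProg :=
  .seq (multiples 20 2 5) (.seq (multiples 12 0 14) (.seq setCaps (.seq setRandom setTerminals)))

def setup : LoopProg := .seq setSizes (.seq setChoices (.seq setTables setGraph))

theorem setChoices_spec (ω : ℕ → Bool) {s : State} (h4 : s.var 4 = 1) :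
    (setChoices.den ω s).var 4 = 4 ^ s.var 3 := by
  refine rep_induction (ω := ω) (l := 3) (x := 9) (s := s) (fun i s₁ => s₁.var 4 = 4 ^ i) rfl
    (by simpa using h4) ?_
  intro i s₁ _ _ _ _ ih
  simp [den, ih, pow_succ]
  omega

/-- Even cells of array 12 are never written and keep their initial value 0. Each round fills two
cells, so the tables extend beyond what is needed. -/
theorem setTables_spec (ω : ℕ → Bool) {s : State} (h12 : s.arr 12 = 0) :
    (setTables.den ω s).Tables := by
  have := rep_induction (ω := ω) (P := tablesStep) (l := 4) (x := 9) (s := s)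
    (fun i s₁ => (∀ x < i + i, s₁.arr 12 x = x % 2 ∧ s₁.arr 13 x = x / 2) ∧
      ∀ x ≥ i + i, s₁.arr 12 x = 0) rfl (by simp [h12]) ?_
  · intro x hx
    rw [den_var ω setTables rfl] at hx
    exact this.1 x (by omega)
  intro i s₁ _ hx _ _ ih
  have h1 := ih.2 (i + i) le_rfl
  refine ⟨fun x hx' => ?_, fun x hx' => ?_⟩
  · simp only [tablesStep, den, Expr.eval, hx, State.setVar_arr, State.setArr_arr, State.setArr_var,
      if_true, Function.update_apply, Nat.reduceEqDiff, if_false]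
    by_cases c1 : x = i + i + 1
    · subst c1
      simp
      omega
    · by_cases c2 : x = i + i
      · subst c2
        simp [h1]
        omega
      · simp only [c1, c2, if_false]
        exact ih.1 x (by omega)
  · have := ih.2 x (by omega)
    simp only [tablesStep, den, Expr.eval, hx, State.setVar_arr, State.setArr_arr, State.setArr_var,
      if_true, Function.update_apply, Nat.reduceEqDiff, if_false]
    rw [if_neg (by omega), this]

/-- The machine cannot multiply, so row offsets are accumulated by addition; the final value of the
accumulator is the size of the whole matrix. -/
theorem multiples_spec (ω : ℕ → Bool) {s : State} {x y a : ℕ} (hx2 : x ≠ 2) (hx9 : x ≠ 9)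
    (hxy : x ≠ y) (hy9 : y ≠ 9) :
    (∀ i < s.var 2, ((multiples x y a).den ω s).arr a i = i * s.var y) ∧
      ((multiples x y a).den ω s).var x = s.var 2 * s.var y := by
  have := rep_induction (ω := ω)
    (P := .seq (.store a (.var 9) (.var x)) (.assign x (.add (.var x) (.var y)))) (l := 2) (x := 9)
    (s := s.setVar x 0)
    (fun i s₁ => (∀ j < i, s₁.arr a j = j * s.var y) ∧ s₁.var x = i * s.var y)
    (by simp [wv, hx9]) (by simp [hx9]) ?_
  · rw [State.setVar_var, if_neg hx2.symm] at this
    exact this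
  intro i s₁ _ hx hv _ ih
  have hy : s₁.var y = s.var y := by
    rw [hv y (by simp [wv, hxy]) hy9]
    simp [hxy.symm]
  refine ⟨fun j hj => ?_, ?_⟩
  · simp only [den, Expr.eval, State.setVar_arr, State.setArr_arr, if_true, hx, ih.2,
      Function.update_apply]
    split_ifs with h
    · rw [h]
    · exact ih.1 j (by omega)
  · simp [den, hx9, ih.2, hy, Nat.succ_mul]

theorem setTerminals_spec (ω : ℕ → Bool) {s : State} (h5 : s.var 5 = 0) :
    (setTerminals.den ω s).var 5 ≠ 0 ↔ ∃ a < s.var 0, s.arr 2 a ≠ 0 := by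
  refine rep_induction (ω := ω) (l := 0) (x := 9) (s := s)
    (fun i s₁ => s₁.var 5 ≠ 0 ↔ ∃ a < i, s.arr 2 a ≠ 0) rfl (by simp [h5]) ?_
  intro i s₁ _ hx _ ha ih
  have h2 : s₁.arr 2 = s.arr 2 := ha 2 rfl
  simp only [den, Expr.eval, hx, h2]
  by_cases c : s.arr 2 i = 0
  · simp only [c, ne_eq, not_true, if_false]
    rw [← ne_eq, State.setVar_var, if_neg (by decide), ih]
    constructor
    · rintro ⟨a, ha, h⟩
      exact ⟨a, by omega, h⟩
    · rintro ⟨a, ha, h⟩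
      refine ⟨a, lt_of_le_of_ne (by omega) ?_, h⟩
      rintro rfl
      exact h c
  · simp only [c, ne_eq, not_false_iff, if_true]
    simp only [State.setVar_var, Nat.reduceEqDiff, if_false, if_true, one_ne_zero, not_false_iff,
      true_iff]
    exact ⟨i, by omega, c⟩

/-- The bits are read in order from position 0, so bit `a` belongs to vertex `a`. Truncated
subtraction of the indicator of the undeletable vertices excludes these. -/
theorem setRandom_spec (ω : ℕ → Bool) {s : State} (hp : s.pos = 0) (h4 : s.arr 4 = 0) (a : ℕ) :
    (setRandom.den ω s).arr 4 a = if a < s.var 0 then (ω a).toNat - s.arr 1 a else 0 := by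
  have := rep_induction (ω := ω)
    (P := .seq (.coin 16) (.store 4 (.var 9) (.sub (.var 16) (.get 1 (.var 9))))) (l := 0) (x := 9)
    (s := s) (fun i s₁ => s₁.pos = i ∧
      ∀ a, s₁.arr 4 a = if a < i then (ω a).toNat - s.arr 1 a else 0) rfl (by simp [hp, h4]) ?_
  · exact this.2 a
  intro i s₁ _ hx _ ha ih
  have h1 : s₁.arr 1 = s.arr 1 := ha 1 rfl
  refine ⟨by simp [den, ih.1], fun a => ?_⟩
  simp only [den, Expr.eval, State.setVar_arr, State.setArr_arr, if_true, Function.update_apply,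
    State.toss_var, State.toss_arr, Nat.reduceEqDiff, if_false, hx, h1, ih.1]
  split_ifs with c1 c2 c2
  · rw [c1]
  · omega
  · rw [ih.2, if_pos (by omega)]
  · rw [ih.2, if_neg (by omega)]

/-- The capacities while they are computed: those of the first `i` vertices, and the rows of the arcs
up to row `j` and column `k`. -/
structure PartialCaps (n : ℕ) (d : ℕ → ℕ) (g : ℕ → ℕ) (i j k : ℕ) (c : ℕ → ℕ → ℕ) : Prop where
  vertex : ∀ a < i, c a (a + n) = if d a ≠ 0 then n + 1 else 1
  arc : ∀ a < n, ∀ b < n, (a < j ∨ a = j ∧ b < k) → g (a * n + b) ≠ 0 → c (a + n) b = n + 1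
  eq_zero : ∀ a < n + n, ∀ b < n + n, c a b ≠ 0 →
    (a < n ∧ b = a + n) ∨ ∃ a' < n, a = a' + n ∧ b < n ∧ g (a' * n + b) ≠ 0

theorem PartialCaps.mono {n : ℕ} {d g : ℕ → ℕ} {i j k j' k' : ℕ} {c : ℕ → ℕ → ℕ}
    (h : PartialCaps n d g i j k c)
    (hjk : ∀ a < n, ∀ b < n, (a < j' ∨ a = j' ∧ b < k') → (a < j ∨ a = j ∧ b < k)) :
    PartialCaps n d g i j' k' c :=
  ⟨h.vertex, fun a ha b hb h' => h.arc a ha b hb (hjk a ha b hb h'), h.eq_zero⟩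

theorem setCaps_spec (ω : ℕ → Bool) {s : State} {n : ℕ} (h0 : s.var 0 = n) (h2 : s.var 2 = n + n)
    (h5 : ∀ a < n + n, s.arr 5 a = a * (n + n)) (h14 : ∀ a < n + n, s.arr 14 a = a * n)
    (h6 : s.arr 6 = 0) : PartialCaps n (s.arr 1) (s.arr 0) n n 0 (setCaps.den ω s).cap := by
  have hcap : ∀ s₁ : State, s₁.var 2 = n + n → s₁.cap = fun a b => s₁.arr 6 (a * (n + n) + b) :=
    fun s₁ h => by funext a b; rw [State.cap, h]
  have hfin : (setCaps.den ω s).var 2 = n + n := (den_var ω setCaps rfl s).trans h2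
  rw [hcap _ hfin]
  have hv := rep_induction (ω := ω) (P := vertexCapStep) (l := 0) (x := 10) (s := s)
    (fun i s₁ => PartialCaps n (s.arr 1) (s.arr 0) i 0 0 fun a b => s₁.arr 6 (a * (n + n) + b)) rfl
    ⟨by simp, by omega, by simp [h6]⟩ ?_
  swap
  · intro i s₁ hi hx hv ha ih
    rw [h0] at hi
    have e0 : s₁.var 0 = n := (hv 0 rfl (by decide)).trans h0
    have g1 : s₁.arr 1 = s.arr 1 := ha 1 rfl
    have g5 : s₁.arr 5 i = i * (n + n) := by rw [ha 5 rfl, h5 i (by omega)]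
    have hval : ∀ a b, b < n + n → ((vertexCapStep.den ω s₁).setVar 10 (i + 1)).arr 6
        (a * (n + n) + b) = if a = i ∧ b = i + n then (if s.arr 1 i ≠ 0 then n + 1 else 1) else
          s₁.arr 6 (a * (n + n) + b) := by
      intro a b hb
      simp only [State.setVar_arr, vertexCapStep, den, Expr.eval, hx, e0, g1, g5]
      by_cases c : s.arr 1 i = 0 <;>
        simp [c, Function.update_apply, cell_inj hb (show i + n < n + n by omega)]
    refine ⟨fun a ha' => ?_, fun a ha b hb h => ?_, fun a ha b hb => ?_⟩
    · rw [hval a (a + n) (by omega)]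
      by_cases c : a = i
      · subst c; simp
      · rw [if_neg (by omega)]; exact ih.vertex a (by omega)
    · omega
    · rw [hval a b hb]
      intro hne
      by_cases c : a = i ∧ b = i + n
      · exact .inl ⟨by omega, by omega⟩
      · rw [if_neg c] at hne
        exact ih.eq_zero a ha b hb hne
  rw [h0] at hv
  set t := (LoopProg.rep 0 10 vertexCapStep).den ω s with ht
  have t0 : t.var 0 = n := (den_var ω (.rep 0 10 vertexCapStep) rfl s).trans h0
  have t5 : t.arr 5 = s.arr 5 := den_arr ω (.rep 0 10 vertexCapStep) rfl s
  have t14 : t.arr 14 = s.arr 14 := den_arr ω (.rep 0 10 vertexCapStep) rfl s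
  have tg : t.arr 0 = s.arr 0 := den_arr ω (.rep 0 10 vertexCapStep) rfl s
  have hd : setCaps.den ω s = (LoopProg.rep 0 10 (.rep 0 11 arcCapStep)).den ω t := rfl
  rw [hd]
  clear_value t
  have := rep_induction (ω := ω) (P := .rep 0 11 arcCapStep) (l := 0) (x := 10) (s := t)
    (fun j s₁ => PartialCaps n (s.arr 1) (s.arr 0) n j 0 fun a b => s₁.arr 6 (a * (n + n) + b)) rfl
    hv ?_
  · rwa [t0] at this
  intro j s₁ hj hx₁ hv₁ ha₁ ih₁
  have e0₁ : s₁.var 0 = n := (hv₁ 0 rfl (by decide)).trans t0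
  have := rep_induction (ω := ω) (P := arcCapStep) (l := 0) (x := 11) (s := s₁)
    (fun k s₁ => PartialCaps n (s.arr 1) (s.arr 0) n j k fun a b => s₁.arr 6 (a * (n + n) + b)) rfl
    ih₁ ?_
  · rw [e0₁] at this
    exact this.mono fun a ha b hb h => by omega
  intro k s₂ hk hx₂ hv₂ ha₂ ih
  rw [e0₁] at hk
  rw [t0] at hj
  have e0 : s₂.var 0 = n := (hv₂ 0 rfl (by decide)).trans e0₁
  have e10 : s₂.var 10 = j := by rw [hv₂ 10 rfl (by decide), hx₁]
  have g5 : s₂.arr 5 (j + n) = (j + n) * (n + n) := by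
    rw [ha₂ 5 rfl, ha₁ 5 rfl, t5, h5 _ (by omega)]
  have g14 : s₂.arr 14 j = j * n := by rw [ha₂ 14 rfl, ha₁ 14 rfl, t14, h14 _ (by omega)]
  have gg : s₂.arr 0 = s.arr 0 := by rw [ha₂ 0 rfl, ha₁ 0 rfl, tg]
  have hval : ∀ a b, b < n + n → ((arcCapStep.den ω s₂).setVar 11 (k + 1)).arr 6
      (a * (n + n) + b) = if s.arr 0 (j * n + k) ≠ 0 ∧ a = j + n ∧ b = k then n + 1 else
        s₂.arr 6 (a * (n + n) + b) := by
    intro a b hb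
    simp only [State.setVar_arr, arcCapStep, den, Expr.eval, hx₂, e0, e10, g5, g14, gg]
    by_cases c : s.arr 0 (j * n + k) = 0 <;>
      simp [c, Function.update_apply, cell_inj hb (show k < n + n by omega)]
  refine ⟨fun a ha' => ?_, fun a ha b hb h hg => ?_, fun a ha b hb => ?_⟩
  · rw [hval a (a + n) (by omega), if_neg (by omega)]
    exact ih.vertex a ha'
  · rw [hval _ _ (by omega)]
    split_ifs with c
    · rfl
    · refine ih.arc a ha b hb ?_ hg
      by_cases c' : a = j ∧ b = k
      · obtain ⟨rfl, rfl⟩ := c'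
        exact absurd ⟨hg, rfl, rfl⟩ c
      · omega
  · rw [hval a b hb]
    intro hne
    split_ifs at hne with c
    · obtain ⟨c, rfl, rfl⟩ := c
      exact .inr ⟨j, hj, rfl, hk, c⟩
    · exact ih.eq_zero a ha b hb hne

/-- The result of the preparation. -/
structure IsPrepared {n : ℕ} (G : Digraph (Fin n)) (D T : Finset (Fin n)) (p : ℕ) (ω : ℕ → Bool)
    (s : State) : Prop where
  var0 : s.var 0 = n
  var2 : s.var 2 = n + n
  var4 : s.var 4 = 4 ^ min p n
  var5 : s.var 5 ≠ 0 ↔ T.Nonempty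
  var19 : s.var 19 = n + n + n + n
  offsets : s.Offsets
  clean : s.Clean
  tables : s.Tables
  network : IsNetwork G D s.cap
  arr2 : ∀ a, s.arr 2 a ≠ 0 ↔ ∃ t ∈ T, a = (t : ℕ)
  arr3 : s.arr 3 = 0
  arr4 : ∀ a, s.arr 4 a ≠ 0 ↔ ∃ u : Fin n, a = u ∧ u ∉ D ∧ ω u = true

theorem bit_ne_zero {P : Prop} : bit P ≠ 0 ↔ P := by
  simp [bit]

theorem setSizes_den (ω : ℕ → Bool) (s : State) : setSizes.den ω s =
    (((s.setVar 2 (s.var 0 + s.var 0)).setVar 3 (s.var 0 - (s.var 0 - s.var 1))).setVar 19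
      (s.var 0 + s.var 0 + (s.var 0 + s.var 0))).setVar 4 1 := by
  simp [setSizes, den]

theorem isPrepared (n : ℕ) (G : Digraph (Fin n)) (D T : Finset (Fin n)) (p : ℕ) (ω : ℕ → Bool) :
    IsPrepared G D T p ω (setup.den ω (input n G D T p)) := by
  set s := input n G D T p with hs
  have i0 : s.var 0 = n := rfl
  have i1 : s.var 1 = p := rfl
  have i5 : s.var 5 = 0 := rfl
  have iz : ∀ x, 3 ≤ x → s.arr x = 0 := by
    intro x hx
    funext c
    simp only [hs, input]
    rw [if_neg (by omega), if_neg (by omega), if_neg (by omega)]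
    rfl
  have ia0 : ∀ a < n, ∀ b < n, s.arr 0 (a * n + b) ≠ 0 ↔
      ∃ u v : Fin n, a = u ∧ b = v ∧ G.Adj u v := by
    intro a ha b hb
    simp only [hs, input, if_true]
    rw [bit_ne_zero]
    refine exists_congr fun u => exists_congr fun v => ?_
    rw [cell_inj hb v.2, and_assoc]
  have ia1 : ∀ a, s.arr 1 a ≠ 0 ↔ ∃ u ∈ D, a = (u : ℕ) := by
    intro a
    simp only [hs, input, one_ne_zero, if_false, if_true]
    exact bit_ne_zero
  have ia1' : ∀ a, s.arr 1 a ≤ 1 := by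
    intro a
    simp only [hs, input, one_ne_zero, if_false, if_true, bit]
    split_ifs <;> omega
  have ia2 : ∀ a, s.arr 2 a ≠ 0 ↔ ∃ t ∈ T, a = (t : ℕ) := by
    intro a
    simp only [hs, input, OfNat.ofNat_ne_zero, OfNat.ofNat_ne_one, if_false, if_true]
    exact bit_ne_zero
  have ipos : s.pos = 0 := rfl
  clear_value s
  set s₁ := setSizes.den ω s with h₁
  set s₂ := setChoices.den ω s₁ with h₂
  set s₃ := setTables.den ω s₂ with h₃
  set s₄ := (multiples 20 2 5).den ω s₃ with h₄
  set s₅ := (multiples 12 0 14).den ω s₄ with h₅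
  set s₆ := setCaps.den ω s₅ with h₆
  set s₇ := setRandom.den ω s₆ with h₇
  set s₈ := setTerminals.den ω s₇ with h₈
  have hd : setup.den ω s = s₈ := rfl
  rw [hd]
  have v0 : s₁.var 0 = n := by rw [h₁, setSizes_den]; simp [i0]
  have v2 : s₁.var 2 = n + n := by rw [h₁, setSizes_den]; simp [i0]
  -- The minimum is n - (n - p) with truncated subtraction. Capping p at n loses nothing, as
  -- separators have at most n vertices, and keeps this loop limit bounded in terms of n.
  have v3 : s₁.var 3 = min p n := by rw [h₁, setSizes_den]; simp [i0, i1]; omega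
  have v4 : s₁.var 4 = 1 := by rw [h₁, setSizes_den]; simp
  have v5 : s₁.var 5 = 0 := by rw [h₁, setSizes_den]; simp [i5]
  have v19 : s₁.var 19 = n + n + n + n := by rw [h₁, setSizes_den]; simp [i0]; omega
  have a₁ : ∀ x, s₁.arr x = s.arr x := fun x => by rw [h₁, setSizes_den]; rfl
  have w4 : s₂.var 4 = 4 ^ min p n := by rw [h₂, setChoices_spec ω v4, v3]
  have a₂ : ∀ x, s₂.arr x = s.arr x := fun x => (den_arr ω setChoices rfl s₁).trans (a₁ x)
  have hT : s₃.Tables :=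
    setTables_spec ω ((a₂ 12).trans (iz 12 (by decide)))
  have b0 : s₃.var 0 = n := by rw [h₃, den_var ω _ rfl, h₂, den_var ω _ rfl, v0]
  have b2 : s₃.var 2 = n + n := by rw [h₃, den_var ω _ rfl, h₂, den_var ω _ rfl, v2]
  obtain ⟨m5, m20⟩ := multiples_spec ω (s := s₃) (x := 20) (y := 2) (a := 5) (by decide) (by decide)
    (by decide) (by decide)
  have c0 : s₄.var 0 = n := by rw [h₄, den_var ω _ rfl, b0]
  have c2 : s₄.var 2 = n + n := by rw [h₄, den_var ω _ rfl, b2]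
  obtain ⟨m14, -⟩ := multiples_spec ω (s := s₄) (x := 12) (y := 0) (a := 14) (by decide) (by decide)
    (by decide) (by decide)
  rw [b2] at m5 m20
  rw [c0, c2] at m14
  have d0 : s₅.var 0 = n := by rw [h₅, den_var ω _ rfl, c0]
  have d2 : s₅.var 2 = n + n := by rw [h₅, den_var ω _ rfl, c2]
  have d5 : ∀ a < n + n, s₅.arr 5 a = a * (n + n) := fun a ha => by
    rw [h₅, den_arr ω _ rfl, m5 a ha]
  have dz : ∀ x, x ∉ [5, 12, 13, 14] → s₅.arr x = s.arr x := fun x hx => by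
    simp only [List.mem_cons, List.not_mem_nil, or_false, not_or] at hx
    rw [h₅, den_arr ω _ (by simp [multiples, wa]; omega), h₄,
      den_arr ω _ (by simp [multiples, wa]; omega),
      h₃, den_arr ω _ (by simp [setTables, tablesStep, wa]; omega), a₂]
  have hcaps := setCaps_spec ω d0 d2 d5 m14 ((dz 6 (by decide)).trans (iz 6 (by decide)))
  rw [dz 1 (by decide), dz 0 (by decide)] at hcaps
  have f₆ : ∀ x, x ∉ [5, 6, 12, 13, 14] → s₆.arr x = s.arr x := fun x hx => by
    simp only [List.mem_cons, List.not_mem_nil, or_false, not_or] at hx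
    rw [h₆, den_arr ω _ (by simp [setCaps, vertexCapStep, arcCapStep, wa]; omega),
      dz x (by simp; omega)]
  have f₈ : ∀ x, x ∉ [4, 5, 6, 12, 13, 14] → s₈.arr x = s.arr x := fun x hx => by
    simp only [List.mem_cons, List.not_mem_nil, or_false, not_or] at hx
    rw [h₈, den_arr ω _ (by simp [setTerminals, wa]), h₇,
      den_arr ω _ (by simp [setRandom, wa]; omega), f₆ x (by simp; omega)]
  have pv : ∀ x, x ∉ [5, 9, 10, 11, 12, 16, 20] → s₈.var x = s₃.var x := fun x hx => by
    simp only [List.mem_cons, List.not_mem_nil, or_false, not_or] at hx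
    rw [h₈, den_var ω _ (by simp [setTerminals, wv]; omega), h₇,
      den_var ω _ (by simp [setRandom, wv]; omega), h₆,
      den_var ω _ (by simp [setCaps, vertexCapStep, arcCapStep, wv]; omega), h₅,
      den_var ω _ (by simp [multiples, wv]; omega), h₄, den_var ω _ (by simp [multiples, wv]; omega)]
  have e0 : s₆.var 0 = n := by rw [h₆, den_var ω _ rfl, d0]
  have e7 : s₇.var 0 = n := by rw [h₇, den_var ω _ rfl, e0]
  have q2 : s₈.var 2 = n + n := (pv 2 (by decide)).trans b2
  have q20 : s₈.var 20 = (n + n) * (n + n) := by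
    rw [h₈, den_var ω _ rfl, h₇, den_var ω _ rfl, h₆, den_var ω _ rfl, h₅, den_var ω _ rfl, m20]
  constructor
  · exact (pv 0 (by decide)).trans b0
  · exact q2
  · rw [pv 4 (by decide), h₃, den_var ω _ rfl, w4]
  · rw [h₈, setTerminals_spec ω]
    · rw [e7]
      have : s₇.arr 2 = s.arr 2 := by rw [h₇, den_arr ω _ rfl, f₆ 2 (by decide)]
      rw [this]
      constructor
      · rintro ⟨a, -, h⟩
        obtain ⟨t, ht, -⟩ := (ia2 a).1 h
        exact ⟨t, ht⟩
      · rintro ⟨t, ht⟩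
        exact ⟨t, t.2, (ia2 t).2 ⟨t, ht, rfl⟩⟩
    · rw [h₇, den_var ω _ rfl, h₆, den_var ω _ rfl, h₅, den_var ω _ rfl, h₄, den_var ω _ rfl,
        h₃, den_var ω _ rfl, h₂, den_var ω _ rfl, v5]
  · rw [pv 19 (by decide), h₃, den_var ω _ rfl, h₂, den_var ω _ rfl, v19]
  · refine ⟨fun a ha => ?_, by rw [q2, q20]⟩
    rw [q2] at ha ⊢
    rw [h₈, den_arr ω _ rfl, h₇, den_arr ω _ rfl, h₆, den_arr ω _ rfl, d5 a ha]
  · have key : ∀ x c, x ∈ [7, 8, 9, 10, 11] → s₈.arr x c = 0 := fun x c hx => by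
      simp only [List.mem_cons, List.not_mem_nil, or_false] at hx
      rw [f₈ x (by simp; omega), iz x (by omega)]
      rfl
    exact ⟨fun c _ => key 7 c (by decide), fun c _ => key 8 c (by decide),
      fun c _ => key 9 c (by decide), fun c _ => key 10 c (by decide),
      fun c _ => key 11 c (by decide)⟩
  · have g12 : s₈.arr 12 = s₃.arr 12 := by
      rw [h₈, den_arr ω _ rfl, h₇, den_arr ω _ rfl, h₆, den_arr ω _ rfl, h₅, den_arr ω _ rfl, h₄,
        den_arr ω _ rfl]
    have g13 : s₈.arr 13 = s₃.arr 13 := by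
      rw [h₈, den_arr ω _ rfl, h₇, den_arr ω _ rfl, h₆, den_arr ω _ rfl, h₅, den_arr ω _ rfl, h₄,
        den_arr ω _ rfl]
    rw [State.Tables, pv 4 (by decide), g12, g13]
    exact hT
  · have hcap : s₈.cap = s₆.cap := by
      funext a b
      rw [State.cap, State.cap, q2, h₈, den_arr ω _ rfl, h₇, den_arr ω _ rfl,
        show s₆.var 2 = n + n by rw [h₆, den_var ω _ rfl, d2]]
    rw [hcap]
    refine ⟨fun u => ?_, fun u w huw => ?_, fun a ha b hb hne => ?_⟩
    · rw [hcaps.vertex u u.2]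
      have : s.arr 1 u ≠ 0 ↔ u ∈ D := by
        rw [ia1]
        exact ⟨fun ⟨u', h, h'⟩ => Fin.ext h' ▸ h, fun h => ⟨u, h, rfl⟩⟩
      simp only [this]
    · exact hcaps.arc u u.2 w w.2 (.inl u.2) ((ia0 u u.2 w w.2).2 ⟨u, w, rfl, rfl, huw⟩)
    · rcases hcaps.eq_zero a ha b hb hne with ⟨h, h'⟩ | ⟨a', ha', rfl, hb', hg⟩
      · exact .inl ⟨⟨a, h⟩, rfl, h'⟩
      · obtain ⟨u, v, rfl, rfl, huv⟩ := (ia0 a' ha' b hb').1 hg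
        exact .inr ⟨u, v, huv, rfl, rfl⟩
  · intro a
    rw [f₈ 2 (by decide)]
    exact ia2 a
  · rw [f₈ 3 (by decide), iz 3 (by decide)]
  · intro a
    rw [h₈, den_arr ω _ rfl, h₇, setRandom_spec ω, e0, f₆ 1 (by decide)]
    · have h1 := ia1 a
      have h1' := ia1' a
      constructor
      · intro h
        split_ifs at h with ha
        · refine ⟨⟨a, ha⟩, rfl, fun hD => ?_, ?_⟩
          · have := h1.2 ⟨_, hD, rfl⟩
            have := Bool.toNat_le (ω a)
            omega
          · cases hω : ω a
            · simp [hω] at h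
            · rfl
        · exact absurd rfl h
      · rintro ⟨u, rfl, hu, hω⟩
        have : s.arr 1 u = 0 := by
          by_contra hne
          obtain ⟨u', hu', h'⟩ := h1.1 hne
          exact hu (Fin.ext h' ▸ hu')
        rw [if_pos u.2, hω, this]
        simp
    · rw [h₆, den_pos ω _ rfl, h₅, den_pos ω _ rfl, h₄, den_pos ω _ rfl, h₃, den_pos ω _ rfl, h₂,
        den_pos ω _ rfl, h₁, den_pos ω _ rfl, ipos]
    · rw [f₆ 4 (by decide), iz 4 (by decide)]

end RandomSampling

namespace RandomSampling

open LoopProg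

/-! ### The algorithm -/

/-- The program of the algorithm. -/
def randomSet : LoopProg := .seq setup mainLoop

-- The interface between program and probability: the families precede the bits `ω`, and the output
-- is described by them alone. Members that arise from wrong guesses do no harm, because `good` only
-- admits genuine separators.
open Classical in
theorem exists_separators (n : ℕ) (G : Digraph (Fin n)) (D T : Finset (Fin n)) (p : ℕ) :
    ∃ 𝓕 : Fin n → Finset (Finset (Fin n)), (∀ v, (𝓕 v).card ≤ 4 ^ p) ∧
      (∀ v, ∀ F ∈ 𝓕 v, IsSeparator G D {v} T F) ∧
      (∀ v S, IsImportantSeparator G D {v} T S → S.card ≤ p → ∃ F ∈ 𝓕 v, F ⊆ S) ∧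
      ∀ (ω : ℕ → Bool) (v : Fin n), (randomSet.den ω (input n G D T p)).arr 3 v ≠ 0 ↔
        ∃ F ∈ 𝓕 v, ∀ x ∈ F, ω x = true := by
  have hp := isPrepared n G D T p fun _ => false
  have hlow (ω : ℕ → Bool) : LowEq [16] [4] (setup.den ω (input n G D T p))
    (setup.den (fun _ => false) (input n G D T p)) := secure_lowEq setup rfl (.refl _ _ _)
  generalize setup.den (fun _ => false) (input n G D T p) = t at hp hlow
  let ℓ (v : Fin n) (k : ℕ) : ℕ → ℕ := (t.setVar 7 v).finalLevels k
  let good (v : Fin n) (k : ℕ) : Prop := v ∉ T ∧ T.Nonempty ∧ ℓ v k (v + n) = 0 ∧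
    ∀ a < n + n, ∀ b < n + n, ℓ v k a = 0 → ℓ v k b ≠ 0 → t.cap a b ≠ 0 → ∃ u : Fin n, a = u ∧ u ∉ D
  have hready : ∀ v : Fin n, (t.setVar 7 v).Ready n v := fun v =>
    ⟨hp.var0, hp.var2, by simp, v.2, hp.offsets,
      hp.clean.arr7, hp.clean.arr8, hp.clean.arr9, hp.clean.arr10, hp.clean.arr11⟩
  have hsink : ∀ v k, ∀ u ∈ T, ℓ v k u ≠ 0 := fun v k u hu =>
    finalLevels_sink (hready v) k (a := u) (by
      have := hp.var2
      change (u : ℕ) < t.var 2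
      omega) ((hp.arr2 u).2 ⟨u, hu, rfl⟩)
  -- One member for each choice sequence whose final cut contains the out-node of `v` and is left
  -- only by arcs that start at deletable vertices.
  refine ⟨fun v => {k ∈ Finset.range (4 ^ min p n) | good v k}.image
    fun k => boundary fun a => ℓ v k a = 0, fun v => ?_, fun v F hF => ?_, fun v S hS hSp => ?_,
    fun ω v => ?_⟩
  · refine Finset.card_image_le.trans ((Finset.card_filter_le _ _).trans ?_)
    rw [Finset.card_range]
    exact Nat.pow_le_pow_right (by omega) (min_le_left _ _)
  · simp only [Finset.mem_image, Finset.mem_filter] at hF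
    obtain ⟨k, ⟨-, hvT, hT, hv, hA⟩, rfl⟩ := hF
    exact isSeparator_boundary hp.network hv hvT hT (hsink v k) hA
  · obtain ⟨A, hvA, hAT, hAc, hmax, hcross⟩ := hS.exists_cut hp.network
    have hsep := hS.1.1
    have h2 : (t.setVar 7 v).var 2 = n + n := hp.var2
    have h4 : (t.setVar 7 v).var 4 = 4 ^ min p n := hp.var4
    have hcap : (t.setVar 7 v).cap = t.cap := rfl
    have hsnk : (fun a => (t.setVar 7 v).arr 2 a ≠ 0) = fun a => ∃ u ∈ T, a = (u : ℕ) :=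
      funext fun a => propext (hp.arr2 a)
    obtain ⟨k, hk, hv, hA, hb⟩ := exists_finalLevels (hready v) (A := A) (L := min p n) hp.tables
      hp.var19 hvA (fun a _ ha => by
        obtain ⟨u, hu, rfl⟩ := (hp.arr2 a).1 ha
        exact hAT u hu)
      (by rw [h2, hcap, hsnk]; exact hmax)
      (by
        rw [h2, hcap]
        exact hAc.trans (le_min hSp (by simpa using Finset.card_le_univ S)))
      (min_le_right _ _) h4.ge
    rw [h2] at hA hb
    rw [h4] at hk
    -- Arcs out of the final cut also leave the cut of `S`, so they start at vertices of `S`.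
    have hcr : ∀ a < n + n, ∀ b < n + n, ℓ v k a = 0 → ℓ v k b ≠ 0 → t.cap a b ≠ 0 →
        ∃ u : Fin n, a = u ∧ u ∈ S := fun a ha b hb' h h' hc =>
      hcross a ha b hb' (hA a ha h) (hb a ha b hb' h h' hc) hc
    have hav := Finset.disjoint_left.1 hsep.avoids
    refine ⟨_, Finset.mem_image_of_mem _ (Finset.mem_filter.2 ⟨Finset.mem_range.2 hk, ?_,
      hsep.right_nonempty, hv, fun a ha b hb' h h' hc => ?_⟩), fun u hu => ?_⟩
    · exact Finset.disjoint_singleton_left.1 hsep.disjoint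
    · obtain ⟨u, hu, huS⟩ := hcr a ha b hb' h h' hc
      exact ⟨u, hu, fun hD => hav huS (by simp [hD])⟩
    · rw [mem_boundary] at hu
      obtain ⟨u', h, h'⟩ := hcr u (by omega) (u + n) (by omega) hu.1 hu.2
        (by rw [hp.network.vertex]; split_ifs <;> omega)
      exact Fin.ext h ▸ h'
  · have hq := isPrepared n G D T p ω
    replace hlow := hlow ω
    have hd : randomSet.den ω (input n G D T p) =
      mainLoop.den ω (setup.den ω (input n G D T p)) := by rw [randomSet, den]
    rw [hd]
    generalize setup.den ω (input n G D T p) = s at hq hlow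
    have hcap : s.cap = t.cap := by
      funext a b
      rw [State.cap, State.cap, hlow.var 2 (by decide), hlow.arr 6 (by decide)]
    rw [mainLoop_spec ω hq.var0 hq.var2 hq.offsets hq.clean hq.arr3 hp.clean hlow v.2, hcap, hq.var4,
      hq.var5]
    have h2 : s.arr 2 v = 0 ↔ v ∉ T := by
      rw [← not_iff_not, not_not, ← ne_eq, hq.arr2]
      exact ⟨fun ⟨u, hu, h⟩ => Fin.ext h ▸ hu, fun h => ⟨v, h, rfl⟩⟩
    rw [h2]
    simp only [Finset.mem_image, Finset.mem_filter, Finset.mem_range, exists_exists_and_eq_and,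
      mem_boundary]
    constructor
    · rintro ⟨hvT, hT, k, hk, hv, hA⟩
      refine ⟨k, ⟨hk, hvT, hT, hv, fun a ha b hb h h' hc => ?_⟩, fun u hu => ?_⟩
      · obtain ⟨u, hu, huD, -⟩ := (hq.arr4 a).1 (hA a ha b hb h h' hc)
        exact ⟨u, hu, huD⟩
      · obtain ⟨u', hu', -, h⟩ := (hq.arr4 u).1 (hA u (by omega) (u + n) (by omega) hu.1 hu.2
          (by rw [hp.network.vertex]; split_ifs <;> omega))
        rwa [hu']
    · rintro ⟨k, ⟨hk, hvT, hT, hv, hA⟩, hω⟩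
      refine ⟨hvT, hT, k, hk, hv, fun a ha b hb h h' hc => (hq.arr4 a).2 ?_⟩
      obtain ⟨u, rfl, huD⟩ := hA a ha b hb h h' hc
      refine ⟨u, rfl, huD, hω u ⟨h, ?_⟩⟩
      -- An arc that starts at an in-node is a vertex arc, so its tail belongs to the boundary,
      -- which lies in the random set.
      rcases hp.network.eq_zero u ha b hb hc with ⟨u', h1, rfl⟩ | ⟨u', -, -, h1, -⟩
      · rwa [← h1] at h'
      · omega

/-! ### The running time -/

open Polynomial in
/-- A bound for the running time up to the number of sequences of choices. -/
noncomputable def timeBound : ℕ[X] :=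
  (setSizes.cost + setChoices.cost + tablesStep.cost + C 14 + setGraph.cost +
    (LoopProg.rep 0 7 body).cost + C 14).comp (C 4 * X)

/-- Only the table construction and the main loop have a limit not bounded by 4n; both run 4^(min p
n) times, and they are not nested. All other limits are at most 4n, which explains the substitution
in `timeBound`. -/
theorem randomSet_runs (ω : ℕ → Bool) (n : ℕ) (G : Digraph (Fin n)) (D T : Finset (Fin n)) (p : ℕ) :
    randomSet.Runs ω (input n G D T p) (4 ^ p * timeBound.eval n) := by
  set s := input n G D T p with hs
  have i0 : s.var 0 = n := rfl
  have hq := isPrepared n G D T p ω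
  rw [← hs] at hq
  have hm : 4 ^ min p n ≤ 4 ^ p := Nat.pow_le_pow_right (by omega) (min_le_left _ _)
  set s₁ := setSizes.den ω s with h₁
  set s₂ := setChoices.den ω s₁ with h₂
  set s₃ := setTables.den ω s₂ with h₃
  have v0 : s₁.var 0 = n := by rw [h₁, setSizes_den]; simp [i0]
  have v2 : s₁.var 2 = n + n := by rw [h₁, setSizes_den]; simp [i0]
  have v3 : s₁.var 3 ≤ n := by rw [h₁, setSizes_den]; simp [i0]
  have hd : setup.den ω s = setGraph.den ω s₃ := rfl
  rw [hd] at hq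
  set s₄ := setGraph.den ω s₃ with h₄
  have w4 : s₂.var 4 = 4 ^ min p n := by
    rw [← hq.var4, h₄, den_var ω setGraph rfl, h₃, den_var ω setTables rfl]
  have r₁ := runs_cost ω (4 * n) setSizes rfl (fun l hl => by simp [setSizes, lims] at hl) s
    (fun l hl => by simp [setSizes, lims] at hl)
  have r₂ := runs_cost ω (4 * n) setChoices rfl (fixedLims_iff rfl) s₁
    (fun l hl => by simp [setChoices, lims] at hl; subst hl; omega)
  have r₃ : setTables.Runs ω s₂ _ := Runs.rep (c := tablesStep.cost.eval (4 * n)) rfl rfl (by decide)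
    fun i _ => runs_cost ω (4 * n) tablesStep rfl (fun l hl => by simp [tablesStep, lims] at hl) _
      (fun l hl => by simp [tablesStep, lims] at hl)
  have r₄ := runs_cost ω (4 * n) setGraph rfl (fixedLims_iff rfl) s₃ (by
    have : ∀ l ∈ setGraph.lims, l = 0 ∨ l = 2 := by decide
    intro l hl
    rcases this l hl with rfl | rfl
    · rw [h₃, den_var ω setTables rfl, h₂, den_var ω setChoices rfl]; omega
    · rw [h₃, den_var ω setTables rfl, h₂, den_var ω setChoices rfl]; omega)
  have r₅ : mainLoop.Runs ω s₄ _ := Runs.rep (c := (LoopProg.rep 0 7 body).cost.eval (4 * n))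
    (by simp [wv, body_wv]) (by simp [wv, body_wv]) (by decide)
    fun i _ => by
      have hl : ∀ l ∈ (LoopProg.rep 0 7 body).lims, l = 0 ∨ l = 2 ∨ l = 19 := by decide +kernel
      have hw : ∀ l ∈ (LoopProg.rep 0 7 body).lims, (LoopProg.rep 0 7 body).wv l = false ∧ l ≠ 6 := by
        intro l h
        rcases hl l h with rfl | rfl | rfl <;> simp [wv, body_wv]
      refine runs_cost ω (4 * n) _ (by decide +kernel) (fun l h => (hw l h).1) _ fun l h => ?_
      rw [traj_var ω _ (hw l h).1 (hw l h).2]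
      rcases hl l h with rfl | rfl | rfl
      · rw [hq.var0]; omega
      · rw [hq.var2]; omega
      · rw [hq.var19]; omega
  rw [w4] at r₃
  rw [hq.var4] at r₅
  refine ((r₁.seq (r₂.seq (r₃.seq r₄))).seq r₅).mono ?_
  simp only [timeBound, Polynomial.eval_comp, Polynomial.eval_add, Polynomial.eval_mul,
    Polynomial.eval_C, Polynomial.eval_X]
  have h1 : 1 ≤ 4 ^ p := Nat.one_le_pow _ _ (by omega)
  generalize 4 ^ min p n = m at hm
  generalize 4 ^ p = M at hm h1
  generalize setSizes.cost.eval (4 * n) = e₁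
  generalize setChoices.cost.eval (4 * n) = e₂
  generalize tablesStep.cost.eval (4 * n) = e₃
  generalize setGraph.cost.eval (4 * n) = e₄
  generalize (LoopProg.rep 0 7 body).cost.eval (4 * n) = e₅
  have := Nat.mul_le_mul_right (e₃ + 8) hm
  have := Nat.mul_le_mul_right (e₅ + 8) hm
  have := Nat.mul_le_mul_right (e₁ + e₂ + e₄ + 12) h1
  linarith [mul_add M (e₁ + e₂ + e₄ + 12) (e₃ + e₅ + 16), mul_add M (e₃ + 8) (e₅ + 8)]

end RandomSampling

namespace RandomSampling

open LoopProg

/-! ### The probability of success -/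

theorem fairBits_cylinder (I : Finset ℕ) (b : ℕ → Bool) :
    fairBits.real {ω | ∀ i ∈ I, ω i = b i} = (1 / 2) ^ I.card := by
  have h : {ω : ℕ → Bool | ∀ i ∈ I, ω i = b i} = Set.pi I fun i => {b i} := by
    ext ω
    simp [Set.mem_pi]
  have h2 (x : Bool) : (PMF.uniformOfFintype Bool).toMeasure {x} = 2⁻¹ := by
    rw [PMF.toMeasure_apply_singleton _ _ (measurableSet_singleton x)]
    simp
  rw [h, MeasureTheory.measureReal_def, fairBits,
    MeasureTheory.Measure.infinitePi_pi _ fun _ _ => measurableSet_singleton _]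
  simp [h2]

theorem IsSeparator.mono {V : Type*} [DecidableEq V] {G : Digraph V} {D X Y S S' : Finset V}
    (h : IsSeparator G D X Y S) (hS : S ⊆ S') (hS' : Disjoint S' (X ∪ Y ∪ D)) :
    IsSeparator G D X Y S' := by
  refine ⟨h.left_nonempty, h.right_nonempty, h.disjoint, hS', fun y hy hr => h.separates y hy ?_⟩
  obtain ⟨x, hx, hxS, hp⟩ := hr
  exact ⟨x, hx, fun h => hxS (hS h), Relation.ReflTransGen.mono (fun a b hab =>
    ⟨hab.1, fun h => hab.2.1 (hS h), fun h => hab.2.2 (hS h)⟩) _ _ hp⟩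

/-- The random set contains `S` and misses a vertex of every member of the families of the vertices
of `S` with a probability that is not too small. -/
theorem le_fairBits {n : ℕ} {𝓕 : Fin n → Finset (Finset (Fin n))} {S Y : Finset (Fin n)} {p : ℕ}
    (hcard : ∀ v, (𝓕 v).card ≤ 4 ^ p) (hS : S.card ≤ p) (hn : ∀ v ∈ S, ∀ F ∈ 𝓕 v, ¬ F ⊆ S)
    (hY : ∀ v ∈ Y, ∃ F ∈ 𝓕 v, F ⊆ S) :
    ((1 : ℝ) / 2) ^ (2 ^ (4 * p)) ≤ fairBits.real {ω |
      (∀ v ∈ S, ¬ ∃ F ∈ 𝓕 v, ∀ x ∈ F, ω x = true) ∧ ∀ v ∈ Y, ∃ F ∈ 𝓕 v, ∀ x ∈ F, ω x = true} := by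
  have : ∀ v ∈ S, ∀ F ∈ 𝓕 v, ∃ x : ℕ, ∃ u : Fin n, x = u ∧ u ∈ F ∧ u ∉ S := fun v hv F hF => by
    obtain ⟨u, hu⟩ := Finset.not_subset.1 (hn v hv F hF)
    exact ⟨u, u, rfl, hu⟩
  choose! f hf using this
  -- The prescribed coins: those of `S`, and for each v ∈ S and F ∈ 𝓕 v that of one vertex of F
  -- outside `S`.
  set I := S.map Fin.valEmbedding ∪ S.biUnion fun v => (𝓕 v).image (f v) with hI
  have hIc : I.card ≤ 2 ^ (4 * p) := by
    have h1 : (S.biUnion fun v => (𝓕 v).image (f v)).card ≤ p * 4 ^ p :=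
      (Finset.card_biUnion_le_card_mul _ _ _ fun v _ => Finset.card_image_le.trans (hcard v)).trans
        (Nat.mul_le_mul_right _ hS)
    have h2 : I.card ≤ p + p * 4 ^ p :=
      (Finset.card_union_le _ _).trans (by rw [Finset.card_map]; omega)
    have h3 : p < 2 ^ p := Nat.lt_two_pow_self
    have h4 : (2 : ℕ) ^ (4 * p) = 2 ^ p * (2 ^ p * 4 ^ p) := by
      rw [show (4 : ℕ) = 2 ^ 2 from rfl, ← pow_mul, ← pow_add, ← pow_add]
      congr 1
      omega
    have h5 : 1 ≤ 4 ^ p := Nat.one_le_pow _ _ (by omega)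
    -- For p ≥ 1 use p < 2^p and 1 + 4^p ≤ 2·4^p ≤ 2^p·4^p.
    have h6 : p * (1 + 4 ^ p) ≤ 2 ^ p * (2 ^ p * 4 ^ p) := by
      rcases Nat.eq_zero_or_pos p with rfl | hp
      · omega
      · exact Nat.mul_le_mul h3.le (by nlinarith)
    rw [h4]
    linarith
  calc ((1 : ℝ) / 2) ^ (2 ^ (4 * p)) ≤ (1 / 2) ^ I.card :=
        pow_le_pow_of_le_one (by norm_num) (by norm_num) hIc
    -- The prescribed pattern is the indicator of `S`; it is consistent because all the other chosen
    -- vertices lie outside `S`.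
    _ = fairBits.real {ω | ∀ i ∈ I, ω i = decide (i ∈ S.map Fin.valEmbedding)} :=
        (fairBits_cylinder _ _).symm
    _ ≤ _ := by
      have : MeasureTheory.IsProbabilityMeasure fairBits := by
        unfold fairBits
        infer_instance
      refine MeasureTheory.measureReal_mono fun ω hω => ?_
      have hin : ∀ u ∈ S, ω u = true := fun u hu => by
        rw [hω u (Finset.mem_union_left _ (Finset.mem_map_of_mem Fin.valEmbedding hu)),
          decide_eq_true_eq]
        exact Finset.mem_map_of_mem Fin.valEmbedding hu
      refine ⟨fun v hv ⟨F, hF, h⟩ => ?_, fun v hv => ?_⟩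
      · obtain ⟨u, hu, huF, huS⟩ := hf v hv F hF
        have h1 := hω (f v F) (Finset.mem_union_right _
          (Finset.mem_biUnion.2 ⟨v, hv, Finset.mem_image_of_mem _ hF⟩))
        rw [hu, h u huF, eq_comm, decide_eq_true_eq] at h1
        exact huS ((Finset.mem_map' Fin.valEmbedding).1 h1)
      · obtain ⟨F, hF, h⟩ := hY v hv
        exact ⟨F, hF, fun x hx => hin x (h hx)⟩

end RandomSampling

/-! ### The random sampling theorem -/

theorem mainTheorem3 :
    ∃ (RandomSet : RandomSampling.Prog) (q : Polynomial ℕ) (c : ℕ),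
      ∀ (n : ℕ) (G : Digraph (Fin n)) (D T : Finset (Fin n)) (p : ℕ), T ⊆ D →
        ∃ Z : (ℕ → Bool) → Finset (Fin n),
          (∀ ω, RandomSampling.ReturnsWithin RandomSet ω (RandomSampling.input n G D T p)
            (4 ^ p * q.eval n) (Z ω)) ∧
          (∀ W : Finset (Fin n), MeasurableSet {ω | Z ω = W}) ∧
          (∀ ω, Disjoint (Z ω) T) ∧
          ∀ S Y : Finset (Fin n), Disjoint S D → RandomSampling.IsThin G D T S → S.card ≤ p →
            (∀ v ∈ Y, ∃ S' ⊆ S, RandomSampling.IsImportantSeparator G D {v} T S') →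
              ((1 : ℝ) / 2) ^ (2 ^ (c * p)) ≤
                RandomSampling.fairBits.real {ω | Disjoint S (Z ω) ∧ Y ⊆ Z ω} := by
  classical
  refine ⟨RandomSampling.randomSet.compile, RandomSampling.timeBound, 4, fun n G D T p hTD => ?_⟩
  obtain ⟨𝓕, hcard, hsep, himp, hret⟩ := RandomSampling.exists_separators n G D T p
  refine ⟨fun ω => {v | ∃ F ∈ 𝓕 v, ∀ x ∈ F, ω x = true}, fun ω => ?_, fun W => ?_, fun ω => ?_,
    fun S Y hSD hthin hS hY => ?_⟩
  · obtain ⟨k, hk, hE⟩ := RandomSampling.randomSet_runs ω n G D T p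
    exact ⟨k, hk, _, hE, fun v => by rw [hret]; simp⟩
  -- The output depends only on the first n bits, a measurable map into a finite discrete space.
  · have : Measurable fun (ω : ℕ → Bool) (i : Fin n) => ω i :=
      measurable_pi_lambda _ fun i => measurable_pi_apply _
    exact this (MeasurableSet.of_discrete
      (s := {b : Fin n → Bool | ({v | ∃ F ∈ 𝓕 v, ∀ x ∈ F, b x = true} : Finset (Fin n)) = W}))
  · rw [Finset.disjoint_left]
    intro v hv hvT
    simp only [Finset.mem_filter, Finset.mem_univ, true_and] at hv
    obtain ⟨F, hF, -⟩ := hv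
    exact Finset.disjoint_singleton_left.1 (hsep v F hF).disjoint hvT
  · have hn : ∀ v ∈ S, ∀ F ∈ 𝓕 v, ¬ F ⊆ S := fun v hv F hF hFS => by
      have h := hsep v F hF
      have hvF : v ∉ F := fun hvF => Finset.disjoint_left.1 h.avoids hvF (by simp)
      -- A separator of `v` avoids `v`, so F ⊆ S gives F ⊆ S \ {v}. The larger set is an admissible
      -- separator too, as `S` avoids the undeletable vertices and thus the terminals.
      refine hthin v hv (h.mono (Finset.subset_erase.2 ⟨hFS, hvF⟩) ?_)
      rw [Finset.disjoint_left]
      intro u hu hu'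
      rw [Finset.mem_erase] at hu
      have huD := Finset.disjoint_left.1 hSD hu.2
      simp only [Finset.mem_union, Finset.mem_singleton] at hu'
      rcases hu' with (h' | h') | h'
      exacts [hu.1 h', huD (hTD h'), huD h']
    have hY' : ∀ v ∈ Y, ∃ F ∈ 𝓕 v, F ⊆ S := fun v hv => by
      obtain ⟨S', hS', h⟩ := hY v hv
      obtain ⟨F, hF, hFS⟩ := himp v S' h ((Finset.card_le_card hS').trans hS)
      exact ⟨F, hF, hFS.trans hS'⟩
    refine (RandomSampling.le_fairBits hcard hS hn hY').trans_eq ?_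
    congr 1
    ext ω
    simp [Finset.disjoint_left, Finset.subset_iff]
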